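/- Let $d\ge 2$, let $\Omega\subseteq\mathbb{R}^d$ be a bounded simplicial Lipschitz domain (a bounded, connected, non-empty open set with Lipschitz boundary whose closure is the space of a finite simplicial complex), let $0<T<\infty$, $I=(0,T)$ and $Q_T=I\times\Omega$. For a measurable set $M$, let $\mathcal{P}^\infty(M)$ be the set of measurable $p\colon M\to\mathbb{R}$ with $p\ge 1$ a.e. in $M$ and $p^+:=\operatorname{ess\,sup}_M p<\infty$; put $p^-:=\operatorname{ess\,inf}_M p$. For $p\in\mathcal{P}^\infty(M)$, let $L^{p(\cdot)}(M;\mathbb{R}^\ell)$ be the space of measurable $u\colon M\to\mathbb{R}^\ell$ with $\int_M|u(z)|^{p(z)}\,dz<\infty$, with the Luxembourg norm $\|u\|_{p(\cdot),M}=\inf\{\lambda>0:\int_M|u(z)/\lambda|^{p(z)}\,dz\le 1\}$. Write $r\prec p$ in $M$ if there is $\varepsilon>0$ with $r+\varepsilon\le p$ a.e. in $M$. Write $p\in\mathcal{P}^{\log}(Q_T)$ if $p\in\mathcal{P}^\infty(Q_T)$ and there is $c>0$ with $|p(z)-p(\tilde z)|\le c/(-\ln|z-\tilde z|)$ for all $z,\tilde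 z\in Q_T$ with $0<|z-\tilde z|\le\frac12$. Let $\mathbf{D}_x u$ be the symmetric part of the distributional spatial gradient of $u$. For $q,p\in\mathcal{P}^\infty(\Omega)$, let $E_0^{q(\cdot),p(\cdot)}$ be the closure of $C_c^\infty(\Omega;\mathbb{R}^d)$ in $\{u\in L^{q(\cdot)}(\Omega;\mathbb{R}^d):\mathbf{D}_x u\in L^{p(\cdot)}(\Omega;\mathbb{R}^{d\times d}_{\mathrm{sym}})\}$ with respect to the norm $\|u\|_{q(\cdot),\Omega}+\|\mathbf{D}_xu\|_{p(\cdot),\Omega}$. For $q,p\in\mathcal{P}^\infty(Q_T)$, let $\mathcal{U}^{q,p}$ be the space of all $u\in L^{q(\cdot,\cdot)}(Q_T;\mathbb{R}^d)$ with $\mathbf{D}_xu\in L^{p(\cdot,\cdot)}(Q_T;\mathbb{R}^{d\times d}_{\mathrm{sym}})$ and $u(t)\in E_0^{q(t,\cdot),p(t,\cdot)}$ for a.e. $t\in I$, with the norm $\|u\|_{\mathcal{U}^{q,p}}=\|u\|_{q(\cdot,\cdot),Q_T}+\|\mathbf{D}_xu\|_{p(\cdot,\cdot),Q_T}$. **Proposition.**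 Let $q,p\in\mathcal{P}^{\log}(Q_T)$ with $q^-,p^->1$, and let $(q_n)_{n\in\mathbb{N}},(p_n)_{n\in\mathbb{N}}\subseteq\mathcal{P}^\infty(Q_T)$ satisfy $q_n\to q$ and $p_n\to p$ in $L^\infty(Q_T)$ as $n\to\infty$. Let $u_n\in\mathcal{U}^{q_n,p_n}$, $n\in\mathbb{N}$, satisfy $\sup_{n\in\mathbb{N}}\|u_n\|_{\mathcal{U}^{q_n,p_n}}<\infty$. Then there exist a subsequence $(u_{n_k})_{k\in\mathbb{N}}$ and a limit $u\in\mathcal{U}^{q,p}$ such that for all $r,s\in\mathcal{P}^\infty(Q_T)$ with $r\prec q$ and $s\prec p$ in $Q_T$, one has $u_{n_k}\in\mathcal{U}^{r,s}$ for all sufficiently large $k$, $u\in\mathcal{U}^{r,s}$, and $$u_{n_k}\rightharpoonup u\quad\text{weakly in }\mathcal{U}^{r,s}\quad(k\to\infty).$$ -/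

import Mathlib

open MeasureTheory Filter Topology
open scoped ContDiff ENNReal NNReal

namespace VarBochner

/-! ### Euclidean data -/

/-- `ℝ^d` with the Euclidean norm. -/
abbrev Vec (d : ℕ) : Type := EuclideanSpace ℝ (Fin d)

/-- `d × d` matrices with the Frobenius norm `|A|² = ∑ i j, A i j ^ 2`. -/
abbrev Tensor (d : ℕ) : Type := EuclideanSpace ℝ (Fin d × Fin d)

/-- The time-space cylinder `Q_T = (0,T) × Ω`. -/
def cylinder {d : ℕ} (T : ℝ) (Ω : Set (Vec d)) : Set (ℝ × Vec d) :=
  Set.Ioo 0 T ×ˢ Ω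

/-- The Euclidean distance `|z - w|` of two points of `ℝ^(1+d)` (the norm that Mathlib puts on
the product `ℝ × ℝ^d` is the maximum norm). -/
noncomputable def euclDist {d : ℕ} (z w : ℝ × Vec d) : ℝ :=
  Real.sqrt ((z.1 - w.1) ^ 2 + ‖z.2 - w.2‖ ^ 2)

/-- `Ω` has Lipschitz boundary: near each boundary point, for a suitable unit vector `ν`, the set
`Ω` is the strict epigraph (in direction `ν`) of a Lipschitz function of the coordinates
orthogonal to `ν`. -/
def HasLipschitzBoundary {d : ℕ} (Ω : Set (Vec d)) : Prop :=
  ∀ x₀ ∈ frontier Ω, ∃ ν : Vec d, ‖ν‖ = 1 ∧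
    ∃ (γ : Vec d → ℝ) (L : ℝ≥0), LipschitzWith L γ ∧
      ∃ ρ > 0, ∀ x ∈ Metric.ball x₀ ρ,
        (x ∈ Ω ↔ γ (x - inner ℝ ν x • ν) < inner ℝ ν x)

/-- A bounded simplicial Lipschitz domain: a non-empty, open, connected, bounded set with
Lipschitz boundary whose closure is triangulated by a finite simplicial complex. -/
structure IsSimplicialLipschitzDomain {d : ℕ} (Ω : Set (Vec d)) : Prop where
  isOpen : IsOpen Ω
  isConnected : IsConnected Ω
  isBounded : Bornology.IsBounded Ω
  lipschitz : HasLipschitzBoundary Ω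
  simplicial : ∃ K : Geometry.SimplicialComplex ℝ (Vec d),
    K.faces.Finite ∧ K.space = closure Ω

/-! ### Variable exponents and variable Lebesgue spaces

Elements of function spaces over a set `M` are represented by functions on the ambient space; only
their restriction to `M`, up to equality almost everywhere, matters. -/

section Lebesgue

variable {X : Type*} [MeasureSpace X] {F : Type*} [NormedAddCommGroup F] [NormedSpace ℝ F]

/-- `p ∈ 𝒫^∞(M)`: `p` is (Lebesgue) measurable on `M`, `p ≥ 1` a.e. in `M`, and `p` is
essentially bounded above in `M`. -/
structure IsBddExponent (M : Set X) (p : X → ℝ) : Prop where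
  aemeasurable : AEMeasurable p (volume.restrict M)
  one_le : ∀ᵐ z ∂(volume.restrict M), 1 ≤ p z
  bdd : ∃ b : ℝ, ∀ᵐ z ∂(volume.restrict M), p z ≤ b

/-- `r ≺ p` in `M`: there is `ε > 0` such that `r + ε ≤ p` a.e. in `M`. -/
def StrictlyBelow (M : Set X) (r p : X → ℝ) : Prop :=
  ∃ ε > 0, ∀ᵐ z ∂(volume.restrict M), r z + ε ≤ p z

/-- The modular `ρ_{p(·),M}(u) = ∫_M |u(z)|^{p(z)} dz`. -/
noncomputable def modular (M : Set X) (p : X → ℝ) (u : X → F) : ℝ≥0∞ :=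
  ∫⁻ z in M, ENNReal.ofReal (‖u z‖ ^ p z)

/-- `u ∈ L^{p(·)}(M; F)`: `u` is (Lebesgue) measurable on `M` and has finite modular. -/
def MemVarLebesgue (M : Set X) (p : X → ℝ) (u : X → F) : Prop :=
  AEStronglyMeasurable u (volume.restrict M) ∧ modular M p u < ⊤

/-- The Luxembourg norm `‖u‖_{p(·),M} = inf {λ > 0 | ρ_{p(·),M}(u/λ) ≤ 1}`. -/
noncomputable def luxNorm (M : Set X) (p : X → ℝ) (u : X → F) : ℝ :=
  sInf {l : ℝ | 0 < l ∧ modular M p (fun z => l⁻¹ • u z) ≤ 1}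

end Lebesgue

/-! ### Log-Hölder continuous exponents on the time-space cylinder -/

/-- `p ∈ 𝒫^log(Q)`: `p` is a bounded variable exponent that is log-Hölder continuous in `Q`. -/
structure IsLogExponent {d : ℕ} (Q : Set (ℝ × Vec d)) (p : ℝ × Vec d → ℝ) : Prop where
  isBddExponent : IsBddExponent Q p
  logHolder : ∃ c > 0, ∀ z ∈ Q, ∀ w ∈ Q, 0 < euclDist z w → euclDist z w ≤ 1 / 2 →
    |p z - p w| ≤ c / (-Real.log (euclDist z w))

/-! ### Weak symmetric gradients -/

section WeakDerivative

variable {X : Type*} [NormedAddCommGroup X] [NormedSpace ℝ X] [MeasureSpace X] {d : ℕ}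

/-- `G = D_x u` in the open set `M`, in the sense of distributions: `u` and `G` are locally
integrable in `M` and for all `i, j` and all real-valued `φ ∈ C_c^∞(M)`,
`∫_M ½ (u_i ∂_j φ + u_j ∂_i φ) = - ∫_M G_ij φ`. The vectors `e j : X`, `j = 1, …, d`, are the
directions of the spatial partial derivatives `∂_j`. -/
structure HasWeakSymGrad (e : Fin d → X) (M : Set X) (u : X → Vec d) (G : X → Tensor d) :
    Prop where
  locallyIntegrable : LocallyIntegrableOn u M
  locallyIntegrable_grad : LocallyIntegrableOn G M
  integral_eq : ∀ φ : X → ℝ, ContDiff ℝ (⊤ : ℕ∞) φ → HasCompactSupport φ → tsupport φ ⊆ M →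
    ∀ i j : Fin d,
      ∫ z in M, (1 / 2 : ℝ) * (u z i * fderiv ℝ φ z (e j) + u z j * fderiv ℝ φ z (e i))
        = - ∫ z in M, G z (i, j) * φ z

open Classical in
/-- The weak symmetric gradient `D_x u` in `M` (unique a.e. in the open set `M` if it exists;
zero by convention if it does not exist). -/
noncomputable def weakSymGrad (e : Fin d → X) (M : Set X) (u : X → Vec d) : X → Tensor d :=
  if h : ∃ G : X → Tensor d, HasWeakSymGrad e M u G then h.choose else 0

/-- `u ∈ L^{q(·)}(M; ℝ^d)` with `D_x u ∈ L^{p(·)}(M; ℝ^{d×d}_sym)`. (The tensor `D_x u` is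
automatically symmetric a.e. in `M`.) -/
def MemSymSobolev (e : Fin d → X) (M : Set X) (q p : X → ℝ) (u : X → Vec d) : Prop :=
  MemVarLebesgue M q u ∧ ∃ G : X → Tensor d, HasWeakSymGrad e M u G ∧ MemVarLebesgue M p G

/-- The norm `‖u‖_{q(·),M} + ‖D_x u‖_{p(·),M}`. -/
noncomputable def symSobolevNorm (e : Fin d → X) (M : Set X) (q p : X → ℝ) (u : X → Vec d) : ℝ :=
  luxNorm M q u + luxNorm M p (weakSymGrad e M u)

end WeakDerivative

/-- The coordinate directions of `ℝ^d`. -/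
noncomputable def spaceDir {d : ℕ} (j : Fin d) : Vec d := EuclideanSpace.single j 1

/-- The spatial coordinate directions of `ℝ × ℝ^d`. -/
noncomputable def cylDir {d : ℕ} (j : Fin d) : ℝ × Vec d := (0, EuclideanSpace.single j 1)

/-! ### The spaces -/

/-- `u ∈ E_0^{q(·),p(·)}`: `u` belongs to
`E^{q(·),p(·)} = {u ∈ L^{q(·)}(Ω; ℝ^d) | D_x u ∈ L^{p(·)}(Ω; ℝ^{d×d}_sym)}` and lies in the
closure of `C_c^∞(Ω; ℝ^d)` with respect to the norm of that space. -/
def MemSymSobolevZero {d : ℕ} (Ω : Set (Vec d)) (q p : Vec d → ℝ) (u : Vec d → Vec d) : Prop :=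
  MemSymSobolev spaceDir Ω q p u ∧
    ∀ ε > 0, ∃ φ : Vec d → Vec d, ContDiff ℝ (⊤ : ℕ∞) φ ∧ HasCompactSupport φ ∧ tsupport φ ⊆ Ω ∧
      symSobolevNorm spaceDir Ω q p (u - φ) < ε

/-- The variable Bochner–Lebesgue space `𝒰^{q,p}`: all `u ∈ L^{q(·,·)}(Q_T; ℝ^d)` with
`D_x u ∈ L^{p(·,·)}(Q_T; ℝ^{d×d}_sym)` and `u(t) ∈ E_0^{q(t,·),p(t,·)}` for a.e. `t ∈ (0,T)`. -/
def bochnerSpace {d : ℕ} (T : ℝ) (Ω : Set (Vec d)) (q p : ℝ × Vec d → ℝ) :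
    Set (ℝ × Vec d → Vec d) :=
  {u | MemSymSobolev cylDir (cylinder T Ω) q p u ∧
    ∀ᵐ t ∂(volume.restrict (Set.Ioo 0 T)),
      MemSymSobolevZero Ω (fun x => q (t, x)) (fun x => p (t, x)) (fun x => u (t, x))}

/-- The norm `‖u‖_{𝒰^{q,p}} = ‖u‖_{q(·,·),Q_T} + ‖D_x u‖_{p(·,·),Q_T}`. -/
noncomputable def bochnerNorm {d : ℕ} (T : ℝ) (Ω : Set (Vec d)) (q p : ℝ × Vec d → ℝ)
    (u : ℝ × Vec d → Vec d) : ℝ :=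
  symSobolevNorm cylDir (cylinder T Ω) q p u

/-! ### Weak convergence -/

/-- `ℓ` restricts to an element of the topological dual of the space `(U, N)`, where `U` is a
linear subspace of `V` and `N` its norm: `ℓ` is linear on `U` and bounded with respect to `N`. The
values of `ℓ` off `U` are irrelevant. (Elements of `U` that are equal in the sense `N (v - w) = 0`
are not distinguished by `ℓ`.) -/
structure IsBoundedLinearOn {V : Type*} [AddCommGroup V] [Module ℝ V] (U : Set V) (N : V → ℝ)
    (ℓ : V → ℝ) : Prop where
  map_add : ∀ v ∈ U, ∀ w ∈ U, ℓ (v + w) = ℓ v + ℓ w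
  map_smul : ∀ (c : ℝ), ∀ v ∈ U, ℓ (c • v) = c * ℓ v
  bound : ∃ C : ℝ, ∀ v ∈ U, |ℓ v| ≤ C * N v

/-- `v k ⇀ w` in `(U, N)` as `k → ∞`: all but finitely many `v k`, and `w`, belong to `U`, and
`ℓ (v k) → ℓ w` for every element `ℓ` of the topological dual of `(U, N)`. -/
def WeaklyTendstoIn {V : Type*} [AddCommGroup V] [Module ℝ V] (U : Set V) (N : V → ℝ)
    (v : ℕ → V) (w : V) : Prop :=
  (∀ᶠ k in atTop, v k ∈ U) ∧ w ∈ U ∧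
    ∀ ℓ : V → ℝ, IsBoundedLinearOn U N ℓ → Tendsto (fun k => ℓ (v k)) atTop (𝓝 (ℓ w))

end VarBochner

set_option linter.unusedSectionVars false

/-! Weak compactness is obtained without representing any dual space. Take a constant `a'` strictly
between 1 and the essential infima of q and p. The pairs (u_n, D_x u_n) are eventually bounded in
L^{a'}(Q_T), so a subsequence has a weak L^1 limit g = (u, G). This limit is recorded in Mazur's
form: g lies in the L^1 closure of every convex set that the subsequence visits infinitely often
(`exists_subseq_mem_closure_convex`). The conclusions follow by choosing convex sets.

Integrability: modular balls are convex, and the modular bound available for exponents r strictly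
below q does not depend on r. Closedness in L^1 followed by Fatou's lemma as r increases to q gives
u in L^q, and likewise G in L^p (`modular_le_of_forall_strictlyBelow`).

Zero boundary values: "the extension by zero of G is the symmetric gradient of the extension by zero
of u" (`HasZeroSymGrad`) is a linear condition on almost every time slice, stable under L^1
convergence and free of exponents. It has to be converted back into membership of the closure of
C_c^∞, and this is where log-Hölder continuity and the Lipschitz boundary enter
(`HasZeroSymGrad.hasSmoothApprox`): localize by a partition of unity, shift each piece into Ω and
mollify. Mollification converges in L^{p(·)} by the log-Hölder averaging estimate
`IsAveraging.exists_rpow_le`. A cut-off χ creates a term ∇χ ⊗ u which must lie in L^{p(·)} although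
u is only known to lie in L^{q(·)}. A Poincaré inequality for the symmetric gradient
(`HasZeroSymGrad.memVarLebesgue`) supplies this.

Weak convergence: let ℓ be a bounded functional on 𝒰^{r,s}. If ℓ(u_n) ≥ b > ℓ(u) infinitely often,
intersect the convex set {ℓ ≥ b} with modular balls for the exponents r + ε and s + ε. The points of
the intersection that approach g in L^1 then converge in the norm of 𝒰^{r,s} by interpolation, and
so ℓ(u) ≥ b, a contradiction (`eventually_lt_of_isBoundedLinearOn`). -/

namespace VarBochner

/-! ### Modulars and the Luxembourg norm. -/

section Modular

variable {X : Type*} [MeasureSpace X] {F : Type*} [NormedAddCommGroup F] [NormedSpace ℝ F]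
  {M : Set X} {p q r : X → ℝ} {u v : X → F} {b : ℝ}

lemma modular_eq_lintegral (hp : ∀ᵐ z ∂(volume.restrict M), 1 ≤ p z) (u : X → F) :
    modular M p u = ∫⁻ z in M, ‖u z‖ₑ ^ p z := by
  refine lintegral_congr_ae ?_
  filter_upwards [hp] with z hz
  rw [← ofReal_norm, ENNReal.ofReal_rpow_of_nonneg (norm_nonneg _) (by linarith)]

lemma modular_congr (h : u =ᵐ[volume.restrict M] v) : modular M p u = modular M p v := by
  refine lintegral_congr_ae ?_
  filter_upwards [h] with z hz
  rw [hz]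

lemma luxNorm_congr (h : u =ᵐ[volume.restrict M] v) : luxNorm M p u = luxNorm M p v := by
  unfold luxNorm
  have : ∀ l : ℝ, modular M p (fun z => l⁻¹ • u z) = modular M p (fun z => l⁻¹ • v z) := by
    intro l
    refine modular_congr ?_
    filter_upwards [h] with z hz
    rw [hz]
  simp only [this]

lemma aemeasurable_enorm_rpow (hp : AEMeasurable p (volume.restrict M))
    (hu : AEStronglyMeasurable u (volume.restrict M)) :
    AEMeasurable (fun z => ‖u z‖ₑ ^ p z) (volume.restrict M) :=
  hu.enorm.pow hp

lemma modular_add_le (hp : IsBddExponent M p) (hb : ∀ᵐ z ∂(volume.restrict M), p z ≤ b)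
    (hu : AEStronglyMeasurable u (volume.restrict M)) :
    modular M p (u + v) ≤ ENNReal.ofReal (2 ^ b) * (modular M p u + modular M p v) := by
  rw [modular_eq_lintegral hp.one_le, modular_eq_lintegral hp.one_le,
    modular_eq_lintegral hp.one_le,
    ← lintegral_add_left' (aemeasurable_enorm_rpow hp.aemeasurable hu),
    ← lintegral_const_mul' _ _ ENNReal.ofReal_ne_top]
  refine lintegral_mono_ae ?_
  filter_upwards [hp.one_le, hb] with z h1 h2
  calc ‖(u + v) z‖ₑ ^ p z ≤ (‖u z‖ₑ + ‖v z‖ₑ) ^ p z :=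
        ENNReal.rpow_le_rpow (enorm_add_le _ _) (by linarith)
    _ ≤ 2 ^ (p z - 1) * (‖u z‖ₑ ^ p z + ‖v z‖ₑ ^ p z) :=
        ENNReal.rpow_add_le_mul_rpow_add_rpow _ _ h1
    _ ≤ ENNReal.ofReal (2 ^ b) * (‖u z‖ₑ ^ p z + ‖v z‖ₑ ^ p z) := by
        gcongr
        rw [← ENNReal.ofReal_rpow_of_pos two_pos]
        simp only [ENNReal.ofReal_ofNat]
        exact ENNReal.rpow_le_rpow_of_exponent_le (by norm_num) (by linarith)

lemma modular_smul_le (hp : ∀ᵐ z ∂(volume.restrict M), 1 ≤ p z)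
    (hb : ∀ᵐ z ∂(volume.restrict M), p z ≤ b) (c : ℝ) (u : X → F) :
    modular M p (c • u) ≤ ENNReal.ofReal (max 1 |c| ^ b) * modular M p u := by
  unfold modular
  rw [← lintegral_const_mul' _ _ ENNReal.ofReal_ne_top]
  refine lintegral_mono_ae ?_
  filter_upwards [hp, hb] with z h1 h2
  rw [← ENNReal.ofReal_mul (by positivity)]
  refine ENNReal.ofReal_le_ofReal ?_
  rw [Pi.smul_apply, norm_smul, Real.mul_rpow (norm_nonneg _) (norm_nonneg _), Real.norm_eq_abs]
  gcongr
  calc |c| ^ p z ≤ max 1 |c| ^ p z := by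
        refine Real.rpow_le_rpow (abs_nonneg _) (le_max_right _ _) (by linarith)
    _ ≤ max 1 |c| ^ b := Real.rpow_le_rpow_of_exponent_le (le_max_left _ _) h2

/-- Scaling down by a factor `l ≤ 1` decreases the modular at least linearly. -/
lemma modular_smul_le_of_le_one (hp : ∀ᵐ z ∂(volume.restrict M), 1 ≤ p z) {l : ℝ} (hl : 0 ≤ l)
    (hl1 : l ≤ 1) (u : X → F) : modular M p (l • u) ≤ ENNReal.ofReal l * modular M p u := by
  unfold modular
  rw [← lintegral_const_mul' _ _ ENNReal.ofReal_ne_top]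
  refine lintegral_mono_ae ?_
  filter_upwards [hp] with z h1
  rw [← ENNReal.ofReal_mul hl]
  refine ENNReal.ofReal_le_ofReal ?_
  rw [Pi.smul_apply, norm_smul, Real.mul_rpow (norm_nonneg _) (norm_nonneg _),
    Real.norm_of_nonneg hl]
  gcongr
  rcases hl.eq_or_lt with h | h
  · rw [← h, Real.zero_rpow (by linarith)]
  · calc l ^ p z ≤ l ^ (1 : ℝ) := Real.rpow_le_rpow_of_exponent_ge h hl1 h1
      _ = l := Real.rpow_one l

lemma MemVarLebesgue.add (hp : IsBddExponent M p) (hu : MemVarLebesgue M p u)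
    (hv : MemVarLebesgue M p v) : MemVarLebesgue M p (u + v) := by
  obtain ⟨b, hb⟩ := hp.bdd
  refine ⟨hu.1.add hv.1, (modular_add_le hp hb hu.1).trans_lt ?_⟩
  exact ENNReal.mul_lt_top ENNReal.ofReal_lt_top (ENNReal.add_lt_top.2 ⟨hu.2, hv.2⟩)

lemma MemVarLebesgue.const_smul (hp : IsBddExponent M p) (hu : MemVarLebesgue M p u) (c : ℝ) :
    MemVarLebesgue M p (c • u) := by
  obtain ⟨b, hb⟩ := hp.bdd
  exact ⟨hu.1.const_smul c, (modular_smul_le hp.one_le hb c u).trans_lt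
    (ENNReal.mul_lt_top ENNReal.ofReal_lt_top hu.2)⟩

lemma MemVarLebesgue.sub (hp : IsBddExponent M p) (hu : MemVarLebesgue M p u)
    (hv : MemVarLebesgue M p v) : MemVarLebesgue M p (u - v) := by
  have : u - v = u + (-1 : ℝ) • v := by simp [sub_eq_add_neg]
  rw [this]
  exact hu.add hp (hv.const_smul hp _)

lemma MemVarLebesgue.congr (hu : MemVarLebesgue M p u) (h : u =ᵐ[volume.restrict M] v) :
    MemVarLebesgue M p v :=
  ⟨hu.1.congr h, by rw [← modular_congr h]; exact hu.2⟩

/-- Lowering the exponent on a set of finite measure, quantitatively. -/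
lemma modular_le_of_exponent_le (hr : ∀ᵐ z ∂(volume.restrict M), 1 ≤ r z)
    (hrq : ∀ᵐ z ∂(volume.restrict M), r z ≤ q z) (hb : ∀ᵐ z ∂(volume.restrict M), q z ≤ b)
    {η : ℝ} (hη : 0 < η) (hη1 : η ≤ 1) (u : X → F) :
    modular M r u ≤ ENNReal.ofReal η * volume M + ENNReal.ofReal (1 + η⁻¹ ^ b) * modular M q u := by
  unfold modular
  rw [← lintegral_const_mul' _ _ ENNReal.ofReal_ne_top, ← setLIntegral_const,
    ← lintegral_add_left measurable_const]
  refine lintegral_mono_ae ?_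
  filter_upwards [hr, hrq, hb] with z h1 h2 h3
  rw [← ENNReal.ofReal_mul (by positivity), ← ENNReal.ofReal_add hη.le (by positivity)]
  refine ENNReal.ofReal_le_ofReal ?_
  have hη' : 1 ≤ η⁻¹ := (one_le_inv₀ hη).2 hη1
  have hn := norm_nonneg (u z)
  have hq0 : 0 ≤ ‖u z‖ ^ q z := by positivity
  have hb0 : 0 ≤ η⁻¹ ^ b := by positivity
  -- Three ranges: for ‖u‖ ≥ 1 the power grows with the exponent; for η ≤ ‖u‖ < 1 the left side is
  -- at most 1 ≤ (‖u‖/η)^q; for ‖u‖ < η it is at most η. A free η makes the constant term as small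
  -- as desired, which convergence to zero needs.
  rcases le_or_gt 1 ‖u z‖ with h | h
  · have : ‖u z‖ ^ r z ≤ ‖u z‖ ^ q z := Real.rpow_le_rpow_of_exponent_le h h2
    nlinarith [mul_nonneg hb0 hq0]
  · rcases le_or_gt η ‖u z‖ with h' | h'
    · have e1 : ‖u z‖ ^ r z ≤ 1 := Real.rpow_le_one hn h.le (by linarith)
      have e2 : 1 ≤ (η⁻¹ * ‖u z‖) ^ q z := by
        refine Real.one_le_rpow ?_ (by linarith)
        rw [inv_mul_eq_div, one_le_div hη]
        exact h'
      have e3 : (η⁻¹ * ‖u z‖) ^ q z ≤ η⁻¹ ^ b * ‖u z‖ ^ q z := by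
        rw [Real.mul_rpow (by positivity) hn]
        gcongr
      nlinarith
    · have e1 : ‖u z‖ ^ r z ≤ ‖u z‖ := by
        rcases hn.eq_or_lt with h0 | h0
        · rw [← h0, Real.zero_rpow (by linarith)]
        · calc ‖u z‖ ^ r z ≤ ‖u z‖ ^ (1 : ℝ) :=
                Real.rpow_le_rpow_of_exponent_ge h0 h.le h1
            _ = _ := Real.rpow_one _
      nlinarith [mul_nonneg hb0 hq0]

lemma MemVarLebesgue.mono_exponent (hM : volume M ≠ ⊤) (hq : IsBddExponent M q)
    (hr : ∀ᵐ z ∂(volume.restrict M), 1 ≤ r z)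
    (hrq : ∀ᵐ z ∂(volume.restrict M), r z ≤ q z) (hu : MemVarLebesgue M q u) :
    MemVarLebesgue M r u := by
  obtain ⟨b, hb⟩ := hq.bdd
  refine ⟨hu.1, (modular_le_of_exponent_le hr hrq hb one_pos le_rfl u).trans_lt ?_⟩
  exact ENNReal.add_lt_top.2 ⟨ENNReal.mul_lt_top ENNReal.ofReal_lt_top hM.lt_top,
    ENNReal.mul_lt_top ENNReal.ofReal_lt_top hu.2⟩

lemma modular_one (M : Set X) (u : X → F) : modular M 1 u = ∫⁻ z in M, ‖u z‖ₑ := by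
  rw [modular_eq_lintegral (by simp)]
  simp

lemma MemVarLebesgue.integrableOn (hM : volume M ≠ ⊤) (hq : IsBddExponent M q)
    (hu : MemVarLebesgue M q u) : IntegrableOn u M := by
  have := hu.mono_exponent hM hq (r := 1) (by simp) hq.one_le
  refine ⟨this.1, ?_⟩
  rw [hasFiniteIntegral_iff_enorm, ← modular_one]
  exact this.2

lemma memVarLebesgue_of_bound (hM : volume M ≠ ⊤) (hq : IsBddExponent M q)
    (hu : AEStronglyMeasurable u (volume.restrict M)) {C : ℝ}
    (hC : ∀ᵐ z ∂(volume.restrict M), ‖u z‖ ≤ C) : MemVarLebesgue M q u := by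
  obtain ⟨b, hb⟩ := hq.bdd
  refine ⟨hu, ?_⟩
  calc modular M q u ≤ ∫⁻ _ in M, ENNReal.ofReal (max 1 C ^ b) := by
        refine lintegral_mono_ae ?_
        filter_upwards [hC, hq.one_le, hb] with z h0 h1 h2
        refine ENNReal.ofReal_le_ofReal ?_
        calc ‖u z‖ ^ q z ≤ max 1 C ^ q z :=
              Real.rpow_le_rpow (norm_nonneg _) (h0.trans (le_max_right _ _)) (by linarith)
          _ ≤ max 1 C ^ b := Real.rpow_le_rpow_of_exponent_le (le_max_left _ _) h2
    _ < ⊤ := by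
        rw [setLIntegral_const]
        exact ENNReal.mul_lt_top ENNReal.ofReal_lt_top hM.lt_top

/-- The set in the definition of the Luxembourg norm is non-empty. -/
lemma luxNorm_set_nonempty (hp : IsBddExponent M p) (hu : MemVarLebesgue M p u) :
    {l : ℝ | 0 < l ∧ modular M p (fun z => l⁻¹ • u z) ≤ 1}.Nonempty := by
  set A := (modular M p u).toReal
  have hA : modular M p u = ENNReal.ofReal A := (ENNReal.ofReal_toReal hu.2.ne).symm
  have hA0 : 0 ≤ A := ENNReal.toReal_nonneg
  -- With A the modular of `u`, scaling by (A + 1)⁻¹ ≤ 1 shrinks the modular at least linearly, to A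
  -- / (A + 1) ≤ 1.
  refine ⟨A + 1, by positivity, ?_⟩
  calc modular M p ((A + 1)⁻¹ • u) ≤ ENNReal.ofReal (A + 1)⁻¹ * modular M p u :=
        modular_smul_le_of_le_one hp.one_le (by positivity) (inv_le_one_of_one_le₀ (by linarith)) u
    _ ≤ 1 := by
        rw [hA, ← ENNReal.ofReal_mul (by positivity), ← ENNReal.ofReal_one]
        refine ENNReal.ofReal_le_ofReal ?_
        rw [inv_mul_le_iff₀ (by positivity)]
        linarith

lemma luxNorm_nonneg (M : Set X) (p : X → ℝ) (u : X → F) : 0 ≤ luxNorm M p u :=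
  Real.sInf_nonneg fun _ h => h.1.le

lemma luxNorm_le {l : ℝ} (hl : 0 < l) (h : modular M p (l⁻¹ • u) ≤ 1) : luxNorm M p u ≤ l :=
  csInf_le ⟨0, fun _ h => h.1.le⟩ ⟨hl, h⟩

lemma exists_lt_of_luxNorm_lt (hp : IsBddExponent M p) (hu : MemVarLebesgue M p u) {ε : ℝ}
    (h : luxNorm M p u < ε) : ∃ l, 0 < l ∧ l < ε ∧ modular M p (l⁻¹ • u) ≤ 1 := by
  obtain ⟨l, hl, hlt⟩ := exists_lt_of_csInf_lt (luxNorm_set_nonempty hp hu) h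
  exact ⟨l, hl.1, hlt, hl.2⟩

lemma modular_le_of_luxNorm_lt (hp : IsBddExponent M p) (hu : MemVarLebesgue M p u) {ε : ℝ}
    (hε : ε ≤ 1) (h : luxNorm M p u < ε) : modular M p u ≤ ENNReal.ofReal ε := by
  obtain ⟨l, h0, h1, h2⟩ := exists_lt_of_luxNorm_lt hp hu h
  calc modular M p u = modular M p (l • (l⁻¹ • u)) := by rw [smul_inv_smul₀ h0.ne']
    _ ≤ ENNReal.ofReal l * modular M p (l⁻¹ • u) :=
        modular_smul_le_of_le_one hp.one_le h0.le (by linarith) _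
    _ ≤ ENNReal.ofReal l * 1 := by gcongr
    _ ≤ ENNReal.ofReal ε := by rw [mul_one]; exact ENNReal.ofReal_le_ofReal h1.le

lemma modular_le_of_luxNorm_le (hp : IsBddExponent M p)
    (hb : ∀ᵐ z ∂(volume.restrict M), p z ≤ b) (hb0 : 0 ≤ b) (hu : MemVarLebesgue M p u) {K : ℝ}
    (h : luxNorm M p u ≤ K) : modular M p u ≤ ENNReal.ofReal ((K + 1) ^ b) := by
  have hK : 0 ≤ K := (luxNorm_nonneg M p u).trans h
  obtain ⟨l, h0, h1, h2⟩ := exists_lt_of_luxNorm_lt hp hu (h.trans_lt (lt_add_one K))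
  calc modular M p u = modular M p (l • (l⁻¹ • u)) := by rw [smul_inv_smul₀ h0.ne']
    _ ≤ ENNReal.ofReal (max 1 |l| ^ b) * modular M p (l⁻¹ • u) :=
        modular_smul_le hp.one_le hb _ _
    _ ≤ ENNReal.ofReal ((K + 1) ^ b) * 1 := by
        gcongr
        rw [abs_of_pos h0]
        exact max_le (by linarith) h1.le
    _ = _ := mul_one _

lemma luxNorm_le_of_modular_le (hp : ∀ᵐ z ∂(volume.restrict M), 1 ≤ p z)
    (hb : ∀ᵐ z ∂(volume.restrict M), p z ≤ b) {ε : ℝ} (hε : 0 < ε)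
    (h : modular M p u ≤ ENNReal.ofReal ((max 1 ε⁻¹ ^ b)⁻¹)) : luxNorm M p u ≤ ε := by
  refine luxNorm_le hε ?_
  refine (modular_smul_le hp hb _ _).trans ?_
  rw [abs_of_pos (by positivity : 0 < ε⁻¹)]
  have : 0 < max 1 ε⁻¹ ^ b := by positivity
  calc _ ≤ ENNReal.ofReal (max 1 ε⁻¹ ^ b) * ENNReal.ofReal ((max 1 ε⁻¹ ^ b)⁻¹) := by gcongr
    _ = 1 := by
      rw [← ENNReal.ofReal_mul this.le, mul_inv_cancel₀ this.ne', ENNReal.ofReal_one]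

/-- Boundedness of the exponent is essential: it allows a fixed dilation 1/ε to cost only a constant
factor in the modular. -/
lemma tendsto_luxNorm_of_tendsto_modular {ι : Type*} {l : Filter ι} (hp : IsBddExponent M p)
    {w : ι → X → F} (h : Tendsto (fun i => modular M p (w i)) l (𝓝 0)) :
    Tendsto (fun i => luxNorm M p (w i)) l (𝓝 0) := by
  obtain ⟨b, hb⟩ := hp.bdd
  rw [Metric.tendsto_nhds]
  intro ε hε
  have hδ : (0 : ℝ≥0∞) < ENNReal.ofReal ((max 1 (ε / 2)⁻¹ ^ b)⁻¹) := by
    rw [ENNReal.ofReal_pos]; positivity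
  filter_upwards [h.eventually (ge_mem_nhds hδ)] with i hi
  have := luxNorm_le_of_modular_le hp.one_le hb (half_pos hε) hi
  rw [Real.dist_eq, sub_zero, abs_of_nonneg (luxNorm_nonneg _ _ _)]
  linarith

lemma tendsto_modular_of_exponent_le {ι : Type*} {l : Filter ι} (hM : volume M ≠ ⊤)
    (hq : IsBddExponent M q) (hr : ∀ᵐ z ∂(volume.restrict M), 1 ≤ r z)
    (hrq : ∀ᵐ z ∂(volume.restrict M), r z ≤ q z) {w : ι → X → F}
    (h : Tendsto (fun i => modular M q (w i)) l (𝓝 0)) :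
    Tendsto (fun i => modular M r (w i)) l (𝓝 0) := by
  obtain ⟨b, hb⟩ := hq.bdd
  rw [ENNReal.tendsto_nhds_zero]
  intro ε hε
  have hA : ∃ η : ℝ, 0 < η ∧ η ≤ 1 ∧ ENNReal.ofReal η * volume M ≤ ε / 2 := by
    have : Tendsto (fun η : ℝ => ENNReal.ofReal η * volume M) (𝓝[>] 0) (𝓝 0) := by
      have h1 : Tendsto (fun η : ℝ => ENNReal.ofReal η) (𝓝[>] 0) (𝓝 0) := by
        have := (ENNReal.continuous_ofReal.tendsto 0)
        rw [ENNReal.ofReal_zero] at this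
        exact this.mono_left nhdsWithin_le_nhds
      simpa using ENNReal.Tendsto.mul_const h1 (Or.inr hM)
    have h2 := this.eventually (ge_mem_nhds (ENNReal.half_pos hε.ne'))
    obtain ⟨η, h3, h4⟩ := (h2.and (Ioc_mem_nhdsGT (zero_lt_one (α := ℝ)))).exists
    exact ⟨η, h4.1, h4.2, h3⟩
  obtain ⟨η, hη, hη1, h1⟩ := hA
  have h2 : Tendsto (fun i => ENNReal.ofReal (1 + η⁻¹ ^ b) * modular M q (w i)) l (𝓝 0) := by
    simpa using ENNReal.Tendsto.const_mul h (Or.inr ENNReal.ofReal_ne_top)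
  filter_upwards [h2.eventually (ge_mem_nhds (ENNReal.half_pos hε.ne'))] with i hi
  calc _ ≤ _ := modular_le_of_exponent_le hr hrq hb hη hη1 (w i)
    _ ≤ ε / 2 + ε / 2 := add_le_add h1 hi
    _ = ε := ENNReal.add_halves ε

/-- Interpolation: convergence in `L^1` and a bound for a strictly larger exponent. -/
lemma tendsto_modular_of_tendsto_lintegral {ι : Type*} {l : Filter ι} {ε : ℝ} (hε : 0 < ε)
    (hr : IsBddExponent M r) {w : ι → X → F}
    (hw : ∀ i, AEStronglyMeasurable (w i) (volume.restrict M))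
    (h : Tendsto (fun i => ∫⁻ z in M, ‖w i z‖ₑ) l (𝓝 0)) {C : ℝ≥0∞} (hC : C ≠ ⊤)
    (hbd : ∀ᶠ i in l, modular M (fun z => r z + ε) (w i) ≤ C) :
    Tendsto (fun i => modular M r (w i)) l (𝓝 0) := by
  obtain ⟨b, hb⟩ := hr.bdd
  -- Split at height N: below it ‖w‖^r ≤ N^b ‖w‖, above it ‖w‖^r ≤ N^{-ε} ‖w‖^{r+ε}. The second term
  -- is made small by N, uniformly in the index, and then the first by L^1 convergence.
  have key : ∀ N : ℝ, 1 ≤ N → ∀ i, modular M r (w i) ≤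
      ENNReal.ofReal (N ^ b) * (∫⁻ z in M, ‖w i z‖ₑ) +
        ENNReal.ofReal (N ^ (-ε)) * modular M (fun z => r z + ε) (w i) := by
    intro N hN i
    unfold modular
    rw [← lintegral_const_mul' _ _ ENNReal.ofReal_ne_top,
      ← lintegral_const_mul' _ _ ENNReal.ofReal_ne_top,
      ← lintegral_add_left' ((hw i).enorm.const_mul _)]
    refine lintegral_mono_ae ?_
    filter_upwards [hr.one_le, hb] with z h1 h2
    rw [← ofReal_norm, ← ENNReal.ofReal_mul (by positivity),
      ← ENNReal.ofReal_mul (by positivity), ← ENNReal.ofReal_add (by positivity) (by positivity)]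
    refine ENNReal.ofReal_le_ofReal ?_
    have hn := norm_nonneg (w i z)
    rcases le_or_gt ‖w i z‖ N with h | h
    · have : ‖w i z‖ ^ r z ≤ N ^ b * ‖w i z‖ := by
        rcases hn.eq_or_lt with h0 | h0
        · rw [← h0, Real.zero_rpow (by linarith), mul_zero]
        · calc ‖w i z‖ ^ r z = ‖w i z‖ ^ (r z - 1) * ‖w i z‖ := by
                rw [Real.rpow_sub_one h0.ne']; field_simp
            _ ≤ N ^ (r z - 1) * ‖w i z‖ := by gcongr
            _ ≤ N ^ b * ‖w i z‖ := by gcongr; linarith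
      have : 0 ≤ N ^ (-ε) * ‖w i z‖ ^ (r z + ε) := by positivity
      linarith
    · have h0 : 0 < ‖w i z‖ := by linarith
      have : ‖w i z‖ ^ r z ≤ N ^ (-ε) * ‖w i z‖ ^ (r z + ε) := by
        rw [Real.rpow_add h0, mul_left_comm, Real.rpow_neg (by linarith)]
        refine le_mul_of_one_le_right (by positivity) ?_
        rw [inv_mul_eq_div, one_le_div (by positivity)]
        gcongr
      have : 0 ≤ N ^ b * ‖w i z‖ := by positivity
      linarith
  rw [ENNReal.tendsto_nhds_zero]
  intro δ hδ
  have hN : ∃ N : ℝ, 1 ≤ N ∧ ENNReal.ofReal (N ^ (-ε)) * C ≤ δ / 2 := by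
    have h1 : Tendsto (fun N : ℝ => ENNReal.ofReal (N ^ (-ε)) * C) atTop (𝓝 0) := by
      have := ENNReal.tendsto_ofReal (tendsto_rpow_neg_atTop hε)
      rw [ENNReal.ofReal_zero] at this
      simpa using ENNReal.Tendsto.mul_const this (Or.inr hC)
    obtain ⟨N, h3, h4⟩ := ((h1.eventually (ge_mem_nhds (ENNReal.half_pos hδ.ne'))).and
      (eventually_ge_atTop 1)).exists
    exact ⟨N, h4, h3⟩
  obtain ⟨N, hN, hNC⟩ := hN
  have h2 : Tendsto (fun i => ENNReal.ofReal (N ^ b) * ∫⁻ z in M, ‖w i z‖ₑ) l (𝓝 0) := by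
    simpa using ENNReal.Tendsto.const_mul h (Or.inr ENNReal.ofReal_ne_top)
  filter_upwards [h2.eventually (ge_mem_nhds (ENNReal.half_pos hδ.ne')), hbd] with i hi hi'
  calc _ ≤ _ := key N hN i
    _ ≤ δ / 2 + δ / 2 := add_le_add hi (le_trans (by gcongr) hNC)
    _ = δ := ENNReal.add_halves δ

end Modular


/-! ### Algebra, uniqueness and closedness of the weak symmetric gradient. -/

section WeakGradient

lemma LocallyIntegrableOn.coord {X : Type*} [TopologicalSpace X] [MeasurableSpace X]
    {μ : Measure X} {ι : Type*} [Fintype ι] {f : X → EuclideanSpace ℝ ι} {M : Set X}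
    (hf : LocallyIntegrableOn f M μ) (i : ι) : LocallyIntegrableOn (fun z => f z i) M μ :=
  (EuclideanSpace.proj i : EuclideanSpace ℝ ι →L[ℝ] ℝ).locallyIntegrableOn_comp hf

lemma Integrable.coord {X : Type*} [MeasurableSpace X]
    {μ : Measure X} {ι : Type*} [Fintype ι] {f : X → EuclideanSpace ℝ ι}
    (hf : Integrable f μ) (i : ι) : Integrable (fun z => f z i) μ :=
  (EuclideanSpace.proj i : EuclideanSpace ℝ ι →L[ℝ] ℝ).integrable_comp hf

variable {X : Type*} [NormedAddCommGroup X] [NormedSpace ℝ X] [MeasureSpace X] [BorelSpace X]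
  {d : ℕ} {e : Fin d → X} {M : Set X} {u v : X → Vec d} {G H : X → Tensor d}

lemma LocallyIntegrableOn.integrable_mul_of_tsupport_subset {f g : X → ℝ}
    (hf : LocallyIntegrableOn f M) (hg : Continuous g) (hgc : HasCompactSupport g)
    (hgM : tsupport g ⊆ M) : Integrable (fun z => f z * g z) (volume.restrict M) := by
  have h1 : IntegrableOn f (tsupport g) := hf.integrableOn_compact_subset hgM hgc
  have h2 : IntegrableOn (fun z => f z * g z) (tsupport g) :=
    h1.mul_continuousOn hg.continuousOn hgc
  have h3 : Function.support (fun z => f z * g z) ⊆ tsupport g := fun z hz =>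
    subset_tsupport g (right_ne_zero_of_mul hz)
  exact ((integrableOn_iff_integrable_of_support_subset h3).1 h2).restrict

lemma continuous_fderiv_apply_const {φ : X → ℝ} (hφ : ContDiff ℝ (⊤ : ℕ∞) φ) (a : X) :
    Continuous fun z => fderiv ℝ φ z a :=
  (hφ.continuous_fderiv (by simp)).clm_apply continuous_const

lemma tsupport_fderiv_apply_const_subset (φ : X → ℝ) (a : X) :
    tsupport (fun z => fderiv ℝ φ z a) ⊆ tsupport φ :=
  (tsupport_comp_subset (g := fun L : X →L[ℝ] ℝ => L a) (by simp) _).trans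
    (tsupport_fderiv_subset ℝ)

lemma LocallyIntegrableOn.integrable_mul_fderiv {f φ : X → ℝ} (hf : LocallyIntegrableOn f M)
    (hφ : ContDiff ℝ (⊤ : ℕ∞) φ) (hc : HasCompactSupport φ) (hM : tsupport φ ⊆ M) (a : X) :
    Integrable (fun z => f z * fderiv ℝ φ z a) (volume.restrict M) :=
  LocallyIntegrableOn.integrable_mul_of_tsupport_subset hf (continuous_fderiv_apply_const hφ a)
    (hc.fderiv_apply ℝ a) ((tsupport_fderiv_apply_const_subset φ a).trans hM)

/-- The integrand on the left-hand side of the weak formulation of the symmetric gradient. -/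
noncomputable def symPairing (e : Fin d → X) (u : X → Vec d) (φ : X → ℝ) (i j : Fin d) (z : X) :
    ℝ :=
  (1 / 2 : ℝ) * (u z i * fderiv ℝ φ z (e j) + u z j * fderiv ℝ φ z (e i))

lemma symPairing_add (φ : X → ℝ) (i j : Fin d) :
    symPairing e (u + v) φ i j = symPairing e u φ i j + symPairing e v φ i j := by
  ext z; simp [symPairing]; ring

lemma symPairing_smul (c : ℝ) (φ : X → ℝ) (i j : Fin d) :
    symPairing e (c • u) φ i j = c • symPairing e u φ i j := by
  ext z; simp [symPairing]; ring

lemma LocallyIntegrableOn.integrable_symPairing (hu : LocallyIntegrableOn u M)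
    {φ : X → ℝ} (hφ : ContDiff ℝ (⊤ : ℕ∞) φ) (hc : HasCompactSupport φ) (hM : tsupport φ ⊆ M)
    (i j : Fin d) : Integrable (symPairing e u φ i j) (volume.restrict M) :=
  ((LocallyIntegrableOn.integrable_mul_fderiv (LocallyIntegrableOn.coord hu i) hφ hc hM _).add
    (LocallyIntegrableOn.integrable_mul_fderiv (LocallyIntegrableOn.coord hu j) hφ hc hM _)).const_mul _

lemma HasWeakSymGrad.add (hu : HasWeakSymGrad e M u G) (hv : HasWeakSymGrad e M v H) :
    HasWeakSymGrad e M (u + v) (G + H) where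
  locallyIntegrable := hu.1.add hv.1
  locallyIntegrable_grad := hu.2.add hv.2
  integral_eq φ hφ hc hM i j := by
    change ∫ z in M, symPairing e (u + v) φ i j z = _
    rw [symPairing_add]
    have h1 : ∫ z in M, (G + H) z (i, j) * φ z
        = (∫ z in M, G z (i, j) * φ z) + ∫ z in M, H z (i, j) * φ z := by
      rw [← integral_add]
      · congr 1; ext z; simp; ring
      · exact LocallyIntegrableOn.integrable_mul_of_tsupport_subset
          (LocallyIntegrableOn.coord hu.2 _) hφ.continuous hc hM
      · exact LocallyIntegrableOn.integrable_mul_of_tsupport_subset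
          (LocallyIntegrableOn.coord hv.2 _) hφ.continuous hc hM
    rw [h1, neg_add, ← hu.integral_eq φ hφ hc hM i j, ← hv.integral_eq φ hφ hc hM i j]
    exact integral_add (LocallyIntegrableOn.integrable_symPairing hu.1 hφ hc hM i j)
      (LocallyIntegrableOn.integrable_symPairing hv.1 hφ hc hM i j)

lemma HasWeakSymGrad.const_smul (hu : HasWeakSymGrad e M u G) (c : ℝ) :
    HasWeakSymGrad e M (c • u) (c • G) where
  locallyIntegrable := hu.1.smul c
  locallyIntegrable_grad := hu.2.smul c
  integral_eq φ hφ hc hM i j := by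
    change ∫ z in M, symPairing e (c • u) φ i j z = _
    rw [symPairing_smul]
    have h1 : ∫ z in M, (c • G) z (i, j) * φ z = c * ∫ z in M, G z (i, j) * φ z := by
      rw [← integral_const_mul]
      congr 1; ext z; simp; ring
    rw [h1, ← mul_neg, ← hu.integral_eq φ hφ hc hM i j]
    exact integral_const_mul c _

lemma HasWeakSymGrad.sub (hu : HasWeakSymGrad e M u G) (hv : HasWeakSymGrad e M v H) :
    HasWeakSymGrad e M (u - v) (G - H) := by
  have := hu.add (hv.const_smul (-1))
  simpa [sub_eq_add_neg] using this

/-- The weak symmetric gradient in an open set is unique. -/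
lemma HasWeakSymGrad.ae_unique [FiniteDimensional ℝ X] (hM : IsOpen M)
    (hu : HasWeakSymGrad e M u G) (hv : HasWeakSymGrad e M u H) :
    G =ᵐ[volume.restrict M] H := by
  have key : ∀ k : Fin d × Fin d, ∀ᵐ z, z ∈ M → G z k - H z k = 0 := by
    rintro ⟨i, j⟩
    refine hM.ae_eq_zero_of_integral_contDiff_smul_eq_zero
      ((LocallyIntegrableOn.coord hu.2 _).sub (LocallyIntegrableOn.coord hv.2 _)) ?_
    intro g hg hc hgM
    have h1 : ∀ K : X → Tensor d, ∫ z in M, K z (i, j) * g z = ∫ z, K z (i, j) * g z := by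
      intro K
      refine setIntegral_eq_integral_of_forall_compl_eq_zero fun z hz => ?_
      rw [image_eq_zero_of_notMem_tsupport fun h => hz (hgM h), mul_zero]
    have h2 := hu.integral_eq g hg hc hgM i j
    rw [hv.integral_eq g hg hc hgM i j, neg_inj, h1, h1] at h2
    have hs : ∀ K : X → Tensor d, LocallyIntegrableOn K M →
        Integrable (fun z => K z (i, j) * g z) := by
      intro K hK
      have := LocallyIntegrableOn.integrable_mul_of_tsupport_subset
        (LocallyIntegrableOn.coord hK (i, j)) hg.continuous hc hgM
      refine (integrableOn_iff_integrable_of_support_subset ?_).1 this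
      intro z hz
      exact hgM (subset_tsupport g (right_ne_zero_of_mul hz))
    calc ∫ z, g z • (G z (i, j) - H z (i, j))
        = ∫ z, (G z (i, j) * g z - H z (i, j) * g z) := by
          congr 1; ext z; rw [smul_eq_mul]; ring
      _ = 0 := by rw [integral_sub (hs G hu.2) (hs H hv.2), h2, sub_self]
  have : ∀ᵐ z, ∀ k : Fin d × Fin d, z ∈ M → G z k - H z k = 0 := ae_all_iff.2 key
  rw [EventuallyEq, ae_restrict_iff' hM.measurableSet]
  filter_upwards [this] with z hz hzM
  ext k
  exact sub_eq_zero.1 (hz k hzM)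

lemma HasWeakSymGrad.weakSymGrad_ae_eq [FiniteDimensional ℝ X] (hM : IsOpen M)
    (hu : HasWeakSymGrad e M u G) : weakSymGrad e M u =ᵐ[volume.restrict M] G := by
  have h : ∃ G : X → Tensor d, HasWeakSymGrad e M u G := ⟨G, hu⟩
  rw [weakSymGrad, dif_pos h]
  exact h.choose_spec.ae_unique hM hu

lemma symSobolevNorm_eq [FiniteDimensional ℝ X] (hM : IsOpen M) {q p : X → ℝ}
    (hu : HasWeakSymGrad e M u G) :
    symSobolevNorm e M q p u = luxNorm M q u + luxNorm M p G := by
  rw [symSobolevNorm, luxNorm_congr (hu.weakSymGrad_ae_eq hM)]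

lemma Integrable.coord_mul {Y ι : Type*} [MeasurableSpace Y] [Fintype ι] {μ : Measure Y}
    {f : Y → EuclideanSpace ℝ ι} (hf : Integrable f μ) {g : Y → ℝ}
    (hg : AEStronglyMeasurable g μ) {C : ℝ} (hC : ∀ z, |g z| ≤ C) (k : ι) :
    Integrable (fun z => f z k * g z) μ :=
  (Integrable.coord hf k).mul_bdd hg (ae_of_all _ hC)

lemma tendsto_integral_coord_mul {Y ι κ : Type*} [MeasurableSpace Y] [Fintype ι] {μ : Measure Y}
    {l : Filter κ} {f : Y → EuclideanSpace ℝ ι} {F : κ → Y → EuclideanSpace ℝ ι}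
    (hf : Integrable f μ) (hF : ∀ n, Integrable (F n) μ)
    (hlim : Tendsto (fun n => ∫⁻ z, ‖F n z - f z‖ₑ ∂μ) l (𝓝 0)) {g : Y → ℝ}
    (hg : AEStronglyMeasurable g μ) {C : ℝ} (hC : ∀ z, |g z| ≤ C) (k : ι) :
    Tendsto (fun n => ∫ z, F n z k * g z ∂μ) l (𝓝 (∫ z, f z k * g z ∂μ)) := by
  refine tendsto_integral_of_L1 _ (Integrable.coord_mul hf hg hC k).1
    (Eventually.of_forall fun n => Integrable.coord_mul (hF n) hg hC k) ?_
  have h0 : Tendsto (fun n => (∫⁻ z, ‖F n z - f z‖ₑ ∂μ) * ENNReal.ofReal C) l (𝓝 0) := by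
    simpa using ENNReal.Tendsto.mul_const hlim (Or.inr ENNReal.ofReal_ne_top)
  refine tendsto_of_tendsto_of_tendsto_of_le_of_le tendsto_const_nhds h0
    (fun _ => zero_le) fun n => ?_
  dsimp only
  rw [← lintegral_mul_const' _ _ ENNReal.ofReal_ne_top]
  refine lintegral_mono fun z => ?_
  have h1 : F n z k * g z - f z k * g z = (F n z - f z) k * g z := by
    simp; ring
  rw [h1, enorm_mul]
  gcongr
  · rw [enorm_le_iff_norm_le]
    exact PiLp.norm_apply_le _ _
  · rw [← ofReal_norm]
    exact ENNReal.ofReal_le_ofReal (hC z)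

lemma exists_bound_fderiv_apply {φ : X → ℝ} (hφ : ContDiff ℝ (⊤ : ℕ∞) φ)
    (hc : HasCompactSupport φ) (a : X) : ∃ C, ∀ z, |fderiv ℝ φ z a| ≤ C :=
  (continuous_fderiv_apply_const hφ a).bounded_above_of_compact_support (hc.fderiv_apply ℝ a)

/-- The weak formulation for one test function passes to limits in `L^1`. -/
lemma integral_symPairing_eq_of_tendsto {κ : Type*} {l : Filter κ} [l.NeBot]
    [SecondCountableTopology X]
    {w : κ → X → Vec d} {K : κ → X → Tensor d}
    (hwi : ∀ k, IntegrableOn (w k) M)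
    (hKi : ∀ k, IntegrableOn (K k) M) (hu : IntegrableOn u M) (hG : IntegrableOn G M)
    (hlim : Tendsto (fun k => ∫⁻ z in M, ‖w k z - u z‖ₑ) l (𝓝 0))
    (hlim' : Tendsto (fun k => ∫⁻ z in M, ‖K k z - G z‖ₑ) l (𝓝 0))
    {φ : X → ℝ} (hφ : ContDiff ℝ (⊤ : ℕ∞) φ) (hc : HasCompactSupport φ) {i j : Fin d}
    (h : ∀ k, ∫ z in M, symPairing e (w k) φ i j z = -∫ z in M, K k z (i, j) * φ z) :
    ∫ z in M, symPairing e u φ i j z = -∫ z in M, G z (i, j) * φ z := by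
  obtain ⟨C, hC⟩ := hφ.continuous.bounded_above_of_compact_support hc
  obtain ⟨Ci, hCi⟩ := exists_bound_fderiv_apply hφ hc (e i)
  obtain ⟨Cj, hCj⟩ := exists_bound_fderiv_apply hφ hc (e j)
  have mi := (continuous_fderiv_apply_const hφ (e i)).aestronglyMeasurable
    (μ := volume.restrict M)
  have mj := (continuous_fderiv_apply_const hφ (e j)).aestronglyMeasurable
    (μ := volume.restrict M)
  have hsplit : ∀ w : X → Vec d, IntegrableOn w M → ∫ z in M, symPairing e w φ i j z
      = (1 / 2 : ℝ) * ((∫ z in M, w z i * fderiv ℝ φ z (e j)) +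
        ∫ z in M, w z j * fderiv ℝ φ z (e i)) := by
    intro w hw
    rw [← integral_add (Integrable.coord_mul hw mj hCj i) (Integrable.coord_mul hw mi hCi j),
      ← integral_const_mul]
    rfl
  have t1 : Tendsto (fun k => ∫ z in M, symPairing e (w k) φ i j z) l
      (𝓝 (∫ z in M, symPairing e u φ i j z)) := by
    simp only [hsplit _ hu, fun k => hsplit _ (hwi k)]
    exact ((tendsto_integral_coord_mul hu hwi hlim mj hCj i).add
      (tendsto_integral_coord_mul hu hwi hlim mi hCi j)).const_mul _
  have t2 := (tendsto_integral_coord_mul hG hKi hlim'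
    hφ.continuous.aestronglyMeasurable hC (i, j)).neg
  simp only [h] at t1
  exact tendsto_nhds_unique t1 t2

/-- The weak symmetric gradient is closed with respect to convergence in `L^1`. -/
lemma HasWeakSymGrad.of_tendsto {κ : Type*} {l : Filter κ} [l.NeBot] [SecondCountableTopology X]
    {w : κ → X → Vec d} {K : κ → X → Tensor d}
    (hw : ∀ k, HasWeakSymGrad e M (w k) (K k)) (hwi : ∀ k, IntegrableOn (w k) M)
    (hKi : ∀ k, IntegrableOn (K k) M) (hu : IntegrableOn u M) (hG : IntegrableOn G M)
    (hlim : Tendsto (fun k => ∫⁻ z in M, ‖w k z - u z‖ₑ) l (𝓝 0))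
    (hlim' : Tendsto (fun k => ∫⁻ z in M, ‖K k z - G z‖ₑ) l (𝓝 0)) :
    HasWeakSymGrad e M u G where
  locallyIntegrable := hu.locallyIntegrableOn
  locallyIntegrable_grad := hG.locallyIntegrableOn
  integral_eq φ hφ hc hM i j :=
    integral_symPairing_eq_of_tendsto hwi hKi hu hG hlim hlim' hφ hc
      fun k => (hw k).integral_eq φ hφ hc hM i j

end WeakGradient

/-! ### Zero boundary values expressed through extension by zero. -/

section ZeroTrace

variable {d : ℕ} {Ω : Set (Vec d)} {u v : Vec d → Vec d} {G H : Vec d → Tensor d}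

/-- The extension by zero of `G` is the weak symmetric gradient in `ℝ^d` of the extension by zero
of `u`. -/
structure HasZeroSymGrad (Ω : Set (Vec d)) (u : Vec d → Vec d) (G : Vec d → Tensor d) : Prop where
  integrableOn : IntegrableOn u Ω
  integrableOn_grad : IntegrableOn G Ω
  integral_eq : ∀ φ : Vec d → ℝ, ContDiff ℝ (⊤ : ℕ∞) φ → HasCompactSupport φ → ∀ i j : Fin d,
    ∫ x in Ω, symPairing spaceDir u φ i j x = -∫ x in Ω, G x (i, j) * φ x

lemma HasZeroSymGrad.hasWeakSymGrad (h : HasZeroSymGrad Ω u G) :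
    HasWeakSymGrad spaceDir Ω u G where
  locallyIntegrable := h.1.locallyIntegrableOn
  locallyIntegrable_grad := h.2.locallyIntegrableOn
  integral_eq φ hφ hc _ i j := h.integral_eq φ hφ hc i j

lemma HasZeroSymGrad.of_tendsto {κ : Type*} {l : Filter κ} [l.NeBot]
    {w : κ → Vec d → Vec d} {K : κ → Vec d → Tensor d}
    (hw : ∀ k, HasZeroSymGrad Ω (w k) (K k)) (hu : IntegrableOn u Ω) (hG : IntegrableOn G Ω)
    (hlim : Tendsto (fun k => ∫⁻ z in Ω, ‖w k z - u z‖ₑ) l (𝓝 0))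
    (hlim' : Tendsto (fun k => ∫⁻ z in Ω, ‖K k z - G z‖ₑ) l (𝓝 0)) :
    HasZeroSymGrad Ω u G where
  integrableOn := hu
  integrableOn_grad := hG
  integral_eq φ hφ hc i j :=
    integral_symPairing_eq_of_tendsto (fun k => (hw k).1) (fun k => (hw k).2) hu hG hlim hlim' hφ hc
      fun k => (hw k).integral_eq φ hφ hc i j

lemma integral_symPairing_indicator (hΩ : MeasurableSet Ω) (u : Vec d → Vec d) (φ : Vec d → ℝ)
    (i j : Fin d) : ∫ x, symPairing spaceDir (Ω.indicator u) φ i j x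
      = ∫ x in Ω, symPairing spaceDir u φ i j x := by
  rw [← integral_indicator hΩ]
  congr 1
  ext x
  by_cases hx : x ∈ Ω <;> simp [symPairing, hx]

lemma integral_coord_mul_indicator (hΩ : MeasurableSet Ω) (G : Vec d → Tensor d) (φ : Vec d → ℝ)
    (k : Fin d × Fin d) : ∫ x, Ω.indicator G x k * φ x = ∫ x in Ω, G x k * φ x := by
  rw [← integral_indicator hΩ]
  congr 1
  ext x
  by_cases hx : x ∈ Ω <;> simp [hx]

/-- Since the test functions need not vanish on the boundary, the condition lives on the whole
space. In this form linearity is inherited from `HasWeakSymGrad`. -/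
lemma hasZeroSymGrad_iff (hΩ : MeasurableSet Ω) : HasZeroSymGrad Ω u G ↔
    Integrable (Ω.indicator u) ∧ Integrable (Ω.indicator G) ∧
      HasWeakSymGrad spaceDir Set.univ (Ω.indicator u) (Ω.indicator G) := by
  constructor
  · intro h
    refine ⟨(integrable_indicator_iff hΩ).2 h.1, (integrable_indicator_iff hΩ).2 h.2, ?_, ?_, ?_⟩
    · exact ((integrable_indicator_iff hΩ).2 h.1).locallyIntegrable.locallyIntegrableOn _
    · exact ((integrable_indicator_iff hΩ).2 h.2).locallyIntegrable.locallyIntegrableOn _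
    · intro φ hφ hc _ i j
      have := h.integral_eq φ hφ hc i j
      rw [← integral_symPairing_indicator hΩ, ← integral_coord_mul_indicator hΩ] at this
      rw [setIntegral_univ, setIntegral_univ]
      exact this
  · rintro ⟨h1, h2, h3⟩
    refine ⟨(integrable_indicator_iff hΩ).1 h1, (integrable_indicator_iff hΩ).1 h2, ?_⟩
    intro φ hφ hc i j
    have := h3.integral_eq φ hφ hc (Set.subset_univ _) i j
    rw [setIntegral_univ, setIntegral_univ] at this
    rw [← integral_symPairing_indicator hΩ, ← integral_coord_mul_indicator hΩ]
    exact this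

lemma HasZeroSymGrad.add (hΩ : MeasurableSet Ω) (hu : HasZeroSymGrad Ω u G)
    (hv : HasZeroSymGrad Ω v H) : HasZeroSymGrad Ω (u + v) (G + H) := by
  rw [hasZeroSymGrad_iff hΩ] at *
  simp only [Set.indicator_add']
  exact ⟨hu.1.add hv.1, hu.2.1.add hv.2.1, hu.2.2.add hv.2.2⟩

lemma HasZeroSymGrad.const_smul (hΩ : MeasurableSet Ω) (hu : HasZeroSymGrad Ω u G) (c : ℝ) :
    HasZeroSymGrad Ω (c • u) (c • G) := by
  rw [hasZeroSymGrad_iff hΩ] at *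
  have h1 : Ω.indicator (c • u) = c • Ω.indicator u := Set.indicator_const_smul Ω c u
  have h2 : Ω.indicator (c • G) = c • Ω.indicator G := Set.indicator_const_smul Ω c G
  rw [h1, h2]
  exact ⟨hu.1.smul c, hu.2.1.smul c, hu.2.2.const_smul c⟩

lemma HasZeroSymGrad.congr (hu : HasZeroSymGrad Ω u G) (huv : u =ᵐ[volume.restrict Ω] v)
    (hGH : G =ᵐ[volume.restrict Ω] H) : HasZeroSymGrad Ω v H where
  integrableOn := hu.1.congr huv
  integrableOn_grad := hu.2.congr hGH
  integral_eq φ hφ hc i j := by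
    have h1 : ∫ z in Ω, H z (i, j) * φ z = ∫ z in Ω, G z (i, j) * φ z := by
      refine integral_congr_ae ?_
      filter_upwards [hGH] with z hz
      rw [hz]
    rw [h1, ← hu.integral_eq φ hφ hc i j]
    refine integral_congr_ae ?_
    filter_upwards [huv] with z hz
    rw [symPairing, symPairing, hz]

/-- The classical symmetric gradient. -/
noncomputable def symGrad (φ : Vec d → Vec d) (x : Vec d) : Tensor d :=
  WithLp.toLp 2 fun k =>
    (1 / 2 : ℝ) * (fderiv ℝ φ x (spaceDir k.2) k.1 + fderiv ℝ φ x (spaceDir k.1) k.2)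

lemma fderiv_coord {φ : Vec d → Vec d} (hφ : ContDiff ℝ (⊤ : ℕ∞) φ) (x a : Vec d) (i : Fin d) :
    fderiv ℝ (fun y => φ y i) x a = fderiv ℝ φ x a i := by
  have h1 : HasFDerivAt φ (fderiv ℝ φ x) x :=
    (hφ.differentiable (by simp) x).hasFDerivAt
  have h2 := (EuclideanSpace.proj i : Vec d →L[ℝ] ℝ).hasFDerivAt.comp x h1
  have h3 : fderiv ℝ (fun y => φ y i) x
      = (EuclideanSpace.proj i : Vec d →L[ℝ] ℝ).comp (fderiv ℝ φ x) := h2.fderiv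
  rw [h3]; rfl

lemma continuous_symGrad {φ : Vec d → Vec d} (hφ : ContDiff ℝ (⊤ : ℕ∞) φ) :
    Continuous (symGrad φ) := by
  have h : ∀ a : Vec d, Continuous fun x => fderiv ℝ φ x a := fun a =>
    (hφ.continuous_fderiv (by simp)).clm_apply continuous_const
  refine (PiLp.continuous_toLp 2 _).comp (continuous_pi fun k => ?_)
  have h1 : Continuous fun x => fderiv ℝ φ x (spaceDir k.2) k.1 :=
    (EuclideanSpace.proj k.1 : Vec d →L[ℝ] ℝ).continuous.comp (h _)
  have h2 : Continuous fun x => fderiv ℝ φ x (spaceDir k.1) k.2 :=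
    (EuclideanSpace.proj k.2 : Vec d →L[ℝ] ℝ).continuous.comp (h _)
  exact continuous_const.mul (h1.add h2)

lemma symGrad_eq_zero_of_notMem_tsupport {φ : Vec d → Vec d} {x : Vec d} (hx : x ∉ tsupport φ) :
    symGrad φ x = 0 := by
  have : fderiv ℝ φ x = 0 := by
    by_contra h
    exact hx (support_fderiv_subset ℝ h)
  ext k
  simp [symGrad, this]

/-- Integration by parts for smooth functions with compact support in `Ω`. -/
lemma hasZeroSymGrad_of_contDiff {φ : Vec d → Vec d} (hφ : ContDiff ℝ (⊤ : ℕ∞) φ)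
    (hc : HasCompactSupport φ) (hΩ : tsupport φ ⊆ Ω) : HasZeroSymGrad Ω φ (symGrad φ) := by
  have hGc : HasCompactSupport (symGrad φ) :=
    HasCompactSupport.intro hc fun x hx => symGrad_eq_zero_of_notMem_tsupport hx
  refine ⟨(hφ.continuous.integrable_of_hasCompactSupport hc).integrableOn,
    ((continuous_symGrad hφ).integrable_of_hasCompactSupport hGc).integrableOn, ?_⟩
  intro ψ hψ hψc i j
  rw [setIntegral_eq_integral_of_forall_compl_eq_zero, setIntegral_eq_integral_of_forall_compl_eq_zero]
  rotate_left
  · intro x hx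
    rw [symGrad_eq_zero_of_notMem_tsupport fun h => hx (hΩ h)]
    simp
  · intro x hx
    rw [symPairing, image_eq_zero_of_notMem_tsupport fun h => hx (hΩ h)]
    simp
  have hcoord : ∀ i, ContDiff ℝ (⊤ : ℕ∞) fun x => φ x i := fun i =>
    (EuclideanSpace.proj i : Vec d →L[ℝ] ℝ).contDiff.comp hφ
  have hcs : ∀ i, HasCompactSupport fun x => φ x i := fun i =>
    hc.comp_left (g := fun y : Vec d => y i) rfl
  have I1 : ∀ i a, Integrable fun x => φ x i * fderiv ℝ ψ x a := fun i a =>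
    ((hcoord i).continuous.mul (continuous_fderiv_apply_const hψ a)).integrable_of_hasCompactSupport
      ((hcs i).mul_right)
  have I2 : ∀ i a, Integrable fun x => fderiv ℝ (fun y => φ y i) x a * ψ x := fun i a =>
    ((continuous_fderiv_apply_const (hcoord i) a).mul hψ.continuous).integrable_of_hasCompactSupport
      (hψc.mul_left)
  have I3 : ∀ i, Integrable fun x => φ x i * ψ x := fun i =>
    ((hcoord i).continuous.mul hψ.continuous).integrable_of_hasCompactSupport ((hcs i).mul_right)
  have key : ∀ i a, ∫ x, φ x i * fderiv ℝ ψ x a = -∫ x, fderiv ℝ (fun y => φ y i) x a * ψ x :=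
    fun i a => integral_mul_fderiv_eq_neg_fderiv_mul_of_integrable (I2 i a) (I1 i a) (I3 i)
      (fun x _ => (hcoord i).differentiable (by simp) x) (fun x _ => hψ.differentiable (by simp) x)
  calc ∫ x, symPairing spaceDir φ ψ i j x
      = (1 / 2 : ℝ) * ((∫ x, φ x i * fderiv ℝ ψ x (spaceDir j)) +
          ∫ x, φ x j * fderiv ℝ ψ x (spaceDir i)) := by
        rw [← integral_add (I1 _ _) (I1 _ _), ← integral_const_mul]; rfl
    _ = -((1 / 2 : ℝ) * ((∫ x, fderiv ℝ (fun y => φ y i) x (spaceDir j) * ψ x) +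
          ∫ x, fderiv ℝ (fun y => φ y j) x (spaceDir i) * ψ x)) := by
        rw [key, key]; ring
    _ = -∫ x, symGrad φ x (i, j) * ψ x := by
        rw [← integral_add (I2 _ _) (I2 _ _), ← integral_const_mul]
        congr 2
        ext x
        simp only [symGrad, fderiv_coord hφ]
        ring

end ZeroTrace


/-! ### Multiplication by cut-off functions. -/

section Cutoff

variable {d : ℕ} {Ω : Set (Vec d)} {u : Vec d → Vec d} {G : Vec d → Tensor d} {χ : Vec d → ℝ}

lemma norm_spaceDir (j : Fin d) : ‖(spaceDir j : Vec d)‖ = 1 := by simp [spaceDir]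

/-- The symmetrized product `∇χ ⊗ u`. -/
noncomputable def symOuter (χ : Vec d → ℝ) (u : Vec d → Vec d) (x : Vec d) : Tensor d :=
  WithLp.toLp 2 fun k => symPairing spaceDir u χ k.1 k.2 x

lemma norm_symOuter_le {C : ℝ} (hC : ∀ x, ‖fderiv ℝ χ x‖ ≤ C) (x : Vec d) :
    ‖symOuter χ u x‖ ≤ d * C * ‖u x‖ := by
  have hC0 : 0 ≤ C := (norm_nonneg _).trans (hC x)
  have h1 : ∀ i : Fin d, |fderiv ℝ χ x (spaceDir i)| ≤ C := fun i => by
    have := (fderiv ℝ χ x).le_opNorm (spaceDir i)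
    rw [norm_spaceDir, mul_one] at this
    exact this.trans (hC x)
  have h2 : ∀ i : Fin d, |u x i| ≤ ‖u x‖ := fun i => PiLp.norm_apply_le (u x) i
  have h3 : ∀ k : Fin d × Fin d, ‖symOuter χ u x k‖ ≤ C * ‖u x‖ := by
    intro k
    change |(1 / 2 : ℝ) * (_ + _)| ≤ _
    rw [abs_mul, abs_of_pos (by norm_num : (0 : ℝ) < 1 / 2)]
    have h4 := abs_add_le (u x k.1 * fderiv ℝ χ x (spaceDir k.2))
      (u x k.2 * fderiv ℝ χ x (spaceDir k.1))
    rw [abs_mul, abs_mul] at h4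
    have h5 := mul_le_mul (h2 k.1) (h1 k.2) (abs_nonneg _) (norm_nonneg _)
    have h6 := mul_le_mul (h2 k.2) (h1 k.1) (abs_nonneg _) (norm_nonneg _)
    linarith
  rw [EuclideanSpace.norm_eq]
  refine Real.sqrt_le_iff.2 ⟨by positivity, ?_⟩
  -- There are d² entries, each at most C‖u‖, so the Frobenius norm contributes the factor √(d²) =
  -- d.
  calc ∑ k, ‖symOuter χ u x k‖ ^ 2 ≤ ∑ _k : Fin d × Fin d, (C * ‖u x‖) ^ 2 :=
        Finset.sum_le_sum fun k _ => pow_le_pow_left₀ (norm_nonneg _) (h3 k) 2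
    _ = (d * C * ‖u x‖) ^ 2 := by
        rw [Finset.sum_const, Finset.card_univ, Fintype.card_prod, Fintype.card_fin, nsmul_eq_mul]
        push_cast
        ring

lemma aestronglyMeasurable_symOuter {μ : Measure (Vec d)} (hχ : ContDiff ℝ (⊤ : ℕ∞) χ)
    (hu : AEStronglyMeasurable u μ) : AEStronglyMeasurable (symOuter χ u) μ := by
  refine (PiLp.continuous_toLp 2 _).comp_aestronglyMeasurable ?_
  refine AEMeasurable.aestronglyMeasurable (aemeasurable_pi_lambda _ fun k => ?_)
  have hc : ∀ i, AEMeasurable (fun x => u x i) μ := fun i =>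
    ((EuclideanSpace.proj i : Vec d →L[ℝ] ℝ).continuous.comp_aestronglyMeasurable hu).aemeasurable
  have hd : ∀ a, AEMeasurable (fun x => fderiv ℝ χ x a) μ := fun a =>
    (continuous_fderiv_apply_const hχ a).measurable.aemeasurable
  exact (((hc k.1).mul (hd _)).add ((hc k.2).mul (hd _))).const_mul _

lemma exists_bound_fderiv (hχ : ContDiff ℝ (⊤ : ℕ∞) χ) (hc : HasCompactSupport χ) :
    ∃ C, ∀ x, ‖fderiv ℝ χ x‖ ≤ C :=
  (hχ.continuous_fderiv (by simp)).bounded_above_of_compact_support (hc.fderiv ℝ)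

/-- Multiplication with a smooth cut-off function. -/
lemma HasZeroSymGrad.cutoff (h : HasZeroSymGrad Ω u G) (hχ : ContDiff ℝ (⊤ : ℕ∞) χ)
    (hc : HasCompactSupport χ) :
    HasZeroSymGrad Ω (fun x => χ x • u x) (fun x => χ x • G x + symOuter χ u x) := by
  obtain ⟨C, hC⟩ := hχ.continuous.bounded_above_of_compact_support hc
  obtain ⟨C', hC'⟩ := exists_bound_fderiv hχ hc
  have iu : IntegrableOn (fun x => χ x • u x) Ω :=
    h.1.bdd_smul C hχ.continuous.aestronglyMeasurable (ae_of_all _ hC)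
  have iG : IntegrableOn (fun x => χ x • G x) Ω :=
    h.2.bdd_smul C hχ.continuous.aestronglyMeasurable (ae_of_all _ hC)
  have iO : IntegrableOn (symOuter χ u) Ω := by
    refine Integrable.mono' (h.1.norm.const_mul (d * C'))
      (aestronglyMeasurable_symOuter hχ h.1.1) (ae_of_all _ fun x => norm_symOuter_le hC' x)
  refine ⟨iu, iG.add iO, ?_⟩
  intro φ hφ hφc i j
  obtain ⟨B, hB⟩ := hφ.continuous.bounded_above_of_compact_support hφc
  have h1 := h.integral_eq (fun x => χ x * φ x) (hχ.mul hφ) hc.mul_right i j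
  -- Test the equation for `u` with χφ; the part of the product rule in which the derivative falls
  -- on χ is exactly the `symOuter` term.
  have h2 : ∀ x, symPairing spaceDir (fun x => χ x • u x) φ i j x
      = symPairing spaceDir u (fun x => χ x * φ x) i j x - symOuter χ u x (i, j) * φ x := by
    intro x
    have h3 : ∀ a, fderiv ℝ (fun x => χ x * φ x) x a
        = χ x * fderiv ℝ φ x a + φ x * fderiv ℝ χ x a := by
      intro a
      rw [fderiv_fun_mul (hχ.differentiable (by simp) x) (hφ.differentiable (by simp) x)]
      simp
    change symPairing spaceDir (fun x => χ x • u x) φ i j x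
      = symPairing spaceDir u (fun x => χ x * φ x) i j x - symPairing spaceDir u χ i j x * φ x
    simp only [symPairing, h3, PiLp.smul_apply, smul_eq_mul]
    ring
  have iO' := Integrable.coord_mul iO hφ.continuous.aestronglyMeasurable hB (i, j)
  have iP : IntegrableOn (symPairing spaceDir u (fun x => χ x * φ x) i j) Ω := by
    have h3 : ContDiff ℝ (⊤ : ℕ∞) fun x => χ x * φ x := hχ.mul hφ
    have h4 : HasCompactSupport fun x => χ x * φ x := hc.mul_right
    obtain ⟨Ci, hCi⟩ := exists_bound_fderiv_apply h3 h4 (spaceDir i)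
    obtain ⟨Cj, hCj⟩ := exists_bound_fderiv_apply h3 h4 (spaceDir j)
    exact ((Integrable.coord_mul h.1
      (continuous_fderiv_apply_const h3 _).aestronglyMeasurable hCj i).add
      (Integrable.coord_mul h.1
      (continuous_fderiv_apply_const h3 _).aestronglyMeasurable hCi j)).const_mul _
  simp only [h2]
  rw [integral_sub iP iO', h1]
  have h5 : ∫ x in Ω, (χ x • G x + symOuter χ u x) (i, j) * φ x
      = (∫ x in Ω, G x (i, j) * (χ x * φ x)) + ∫ x in Ω, symOuter χ u x (i, j) * φ x := by
    rw [← integral_add _ iO']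
    · congr 1; ext x; simp; ring
    · have := Integrable.coord_mul iG hφ.continuous.aestronglyMeasurable hB (i, j)
      refine this.congr (ae_of_all _ fun x => ?_)
      simp; ring
  rw [h5]
  ring

end Cutoff


/-! ### Averaging operators and the log-Hölder estimate. -/

section Averages

variable {d : ℕ}

/-- A probability measure on `ℝ^d` with bounded density and bounded support. -/
structure IsAveraging (σ : Measure (Vec d)) (D Λ : ℝ) : Prop where
  isProbabilityMeasure : IsProbabilityMeasure σ
  le_smul : σ ≤ ENNReal.ofReal D • volume
  one_le_radius : 1 ≤ Λ
  norm_le : ∀ᵐ a ∂σ, ‖a‖ ≤ Λ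

variable {σ : Measure (Vec d)} {D Λ h : ℝ}

lemma IsAveraging.quasiMeasurePreserving (hσ : IsAveraging σ D Λ) (hh : 0 < h) (x : Vec d) :
    Measure.QuasiMeasurePreserving (fun a : Vec d => x + h • a) σ volume := by
  have h1 : Measure.QuasiMeasurePreserving (fun a : Vec d => h • a) volume volume :=
    Measure.quasiMeasurePreserving_smul volume hh.ne'
  have h2 : Measure.QuasiMeasurePreserving (fun a : Vec d => x + a) volume volume :=
    (measurePreserving_add_left volume x).quasiMeasurePreserving
  exact (h2.comp h1).mono_left (Measure.absolutelyContinuous_of_le_smul hσ.le_smul)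

lemma IsAveraging.lintegral_le (hσ : IsAveraging σ D Λ) (hh : 0 < h) (x : Vec d)
    (f : Vec d → ℝ≥0∞) :
    ∫⁻ a, f (x + h • a) ∂σ ≤ ENNReal.ofReal (D * (h ^ d)⁻¹) * ∫⁻ y, f y := by
  have h1 : ∫⁻ a, f (x + h • a) ∂σ ≤ ENNReal.ofReal D * ∫⁻ a, f (x + h • a) := by
    rw [← smul_eq_mul, ← lintegral_smul_measure]
    exact lintegral_mono' hσ.le_smul le_rfl
  have hme : MeasurableEmbedding fun a : Vec d => h • a :=
    (Homeomorph.smulOfNeZero h hh.ne').measurableEmbedding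
  have h2 : ∫⁻ a : Vec d, f (x + h • a) = ENNReal.ofReal ((h ^ d)⁻¹) * ∫⁻ y, f y := by
    rw [← hme.lintegral_map (fun y => f (x + y)), Measure.map_addHaar_smul _ hh.ne',
      lintegral_smul_measure, lintegral_add_left_eq_self, finrank_euclideanSpace_fin,
      abs_of_pos (by positivity), smul_eq_mul]
  rw [h2, ← mul_assoc] at h1
  rcases le_or_gt 0 D with hD | hD
  · rwa [ENNReal.ofReal_mul hD]
  · rw [ENNReal.ofReal_of_nonpos hD.le] at h1
    simpa using h1.trans (by simp)

/-- Averages preserve the integral. -/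
lemma IsAveraging.lintegral_lintegral (hσ : IsAveraging σ D Λ) (hh : 0 < h)
    {f : Vec d → ℝ≥0∞} (hf : AEMeasurable f) :
    ∫⁻ x, ∫⁻ a, f (x + h • a) ∂σ = ∫⁻ y, f y := by
  have := hσ.isProbabilityMeasure
  have h1 : ∀ x, ∫⁻ a, f (x + h • a) ∂σ = ∫⁻ a, hf.mk f (x + h • a) ∂σ := fun x =>
    lintegral_congr_ae ((hσ.quasiMeasurePreserving hh x).ae hf.ae_eq_mk)
  simp only [h1]
  rw [lintegral_lintegral_swap, lintegral_congr_ae hf.ae_eq_mk]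
  · simp [lintegral_add_right_eq_self]
  · exact (hf.measurable_mk.comp (by fun_prop)).aemeasurable

/-- Jensen's inequality for powers, read off from the monotonicity of L^m norms over a probability
space. -/
lemma lintegral_rpow_le_of_isProbabilityMeasure {α : Type*} [MeasurableSpace α] {μ : Measure α}
    [IsProbabilityMeasure μ] {f : α → ℝ≥0∞} (hf : AEMeasurable f μ) {m : ℝ} (hm : 1 ≤ m) :
    (∫⁻ a, f a ∂μ) ^ m ≤ ∫⁻ a, f a ^ m ∂μ := by
  have h := eLpNorm'_le_eLpNorm'_of_exponent_le one_pos hm μ hf.aestronglyMeasurable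
  have hm0 : 0 < m := by linarith
  simp only [eLpNorm', enorm_eq_self, ENNReal.rpow_one, div_one] at h
  calc (∫⁻ a, f a ∂μ) ^ m ≤ ((∫⁻ a, f a ^ m ∂μ) ^ (1 / m)) ^ m :=
        ENNReal.rpow_le_rpow h hm0.le
    _ = _ := by rw [← ENNReal.rpow_mul, one_div, inv_mul_cancel₀ hm0.ne', ENNReal.rpow_one]

/-- Log-Hölder continuity of a function on a subset of `ℝ^d`. -/
def LogHolderOn (Ω : Set (Vec d)) (p : Vec d → ℝ) : Prop :=
  ∃ c > 0, ∀ x ∈ Ω, ∀ y ∈ Ω, 0 < ‖x - y‖ → ‖x - y‖ ≤ 1 / 2 →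
    |p x - p y| ≤ c / (-Real.log ‖x - y‖)

lemma LogHolderOn.sub_le {Ω : Set (Vec d)} {p : Vec d → ℝ} {c : ℝ} (hc : 0 < c)
    (h : ∀ x ∈ Ω, ∀ y ∈ Ω, 0 < ‖x - y‖ → ‖x - y‖ ≤ 1 / 2 →
      |p x - p y| ≤ c / (-Real.log ‖x - y‖)) {ρ : ℝ} (hρ0 : 0 < ρ) (hρ : ρ ≤ 1 / 2)
    {x y : Vec d} (hx : x ∈ Ω) (hy : y ∈ Ω) (hxy : ‖x - y‖ ≤ ρ) :
    p x - p y ≤ c / (-Real.log ρ) := by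
  have hl : 0 < -Real.log ρ := by
    rw [neg_pos]; exact Real.log_neg hρ0 (by linarith)
  rcases (norm_nonneg (x - y)).eq_or_lt with h0 | h0
  · rw [eq_comm, norm_eq_zero, sub_eq_zero] at h0
    rw [h0, sub_self]
    positivity
  · refine (le_abs_self _).trans ((h x hx y hy h0 (hxy.trans hρ)).trans ?_)
    have := Real.log_le_log h0 hxy
    gcongr

/-- The quantitative role of log-Hölder continuity: h^{-d} is unbounded as h tends to 0, but raised
to an oscillation of size c / (-log(Λh)) it stays bounded, because -log h and -log(Λh) differ by log
Λ and the latter is at least log 2. -/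
lemma rpow_log_div_log_le {c : ℝ} (hc : 0 < c) (hΛ : 1 ≤ Λ) (hh : 0 < h) (hs : Λ * h ≤ 1 / 2)
    {e : ℝ} (he : e ≤ c / (-Real.log (Λ * h))) :
    ((h ^ d)⁻¹) ^ e ≤ Real.exp (d * c * (1 + Real.log Λ / Real.log 2)) := by
  have hΛ0 : 0 < Λ := by linarith
  have hl2 : 0 < Real.log 2 := Real.log_pos one_lt_two
  have hlΛ : 0 ≤ Real.log Λ := Real.log_nonneg hΛ
  have hl : Real.log 2 ≤ -Real.log (Λ * h) := by
    rw [← Real.log_inv]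
    refine Real.log_le_log two_pos ?_
    rw [le_inv_comm₀ two_pos (by positivity)]
    linarith
  have hlog : -Real.log h = -Real.log (Λ * h) + Real.log Λ := by
    rw [Real.log_mul hΛ0.ne' hh.ne']; ring
  have hh0 : 0 ≤ -Real.log h := by rw [hlog]; linarith
  rw [Real.rpow_def_of_pos (by positivity), Real.log_inv, Real.log_pow]
  refine Real.exp_le_exp.2 ?_
  calc -(d * Real.log h) * e = d * (-Real.log h * e) := by ring
    _ ≤ d * (-Real.log h * (c / (-Real.log (Λ * h)))) := by gcongr
    _ = d * c * ((-Real.log (Λ * h) + Real.log Λ) / (-Real.log (Λ * h))) := by rw [hlog]; ring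
    _ = d * c * (1 + Real.log Λ / (-Real.log (Λ * h))) := by
        rw [add_div, div_self (by linarith)]
    _ ≤ d * c * (1 + Real.log Λ / Real.log 2) := by gcongr

/-- The fundamental estimate for averages in the case of a log-Hölder continuous exponent. -/
theorem IsAveraging.exists_rpow_le (hσ : IsAveraging σ D Λ) {Ω : Set (Vec d)}
    {p : Vec d → ℝ} (hlog : LogHolderOn Ω p) (hp : ∀ᵐ x, x ∈ Ω → 1 ≤ p x) {b : ℝ} {K : ℝ≥0∞}
    (hK : K ≠ ⊤) : ∃ C : ℝ≥0∞, C ≠ ⊤ ∧ ∀ f g : Vec d → ℝ≥0∞, AEMeasurable f →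
      (∀ᵐ y, y ∈ Ω → f y ^ p y + 1 ≤ g y) → (∀ᵐ y, y ∉ Ω → f y = 0) → ∫⁻ y, g y ≤ K →
      ∀ h : ℝ, 0 < h → ∀ x ∈ Ω, 1 ≤ p x → p x ≤ b →
        (∫⁻ a, f (x + h • a) ∂σ) ^ p x ≤ C * ∫⁻ a, g (x + h • a) ∂σ := by
  obtain ⟨c, hc, hlog⟩ := hlog
  have hσp := hσ.isProbabilityMeasure
  have hΛ := hσ.one_le_radius
  have hΛ0 : 0 < Λ := by linarith
  -- The averages of g at scale h are at most A h^{-d}. The constants `C1` and `C2` serve small and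
  -- large scales respectively.
  set A : ℝ := max 1 (D * K.toReal)
  have hA1 : 1 ≤ A := le_max_left _ _
  set C1 : ℝ := A ^ b * Real.exp (d * c * (1 + Real.log Λ / Real.log 2))
  set C2 : ℝ := (A * (2 * Λ) ^ d) ^ b
  have hC1 : 0 ≤ C1 := by positivity
  have hC2 : 0 ≤ C2 := by positivity
  refine ⟨ENNReal.ofReal (C1 + C2), ENNReal.ofReal_ne_top, ?_⟩
  intro f g hf hfg hf0 hgK h hh x hx hpx hpb
  have hqm := hσ.quasiMeasurePreserving hh x
  -- an admissible lower exponent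
  obtain ⟨m, hm1, hmp, hm, hCm⟩ : ∃ m : ℝ, 1 ≤ m ∧ m ≤ p x ∧
      (∀ y ∈ Ω, 1 ≤ p y → ‖x - y‖ ≤ Λ * h → m ≤ p y) ∧
      (A * (h ^ d)⁻¹) ^ ((p x - m) / m) ≤ C1 + C2 := by
    -- The exponent m must lie below p on all points seen by the average at x, and close enough to p
    -- x that the surplus power of h^{-d} is bounded. At small scales it is p x minus the log-Hölder
    -- oscillation over radius Λh, cut off at 1.
    rcases le_or_gt (Λ * h) (1 / 2) with hs | hs
    · have hρ : 0 < Λ * h := by positivity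
      have hl : 0 < -Real.log (Λ * h) := by
        rw [neg_pos]; exact Real.log_neg hρ (by linarith)
      refine ⟨max 1 (p x - c / (-Real.log (Λ * h))), le_max_left _ _, max_le hpx ?_, ?_, ?_⟩
      · linarith [div_pos hc hl]
      · intro y hy hpy hxy
        refine max_le hpy ?_
        linarith [LogHolderOn.sub_le hc hlog hρ hs hx hy hxy]
      · set m := max 1 (p x - c / (-Real.log (Λ * h)))
        have hm1 : 1 ≤ m := le_max_left _ _
        have hmp : m ≤ p x := max_le hpx (by linarith [div_pos hc hl])
        have e1 : (p x - m) / m ≤ p x - m := div_le_self (by linarith) hm1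
        have e2 : (p x - m) / m ≤ c / (-Real.log (Λ * h)) := by
          have : p x - c / (-Real.log (Λ * h)) ≤ m := le_max_right _ _
          linarith
        have e3 : (p x - m) / m ≤ b := by linarith
        rw [Real.mul_rpow (by positivity) (by positivity)]
        calc _ ≤ A ^ b * Real.exp (d * c * (1 + Real.log Λ / Real.log 2)) := by
              gcongr
              exact rpow_log_div_log_le hc hΛ hh hs e2
          _ ≤ C1 + C2 := by linarith
    -- At large scales h^{-d} < (2Λ)^d is itself bounded, so the crude choice m = 1 is good enough.
    · refine ⟨1, le_rfl, hpx, fun y _ hpy _ => hpy, ?_⟩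
      have h1 : (h ^ d)⁻¹ ≤ (2 * Λ) ^ d := by
        rw [← inv_pow]
        refine pow_le_pow_left₀ (by positivity) ?_ d
        rw [inv_le_iff_one_le_mul₀ hh]
        linarith
      have h2 : 1 ≤ A * (2 * Λ) ^ d :=
        one_le_mul_of_one_le_of_one_le hA1 (one_le_pow₀ (by linarith))
      calc (A * (h ^ d)⁻¹) ^ ((p x - 1) / 1) ≤ (A * (2 * Λ) ^ d) ^ ((p x - 1) / 1) := by
            refine Real.rpow_le_rpow (by positivity) (by gcongr) ?_
            rw [div_one]; linarith
        _ ≤ (A * (2 * Λ) ^ d) ^ b := by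
            refine Real.rpow_le_rpow_of_exponent_le h2 ?_
            rw [div_one]; linarith
        _ ≤ C1 + C2 := by linarith
  have hm0 : 0 < m := by linarith
  set I := ∫⁻ a, g (x + h • a) ∂σ
  have hI : I ≤ ENNReal.ofReal (A * (h ^ d)⁻¹) := by
    calc I ≤ ENNReal.ofReal (D * (h ^ d)⁻¹) * ∫⁻ y, g y := hσ.lintegral_le hh x g
      _ ≤ ENNReal.ofReal (D * (h ^ d)⁻¹) * ENNReal.ofReal K.toReal := by
          rw [ENNReal.ofReal_toReal hK]; gcongr
      _ = ENNReal.ofReal (D * K.toReal * (h ^ d)⁻¹) := by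
          rw [← ENNReal.ofReal_mul' ENNReal.toReal_nonneg]; congr 1; ring
      _ ≤ _ := by gcongr; exact le_max_right _ _
  -- Jensen with the constant exponent m, followed by f^m ≤ f^p + 1 ≤ g in Ω. The summand 1 covers
  -- the points where f < 1.
  have hfm : (∫⁻ a, f (x + h • a) ∂σ) ^ m ≤ I := by
    refine (lintegral_rpow_le_of_isProbabilityMeasure
      (hf.comp_quasiMeasurePreserving hqm) hm1).trans (lintegral_mono_ae ?_)
    filter_upwards [hqm.ae hfg, hqm.ae hf0, hqm.ae hp, hσ.norm_le] with a h1 h2 h3 h4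
    by_cases hy : x + h • a ∈ Ω
    · have h5 : ‖x - (x + h • a)‖ ≤ Λ * h := by
        rw [sub_add_cancel_left, norm_neg, norm_smul, Real.norm_of_nonneg hh.le, mul_comm]
        gcongr
      refine le_trans ?_ (h1 hy)
      rcases le_or_gt 1 (f (x + h • a)) with h6 | h6
      · exact (ENNReal.rpow_le_rpow_of_exponent_le h6 (hm _ hy (h3 hy) h5)).trans le_self_add
      · exact (ENNReal.rpow_le_one h6.le hm0.le).trans le_add_self
    · rw [Function.comp_apply, h2 hy, ENNReal.zero_rpow_of_pos hm0]
      exact zero_le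
  -- One power of the average of g is kept on the right; the surplus power (p x - m)/m is absorbed
  -- into the constant by the choice of m.
  have hpm : p x = m * (1 + (p x - m) / m) := by field_simp; ring
  have he : 0 ≤ (p x - m) / m := div_nonneg (by linarith) hm0.le
  calc (∫⁻ a, f (x + h • a) ∂σ) ^ p x
      = ((∫⁻ a, f (x + h • a) ∂σ) ^ m) ^ (1 + (p x - m) / m) := by
        rw [← ENNReal.rpow_mul, ← hpm]
    _ ≤ I ^ (1 + (p x - m) / m) := ENNReal.rpow_le_rpow hfm (by linarith)
    _ = I ^ ((p x - m) / m) * I := by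
        rw [ENNReal.rpow_add_of_nonneg _ _ zero_le_one he, ENNReal.rpow_one, mul_comm]
    _ ≤ ENNReal.ofReal (C1 + C2) * I := by
        gcongr
        calc I ^ ((p x - m) / m) ≤ ENNReal.ofReal (A * (h ^ d)⁻¹) ^ ((p x - m) / m) :=
              ENNReal.rpow_le_rpow hI he
          _ = ENNReal.ofReal ((A * (h ^ d)⁻¹) ^ ((p x - m) / m)) :=
              ENNReal.ofReal_rpow_of_nonneg (by positivity) he
          _ ≤ _ := ENNReal.ofReal_le_ofReal hCm

end Averages


/-! ### Convergence of averages in L^1 and in variable Lebesgue spaces. -/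

section AverageConvergence

variable {d : ℕ} {E : Type*} [NormedAddCommGroup E] [NormedSpace ℝ E]
  {σ : Measure (Vec d)} {D Λ : ℝ}

/-- Continuity of translations in `L^1`. -/
lemma tendsto_lintegral_translate {f : Vec d → E} (hf : Integrable f) :
    Tendsto (fun v : Vec d => ∫⁻ x, ‖f (x + v) - f x‖ₑ) (𝓝 0) (𝓝 0) := by
  have hf1 : MemLp f 1 volume := memLp_one_iff_integrable.2 hf
  let g : C(Vec d, C(Vec d, Vec d)) :=
    (ContinuousMap.mk (fun a : Vec d × Vec d => a.2 + a.1) (by fun_prop)).curry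
  have hmp : ∀ v : Vec d, MeasurePreserving (g v) volume volume := fun v =>
    measurePreserving_add_right volume v
  have hc := (tendsto_const_nhds (x := hf1.toLp f) (f := 𝓝 (0 : Vec d))).compMeasurePreservingLp
    (g.continuous.tendsto 0) hmp (hmp 0) ENNReal.one_ne_top
  rw [tendsto_iff_edist_tendsto_0] at hc
  refine hc.congr fun v => ?_
  rw [Lp.toLp_compMeasurePreserving, Lp.toLp_compMeasurePreserving, Lp.edist_toLp_toLp,
    eLpNorm_one_eq_lintegral_enorm]
  simp [g]

/-- After exchanging the integrals, each inner integral is an L^1 translation error for a shift of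
length at most hΛ, hence uniformly small. -/
lemma IsAveraging.tendsto_lintegral_sub (hσ : IsAveraging σ D Λ) {f : Vec d → E}
    (hf : Integrable f) :
    Tendsto (fun h : ℝ => ∫⁻ x, ∫⁻ a, ‖f (x + h • a) - f x‖ₑ ∂σ) (𝓝[>] 0) (𝓝 0) := by
  have hσp := hσ.isProbabilityMeasure
  rw [ENNReal.tendsto_nhds_zero]
  intro ε hε
  have h1 := (tendsto_lintegral_translate hf).eventually (ge_mem_nhds hε)
  obtain ⟨δ, hδ, h2⟩ := Metric.eventually_nhds_iff_ball.1 h1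
  have hΛ0 : 0 < Λ := zero_lt_one.trans_le hσ.one_le_radius
  have h3 : Set.Ioo (0 : ℝ) (δ / Λ) ∈ 𝓝[>] (0 : ℝ) := Ioo_mem_nhdsGT (by positivity)
  filter_upwards [h3] with h hh
  -- Joint measurability for Tonelli: `f` may be replaced by a strongly measurable representative
  -- because (x, a) ↦ x + h a pulls null sets back to null sets of the product.
  have hm : AEMeasurable (Function.uncurry fun (x a : Vec d) => ‖f (x + h • a) - f x‖ₑ)
      (volume.prod σ) := by
    obtain ⟨f', hf', hff'⟩ := hf.1
    have e1 : (Function.uncurry fun (x a : Vec d) => ‖f (x + h • a) - f x‖ₑ)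
        =ᵐ[volume.prod σ] fun z => ‖f' (z.1 + h • z.2) - f' z.1‖ₑ := by
      have q1 : Measure.QuasiMeasurePreserving (fun z : Vec d × Vec d => z.1 + h • z.2)
          (volume.prod σ) volume := by
        refine ⟨by fun_prop, Measure.AbsolutelyContinuous.mk fun s hs hs0 => ?_⟩
        rw [Measure.map_apply (by fun_prop) hs,
          Measure.prod_apply_symm ((by fun_prop : Measurable fun z : Vec d × Vec d =>
            z.1 + h • z.2) hs), lintegral_eq_zero_iff' (by
              exact (measurable_measure_prodMk_right ((by fun_prop : Measurable fun z :
                Vec d × Vec d => z.1 + h • z.2) hs)).aemeasurable)]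
        refine ae_of_all _ fun a => ?_
        change volume ((fun x => x + h • a) ⁻¹' s) = 0
        rw [(measurePreserving_add_right volume (h • a)).measure_preimage
          hs.nullMeasurableSet, hs0]
      filter_upwards [q1.ae hff', Measure.quasiMeasurePreserving_fst.ae hff'] with z h4 h5
      simp only [Function.uncurry]
      rw [h4, h5]
    refine AEMeasurable.congr ?_ e1.symm
    have m1 : StronglyMeasurable fun z : Vec d × Vec d => f' (z.1 + h • z.2) :=
      hf'.comp_measurable (by fun_prop)
    have m2 : StronglyMeasurable fun z : Vec d × Vec d => f' z.1 :=
      hf'.comp_measurable (by fun_prop)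
    exact (m1.sub m2).enorm.aemeasurable
  rw [lintegral_lintegral_swap hm]
  calc ∫⁻ a, ∫⁻ x, ‖f (x + h • a) - f x‖ₑ ∂volume ∂σ ≤ ∫⁻ _a, ε ∂σ := by
        refine lintegral_mono_ae ?_
        filter_upwards [hσ.norm_le] with a ha
        refine h2 _ ?_
        rw [mem_ball_zero_iff, norm_smul, Real.norm_of_nonneg hh.1.le]
        calc h * ‖a‖ ≤ h * Λ := by gcongr; exact hh.1.le
          _ < δ := by rw [← lt_div_iff₀ hΛ0]; exact hh.2
    _ = ε := by simp

lemma IsAveraging.integrable_comp (hσ : IsAveraging σ D Λ) {f : Vec d → E}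
    (hf : Integrable f) {h : ℝ} (hh : 0 < h) (x : Vec d) :
    Integrable (fun a => f (x + h • a)) σ := by
  refine ⟨hf.1.comp_quasiMeasurePreserving (hσ.quasiMeasurePreserving hh x), ?_⟩
  rw [hasFiniteIntegral_iff_enorm]
  exact (hσ.lintegral_le hh x fun y => ‖f y‖ₑ).trans_lt
    (ENNReal.mul_lt_top ENNReal.ofReal_lt_top hf.2)

lemma IsAveraging.enorm_integral_sub_le [CompleteSpace E] (hσ : IsAveraging σ D Λ) {f : Vec d → E}
    (hf : Integrable f) {h : ℝ} (hh : 0 < h) (x : Vec d) :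
    ‖(∫ a, f (x + h • a) ∂σ) - f x‖ₑ ≤ ∫⁻ a, ‖f (x + h • a) - f x‖ₑ ∂σ := by
  have hσp := hσ.isProbabilityMeasure
  have : (∫ a, f (x + h • a) ∂σ) - f x = ∫ a, (f (x + h • a) - f x) ∂σ := by
    rw [integral_sub (hσ.integrable_comp hf hh x) (integrable_const _)]
    simp
  rw [this]
  exact enorm_integral_le_lintegral_enorm _

/-- Averages converge in `L^1`. -/
lemma IsAveraging.tendsto_lintegral_integral_sub [CompleteSpace E] (hσ : IsAveraging σ D Λ)
    {f : Vec d → E} (hf : Integrable f) :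
    Tendsto (fun h : ℝ => ∫⁻ x, ‖(∫ a, f (x + h • a) ∂σ) - f x‖ₑ) (𝓝[>] 0) (𝓝 0) := by
  refine tendsto_of_tendsto_of_tendsto_of_le_of_le' tendsto_const_nhds
    (hσ.tendsto_lintegral_sub hf) (Eventually.of_forall fun _ => zero_le) ?_
  filter_upwards [self_mem_nhdsWithin] with h hh
  exact lintegral_mono fun x => hσ.enorm_integral_sub_le hf hh x

/-- Dominated convergence with variable exponents and a dominating function that converges
in `L^1`. -/
lemma tendsto_lintegral_rpow_of_le {α ι : Type*} [MeasurableSpace α] {μ : Measure α}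
    {l : Filter ι} {p : α → ℝ} (hp : ∀ᵐ x ∂μ, 1 ≤ p x) {w D : ι → α → ℝ≥0∞} {F : α → ℝ≥0∞}
    (hwm : ∀ᶠ i in l, AEMeasurable (w i) μ) (hFm : AEMeasurable F μ)
    (hF : ∫⁻ x, F x ∂μ ≠ ⊤)
    (hw : Tendsto (fun i => ∫⁻ x, w i x ∂μ) l (𝓝 0))
    (hD : Tendsto (fun i => ∫⁻ x, D i x ∂μ) l (𝓝 0))
    (hle : ∀ᶠ i in l, ∀ᵐ x ∂μ, w i x ^ p x ≤ F x + D i x) :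
    Tendsto (fun i => ∫⁻ x, w i x ^ p x ∂μ) l (𝓝 0) := by
  -- Where w < 1 one has w^p ≤ w, which vanishes in L^1. The set {w ≥ 1} has measure at most ∫ w, so
  -- the integral of the fixed function F over it vanishes too.
  have hs : Tendsto (μ ∘ fun i => {x | 1 ≤ w i x}) l (𝓝 0) := by
    refine tendsto_of_tendsto_of_tendsto_of_le_of_le' tendsto_const_nhds hw
      (Eventually.of_forall fun _ => zero_le) ?_
    filter_upwards [hwm] with i hi
    simpa using mul_meas_ge_le_lintegral₀ hi 1
  have h3 := (tendsto_setLIntegral_zero hF hs)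
  have h4 := (hw.add h3).add hD
  simp only [add_zero] at h4
  refine tendsto_of_tendsto_of_tendsto_of_le_of_le' tendsto_const_nhds h4
    (Eventually.of_forall fun _ => zero_le) ?_
  filter_upwards [hwm, hle] with i hi hi'
  have hset : NullMeasurableSet {x | 1 ≤ w i x} μ := nullMeasurableSet_le aemeasurable_const hi
  rw [← lintegral_indicator₀ hset, ← lintegral_add_left' hi, ← lintegral_add_left'
    (show AEMeasurable (fun x => w i x + {x | 1 ≤ w i x}.indicator F x) μ from
      hi.add (hFm.indicator₀ hset))]
  refine lintegral_mono_ae ?_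
  filter_upwards [hp, hi'] with x h1 h2
  by_cases hx : 1 ≤ w i x
  · rw [Set.indicator_of_mem (by exact hx)]
    refine h2.trans ?_
    rw [add_assoc]
    exact le_add_self
  · rw [Set.indicator_of_notMem (by exact hx), add_zero]
    refine le_trans ?_ le_self_add
    calc w i x ^ p x ≤ w i x ^ (1 : ℝ) :=
          ENNReal.rpow_le_rpow_of_exponent_ge (not_le.1 hx).le h1
      _ = w i x := ENNReal.rpow_one _

/-- Averages converge in variable Lebesgue spaces with log-Hölder continuous exponent. -/
theorem IsAveraging.tendsto_modular [CompleteSpace E] (hσ : IsAveraging σ D Λ)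
    {Ω : Set (Vec d)} (hΩ : MeasurableSet Ω) (hΩf : volume Ω ≠ ⊤) {p : Vec d → ℝ}
    (hlog : LogHolderOn Ω p) (hp : IsBddExponent Ω p) {f : Vec d → E}
    (hf : MemVarLebesgue Ω p f) (hf0 : ∀ y, y ∉ Ω → f y = 0) :
    Tendsto (fun h : ℝ => modular Ω p fun x => (∫ a, f (x + h • a) ∂σ) - f x)
      (𝓝[>] 0) (𝓝 0) := by
  obtain ⟨b, hb⟩ := hp.bdd
  have hσp := hσ.isProbabilityMeasure
  have hind : Ω.indicator f = f := Set.indicator_eq_self.2 fun y hy => by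
    by_contra h; exact hy (hf0 y h)
  have hfi : Integrable f := by
    rw [← hind, integrable_indicator_iff hΩ]
    exact hf.integrableOn hΩf hp
  have hpm := hp.aemeasurable
  -- the dominating function
  set gΩ : Vec d → ℝ := fun y => ‖f y‖ ^ p y + 1
  set g : Vec d → ℝ := Ω.indicator gΩ
  have hgm : AEStronglyMeasurable gΩ (volume.restrict Ω) :=
    ((hf.1.norm.aemeasurable.pow hpm).add_const 1).aestronglyMeasurable
  have hgΩ : IntegrableOn gΩ Ω := by
    refine Integrable.add ⟨(hf.1.norm.aemeasurable.pow hpm).aestronglyMeasurable, ?_⟩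
      (integrableOn_const hΩf)
    rw [hasFiniteIntegral_iff_ofReal (ae_of_all _ fun y => by positivity)]
    exact hf.2
  have hg : Integrable g := (integrable_indicator_iff hΩ).2 hgΩ
  have hp1 := (ae_restrict_iff' hΩ).1 hp.one_le
  have hpb := (ae_restrict_iff' hΩ).1 hb
  obtain ⟨C, hC, hkey⟩ := hσ.exists_rpow_le hlog hp1 (b := b) (K := ∫⁻ y, ‖g y‖ₑ) hg.2.ne
  have hpt : ∀ᵐ y, y ∈ Ω → ‖f y‖ₑ ^ p y + 1 = ‖g y‖ₑ := by
    filter_upwards [hp1] with y hy hyΩ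
    have h0 : 0 ≤ ‖f y‖ ^ p y := by positivity
    simp only [g, gΩ, Set.indicator_of_mem hyΩ]
    rw [← ofReal_norm, ← ofReal_norm,
      ENNReal.ofReal_rpow_of_nonneg (norm_nonneg _) (by linarith [hy hyΩ]),
      Real.norm_of_nonneg (by linarith), ENNReal.ofReal_add h0 zero_le_one, ENNReal.ofReal_one]
  have hmain := fun h (hh : (0 : ℝ) < h) => hkey (fun y => ‖f y‖ₑ) (fun y => ‖g y‖ₑ)
    hfi.1.enorm (by filter_upwards [hpt] with y hy hyΩ using (hy hyΩ).le)
    (ae_of_all _ fun y hy => by rw [hf0 y hy, enorm_zero]) le_rfl h hh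
  have hL1 := hσ.tendsto_lintegral_integral_sub hfi
  have hL1g := hσ.tendsto_lintegral_sub hg
  simp only [modular_eq_lintegral hp.one_le]
  set c : ℝ≥0∞ := ENNReal.ofReal (2 ^ b)
  -- The averaging estimate bounds the power of the difference by c (C · average of |g| + |g|).
  -- Replacing the average of |g| by |g| plus the averaged translation error separates a fixed
  -- integrable majorant from a remainder vanishing in L^1.
  refine tendsto_lintegral_rpow_of_le (F := fun x => c * ((C + 1) * ‖g x‖ₑ))
    (D := fun h x => c * (C * ∫⁻ a, ‖g (x + h • a) - g x‖ₑ ∂σ)) hp.one_le ?_ ?_ ?_ ?_ ?_ ?_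
  · filter_upwards [self_mem_nhdsWithin] with h hh
    refine (AEStronglyMeasurable.sub ?_ hfi.1).enorm.restrict
    obtain ⟨f', hf', hff'⟩ := hfi.1
    have e1 : (fun x => ∫ a, f (x + h • a) ∂σ) = fun x => ∫ a, f' (x + h • a) ∂σ := by
      ext x
      exact integral_congr_ae ((hσ.quasiMeasurePreserving hh x).ae hff')
    rw [e1]
    have m1 : StronglyMeasurable fun z : Vec d × Vec d => f' (z.1 + h • z.2) :=
      hf'.comp_measurable (by fun_prop)
    exact m1.integral_prod_right'.aestronglyMeasurable
  · exact ((hg.1.enorm.const_mul _).const_mul _).restrict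
  · rw [lintegral_const_mul' _ _ ENNReal.ofReal_ne_top, lintegral_const_mul' _ _ (by finiteness)]
    refine ENNReal.mul_ne_top ENNReal.ofReal_ne_top (ENNReal.mul_ne_top (by finiteness) ?_)
    exact ((setLIntegral_le_lintegral _ _).trans_lt hg.2).ne
  · refine tendsto_of_tendsto_of_tendsto_of_le_of_le tendsto_const_nhds hL1
      (fun _ => zero_le) fun h => setLIntegral_le_lintegral _ _
  · have h1 : Tendsto (fun h : ℝ => c * (C * ∫⁻ x, ∫⁻ a, ‖g (x + h • a) - g x‖ₑ ∂σ))
        (𝓝[>] 0) (𝓝 0) := by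
      have := ENNReal.Tendsto.const_mul (ENNReal.Tendsto.const_mul hL1g (Or.inr hC))
        (Or.inr (ENNReal.ofReal_ne_top (r := 2 ^ b)))
      simpa using this
    refine tendsto_of_tendsto_of_tendsto_of_le_of_le tendsto_const_nhds h1
      (fun _ => zero_le) fun h => ?_
    dsimp only
    rw [lintegral_const_mul' _ _ ENNReal.ofReal_ne_top, lintegral_const_mul' _ _ hC]
    gcongr
    exact Measure.restrict_le_self
  · filter_upwards [self_mem_nhdsWithin] with h hh
    rw [ae_restrict_iff' hΩ]
    filter_upwards [hp1, hpb, hpt] with x h1 h2 h3 hx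
    have hp0 : 1 ≤ p x := h1 hx
    have hA := hmain h hh x hx hp0 (h2 hx)
    have hB : ‖f x‖ₑ ^ p x ≤ ‖g x‖ₑ := by rw [← h3 hx]; exact le_self_add
    have hG : ∫⁻ a, ‖g (x + h • a)‖ₑ ∂σ ≤ ‖g x‖ₑ + ∫⁻ a, ‖g (x + h • a) - g x‖ₑ ∂σ := by
      calc ∫⁻ a, ‖g (x + h • a)‖ₑ ∂σ ≤ ∫⁻ a, (‖g x‖ₑ + ‖g (x + h • a) - g x‖ₑ) ∂σ := by
            refine lintegral_mono fun a => ?_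
            calc ‖g (x + h • a)‖ₑ = ‖g x + (g (x + h • a) - g x)‖ₑ := by rw [add_sub_cancel]
              _ ≤ _ := enorm_add_le _ _
        _ = _ := by rw [lintegral_add_left measurable_const]; simp
    have hsub : ‖(∫ a, f (x + h • a) ∂σ) - f x‖ₑ ≤ (∫⁻ a, ‖f (x + h • a)‖ₑ ∂σ) + ‖f x‖ₑ := by
      refine (enorm_sub_le).trans ?_
      gcongr
      exact enorm_integral_le_lintegral_enorm _
    calc ‖(∫ a, f (x + h • a) ∂σ) - f x‖ₑ ^ p x
        ≤ ((∫⁻ a, ‖f (x + h • a)‖ₑ ∂σ) + ‖f x‖ₑ) ^ p x :=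
          ENNReal.rpow_le_rpow hsub (by linarith)
      _ ≤ 2 ^ (p x - 1) * ((∫⁻ a, ‖f (x + h • a)‖ₑ ∂σ) ^ p x + ‖f x‖ₑ ^ p x) :=
          ENNReal.rpow_add_le_mul_rpow_add_rpow _ _ hp0
      _ ≤ c * (C * (‖g x‖ₑ + ∫⁻ a, ‖g (x + h • a) - g x‖ₑ ∂σ) + ‖g x‖ₑ) := by
          gcongr
          · simp only [c]
            rw [← ENNReal.ofReal_rpow_of_pos two_pos]
            simp only [ENNReal.ofReal_ofNat]
            exact ENNReal.rpow_le_rpow_of_exponent_le (by norm_num) (by linarith [h2 hx])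
          · exact hA.trans (by gcongr)
      _ = _ := by ring

end AverageConvergence


open scoped Convolution

/-! ### Mollification as an average against a smooth bump. -/

section Mollification

variable {d : ℕ} {v : Vec d}

/-- The probability measure with density a normalized bump function. -/
noncomputable def bumpMeasure (w : ContDiffBump v) : Measure (Vec d) :=
  volume.withDensity fun a => ENNReal.ofReal (w.normed volume a)

lemma continuous_normed (w : ContDiffBump v) : Continuous (w.normed volume) :=
  (w.contDiff_normed (n := 0)).continuous

/-- The centre `v` need not be the origin: at scale h the average then translates by about h v and
mollifies simultaneously, which later moves supports into Ω. This is why ‖v‖ enters the radius. -/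
lemma isAveraging_bumpMeasure (w : ContDiffBump v) :
    IsAveraging (bumpMeasure w) (1 / volume.real (Metric.closedBall v w.rIn))
      (max 1 (‖v‖ + w.rOut)) where
  isProbabilityMeasure := ⟨by
    rw [bumpMeasure, withDensity_apply _ MeasurableSet.univ, Measure.restrict_univ,
      ← ofReal_integral_eq_lintegral_ofReal w.integrable_normed
        (ae_of_all _ fun a => w.nonneg_normed a), w.integral_normed, ENNReal.ofReal_one]⟩
  le_smul := by
    rw [bumpMeasure, ← withDensity_const]
    exact withDensity_mono (ae_of_all _ fun a =>
      ENNReal.ofReal_le_ofReal (w.normed_le_div_measure_closedBall_rIn volume a))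
  one_le_radius := le_max_left _ _
  norm_le := by
    rw [bumpMeasure, ae_withDensity_iff (continuous_normed w).measurable.ennreal_ofReal]
    refine ae_of_all _ fun a ha => ?_
    have h1 : a ∈ Function.support (w.normed volume) := fun h => ha (by rw [h]; simp)
    rw [w.support_normed_eq, mem_ball_iff_norm] at h1
    have h2 : ‖a‖ ≤ ‖v‖ + ‖a - v‖ := by
      calc ‖a‖ = ‖v + (a - v)‖ := by rw [add_sub_cancel]
        _ ≤ _ := norm_add_le _ _
    exact le_max_of_le_right (by linarith)

/-- The rescaled and reflected bump function. -/
noncomputable def bumpKernel (w : ContDiffBump v) (h : ℝ) (z : Vec d) : ℝ :=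
  (h ^ d)⁻¹ * w.normed volume ((-h⁻¹) • z)

lemma contDiff_bumpKernel (w : ContDiffBump v) (h : ℝ) :
    ContDiff ℝ (⊤ : ℕ∞) (bumpKernel w h) :=
  contDiff_const.mul (w.contDiff_normed.comp (contDiff_const_smul _))

lemma hasCompactSupport_bumpKernel (w : ContDiffBump v) {h : ℝ} (hh : 0 < h) :
    HasCompactSupport (bumpKernel w h) :=
  (w.hasCompactSupport_normed.comp_smul (neg_ne_zero.2 (inv_ne_zero hh.ne'))).mul_left

variable {E : Type*} [NormedAddCommGroup E] [NormedSpace ℝ E]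

lemma integral_bumpMeasure (w : ContDiffBump v) {h : ℝ} (hh : 0 < h) (f : Vec d → E)
    (x : Vec d) :
    ∫ a, f (x + h • a) ∂(bumpMeasure w) = ∫ t, bumpKernel w h (x - t) • f t := by
  rw [bumpMeasure, integral_withDensity_eq_integral_toReal_smul
    (continuous_normed w).measurable.ennreal_ofReal (ae_of_all _ fun _ => ENNReal.ofReal_lt_top)]
  have h1 : (fun a => (ENNReal.ofReal (w.normed volume a)).toReal • f (x + h • a))
      = fun a => (fun y => w.normed volume (h⁻¹ • y) • f (x + y)) (h • a) := by
    ext a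
    dsimp only
    rw [ENNReal.toReal_ofReal (w.nonneg_normed a), inv_smul_smul₀ hh.ne']
  rw [h1, Measure.integral_comp_smul volume fun y => w.normed volume (h⁻¹ • y) • f (x + y), finrank_euclideanSpace_fin, abs_of_pos (by positivity),
    ← integral_add_left_eq_self (fun t => bumpKernel w h (x - t) • f t) x, ← integral_smul]
  congr 1
  ext y
  simp [bumpKernel, mul_smul]

lemma integral_bumpMeasure_eq_convolution (w : ContDiffBump v) {h : ℝ} (hh : 0 < h)
    (f : Vec d → E) : (fun x => ∫ a, f (x + h • a) ∂(bumpMeasure w))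
      = f ⋆[(ContinuousLinearMap.lsmul ℝ ℝ).flip] bumpKernel w h := by
  ext x
  rw [integral_bumpMeasure w hh, convolution_def]
  rfl

lemma contDiff_integral_bumpMeasure (w : ContDiffBump v) {h : ℝ} (hh : 0 < h) {f : Vec d → E}
    (hf : Integrable f) :
    ContDiff ℝ (⊤ : ℕ∞) fun x => ∫ a, f (x + h • a) ∂(bumpMeasure w) := by
  rw [integral_bumpMeasure_eq_convolution w hh]
  exact (hasCompactSupport_bumpKernel w hh).contDiff_convolution_right _ hf.locallyIntegrable
    (contDiff_bumpKernel w h)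

lemma support_integral_bumpMeasure_subset (w : ContDiffBump v) (h : ℝ) (f : Vec d → E) :
    Function.support (fun x => ∫ a, f (x + h • a) ∂(bumpMeasure w)) ⊆
      (fun z : Vec d × Vec d => z.1 - h • z.2) '' (tsupport f ×ˢ Metric.closedBall v w.rOut) := by
  intro x hx
  by_contra hcon
  refine hx ?_
  dsimp only
  rw [bumpMeasure, integral_withDensity_eq_integral_toReal_smul
    (continuous_normed w).measurable.ennreal_ofReal (ae_of_all _ fun _ => ENNReal.ofReal_lt_top)]
  refine integral_eq_zero_of_ae (ae_of_all _ fun a => ?_)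
  by_cases ha : a ∈ Metric.ball v w.rOut
  · have : f (x + h • a) = 0 := by
      by_contra hne
      exact hcon ⟨(x + h • a, a), ⟨subset_tsupport f hne, Metric.ball_subset_closedBall ha⟩,
        by simp⟩
    simp [this]
  · rw [← w.support_normed_eq (μ := volume), Function.notMem_support] at ha
    simp [ha]

lemma tsupport_integral_bumpMeasure_subset (w : ContDiffBump v) (h : ℝ) {f : Vec d → E}
    (hf : HasCompactSupport f) :
    tsupport (fun x => ∫ a, f (x + h • a) ∂(bumpMeasure w)) ⊆
      (fun z : Vec d × Vec d => z.1 - h • z.2) '' (tsupport f ×ˢ Metric.closedBall v w.rOut) := by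
  have : IsCompact ((fun z : Vec d × Vec d => z.1 - h • z.2) ''
      (tsupport f ×ˢ Metric.closedBall v w.rOut)) :=
    (IsCompact.prod hf (isCompact_closedBall _ _)).image (by fun_prop)
  exact closure_minimal (support_integral_bumpMeasure_subset w h f) this.isClosed

lemma hasCompactSupport_integral_bumpMeasure (w : ContDiffBump v) (h : ℝ) {f : Vec d → E}
    (hf : HasCompactSupport f) :
    HasCompactSupport (fun x => ∫ a, f (x + h • a) ∂(bumpMeasure w)) :=
  ((IsCompact.prod hf (isCompact_closedBall v w.rOut)).image
    (by fun_prop : Continuous fun z : Vec d × Vec d => z.1 - h • z.2)).of_isClosed_subset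
    (isClosed_tsupport _) (tsupport_integral_bumpMeasure_subset w h hf)

lemma integral_bumpMeasure_coord (w : ContDiffBump v) {h : ℝ} (hh : 0 < h) {ι : Type*} [Fintype ι]
    {f : Vec d → EuclideanSpace ℝ ι} (hf : Integrable f) (x : Vec d) (k : ι) :
    (∫ a, f (x + h • a) ∂(bumpMeasure w)) k = ∫ a, f (x + h • a) k ∂(bumpMeasure w) := by
  have := (EuclideanSpace.proj k : EuclideanSpace ℝ ι →L[ℝ] ℝ).integral_comp_comm
    ((isAveraging_bumpMeasure w).integrable_comp hf hh x)
  exact this.symm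

/-- Mollification commutes with the symmetric gradient. -/
lemma symGrad_integral_bumpMeasure (w : ContDiffBump v) {h : ℝ} (hh : 0 < h)
    {Ω : Set (Vec d)} (hΩ : MeasurableSet Ω) {u : Vec d → Vec d} {G : Vec d → Tensor d}
    (hu : HasZeroSymGrad Ω u G) (x : Vec d) :
    symGrad (fun x => ∫ a, Ω.indicator u (x + h • a) ∂(bumpMeasure w)) x
      = ∫ a, Ω.indicator G (x + h • a) ∂(bumpMeasure w) := by
  obtain ⟨iu, iG, -⟩ := (hasZeroSymGrad_iff hΩ).1 hu
  set ρ := bumpKernel w h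
  have hρ : ContDiff ℝ (⊤ : ℕ∞) ρ := contDiff_bumpKernel w h
  have hρc : HasCompactSupport ρ := hasCompactSupport_bumpKernel w hh
  -- The reflected kernel centred at x may meet the boundary of Ω; it is admissible because
  -- `HasZeroSymGrad` tests with every smooth compactly supported function of the whole space.
  set ψ : Vec d → ℝ := fun t => ρ (x - t)
  have hψ : ContDiff ℝ (⊤ : ℕ∞) ψ := hρ.comp (contDiff_const.sub contDiff_id)
  have hψc : HasCompactSupport ψ :=
    hρc.comp_homeomorph (Homeomorph.subLeft x)
  have hψd : ∀ t a, fderiv ℝ ψ t a = -fderiv ℝ ρ (x - t) a := by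
    intro t a
    have h1 : HasFDerivAt (fun t : Vec d => x - t) (-ContinuousLinearMap.id ℝ (Vec d)) t :=
      (hasFDerivAt_id t).const_sub x
    have h2 : HasFDerivAt ψ ((fderiv ℝ ρ (x - t)).comp (-ContinuousLinearMap.id ℝ (Vec d))) t :=
      (hρ.differentiable (by simp) (x - t)).hasFDerivAt.comp t h1
    rw [h2.fderiv]
    simp
  have hS := contDiff_integral_bumpMeasure w hh iu
  have hderiv : ∀ (i : Fin d) (a : Vec d),
      fderiv ℝ (fun x => ∫ a, Ω.indicator u (x + h • a) ∂(bumpMeasure w)) x a i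
        = ∫ t, Ω.indicator u t i * fderiv ℝ ρ (x - t) a := by
    intro i a
    have iui : Integrable fun t => Ω.indicator u t i := Integrable.coord iu i
    rw [← fderiv_coord hS]
    have h3 : (fun y => (∫ a, Ω.indicator u (y + h • a) ∂(bumpMeasure w)) i)
        = (fun t => Ω.indicator u t i) ⋆[ContinuousLinearMap.mul ℝ ℝ] ρ := by
      ext y
      rw [integral_bumpMeasure_coord w hh iu,
        integral_bumpMeasure w hh (fun t => Ω.indicator u t i), convolution_def]
      congr 1
      ext t
      simp [mul_comm, ρ]
    have h4 := hρc.hasFDerivAt_convolution_right (ContinuousLinearMap.mul ℝ ℝ)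
      iui.locallyIntegrable (hρ.of_le (by exact_mod_cast le_top)) x
    rw [h3, h4.fderiv, convolution_precompR_apply _ iui.locallyIntegrable (hρc.fderiv ℝ)
      (hρ.continuous_fderiv (by simp)), convolution_def]
    rfl
  ext ⟨i, j⟩
  rw [integral_bumpMeasure_coord w hh iG,
    integral_bumpMeasure w hh (fun t => Ω.indicator G t (i, j))]
  have key := hu.integral_eq ψ hψ hψc i j
  rw [← integral_symPairing_indicator hΩ, ← integral_coord_mul_indicator hΩ] at key
  obtain ⟨Ci, hCi⟩ := exists_bound_fderiv_apply hψ hψc (spaceDir i)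
  obtain ⟨Cj, hCj⟩ := exists_bound_fderiv_apply hψ hψc (spaceDir j)
  have I1 := Integrable.coord_mul iu
    (continuous_fderiv_apply_const hψ (spaceDir j)).aestronglyMeasurable hCj i
  have I2 := Integrable.coord_mul iu
    (continuous_fderiv_apply_const hψ (spaceDir i)).aestronglyMeasurable hCi j
  have e1 : ∫ t, symPairing spaceDir (Ω.indicator u) ψ i j t
      = (1 / 2 : ℝ) * ((∫ t, Ω.indicator u t i * fderiv ℝ ψ t (spaceDir j)) +
          ∫ t, Ω.indicator u t j * fderiv ℝ ψ t (spaceDir i)) := by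
    rw [← integral_add I1 I2, ← integral_const_mul]; rfl
  have e2 : ∫ t, ρ (x - t) • Ω.indicator G t (i, j) = ∫ t, Ω.indicator G t (i, j) * ψ t := by
    congr 1; ext t; rw [smul_eq_mul, mul_comm]
  rw [e2, ← neg_inj, ← key, e1]
  simp only [hψd, mul_neg, integral_neg, symGrad, hderiv]
  ring

end Mollification


/-! ### A Poincaré inequality for the symmetric gradient. -/

section Poincare

variable {d : ℕ}

/-- A quadratic form sees only the symmetric part of a matrix. Hence the derivative along `a` of the
component along `a` is controlled by the symmetric gradient alone, and no Korn inequality is needed.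
-/
lemma sum_mul_symGrad (V : Vec d → Vec d) (y a : Vec d) :
    ∑ i, ∑ j, a i * a j * symGrad V y (i, j) = ∑ i, a i * fderiv ℝ V y a i := by
  have ha : a = ∑ j, a j • (spaceDir j : Vec d) := by
    ext i
    simp [spaceDir, Pi.single_apply, Finset.sum_apply]
  have h1 : ∀ i, fderiv ℝ V y a i = ∑ j, a j * fderiv ℝ V y (spaceDir j) i := by
    intro i
    conv_lhs => rw [ha, map_sum]
    simp [map_smul]
  have h2 : ∑ i, ∑ j, a i * a j * fderiv ℝ V y (spaceDir i) j
      = ∑ i, ∑ j, a i * a j * fderiv ℝ V y (spaceDir j) i := by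
    rw [Finset.sum_comm]
    refine Finset.sum_congr rfl fun i _ => Finset.sum_congr rfl fun j _ => ?_
    ring
  calc ∑ i, ∑ j, a i * a j * symGrad V y (i, j)
      = (1 / 2 : ℝ) * ((∑ i, ∑ j, a i * a j * fderiv ℝ V y (spaceDir j) i) +
          ∑ i, ∑ j, a i * a j * fderiv ℝ V y (spaceDir i) j) := by
        simp only [symGrad, Finset.mul_sum, ← Finset.sum_add_distrib]
        refine Finset.sum_congr rfl fun i _ => Finset.sum_congr rfl fun j _ => ?_
        ring
    _ = ∑ i, ∑ j, a i * a j * fderiv ℝ V y (spaceDir j) i := by rw [h2]; ring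
    _ = ∑ i, a i * fderiv ℝ V y a i := by
        refine Finset.sum_congr rfl fun i _ => ?_
        rw [h1, Finset.mul_sum]
        refine Finset.sum_congr rfl fun j _ => ?_
        ring

/-- The component of a smooth field in direction `a` is controlled by a line integral of its
symmetric gradient in that direction. -/
lemma enorm_sum_mul_le_lintegral_symGrad {V : Vec d → Vec d} (hV : ContDiff ℝ (⊤ : ℕ∞) V)
    {x a : Vec d} (hx : V (x + a) = 0) {A : ℝ} (hA : ‖a‖ ≤ A) :
    ‖∑ i, a i * V x i‖ₑ ≤ ENNReal.ofReal (d * d * A ^ 2) *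
      ∫⁻ t in Set.Ioc (0 : ℝ) 1, ‖symGrad V (x + t • a)‖ₑ := by
  have hA0 : 0 ≤ A := (norm_nonneg a).trans hA
  set f : ℝ → ℝ := fun t => ∑ i, a i * V (x + t • a) i
  set f' : ℝ → ℝ := fun t => ∑ i, ∑ j, a i * a j * symGrad V (x + t • a) (i, j)
  have hf : ∀ t, HasDerivAt f (f' t) t := by
    intro t
    have h1 : HasDerivAt (fun t : ℝ => x + t • a) a t := by
      simpa using ((hasDerivAt_id t).smul_const a).const_add x
    have h2 : HasDerivAt (fun t => V (x + t • a)) (fderiv ℝ V (x + t • a) a) t :=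
      (hV.differentiable (by simp) (x + t • a)).hasFDerivAt.comp_hasDerivAt t h1
    simp only [f', sum_mul_symGrad]
    refine HasDerivAt.fun_sum fun i _ => ?_
    have h3 := (EuclideanSpace.proj i : Vec d →L[ℝ] ℝ).hasFDerivAt.comp_hasDerivAt t h2
    exact h3.const_mul (a i)
  have hsc : Continuous fun t : ℝ => symGrad V (x + t • a) :=
    (continuous_symGrad hV).comp (by fun_prop)
  have hf'c : Continuous f' := by
    refine continuous_finsetSum _ fun i _ => continuous_finsetSum _ fun j _ => ?_
    exact continuous_const.mul
      ((EuclideanSpace.proj (i, j) : Tensor d →L[ℝ] ℝ).continuous.comp hsc)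
  have hint : ∫ t in (0 : ℝ)..1, f' t = f 1 - f 0 :=
    intervalIntegral.integral_eq_sub_of_hasDerivAt (fun t _ => hf t) (hf'c.intervalIntegrable _ _)
  have h1 : f 1 = 0 := by simp [f, hx]
  have h0 : f 0 = ∑ i, a i * V x i := by simp [f]
  rw [intervalIntegral.integral_of_le zero_le_one, h1, zero_sub, h0] at hint
  rw [← enorm_neg, ← hint]
  refine (enorm_integral_le_lintegral_enorm _).trans ?_
  rw [← lintegral_const_mul' _ _ ENNReal.ofReal_ne_top]
  refine lintegral_mono fun t => ?_
  rw [← ofReal_norm, ← ofReal_norm, ← ENNReal.ofReal_mul (by positivity)]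
  refine ENNReal.ofReal_le_ofReal ?_
  have hai : ∀ i, ‖a i‖ ≤ A := fun i => (PiLp.norm_apply_le a i).trans hA
  -- There are d · d summands, and each coefficient a_i a_j is at most A² in modulus.
  calc ‖f' t‖ ≤ ∑ _i : Fin d, ∑ _j : Fin d, A ^ 2 * ‖symGrad V (x + t • a)‖ := by
        refine norm_sum_le_of_le _ fun i _ => norm_sum_le_of_le _ fun j _ => ?_
        rw [norm_mul, norm_mul, sq]
        gcongr
        · exact hai i
        · exact hai j
        · exact PiLp.norm_apply_le _ _
    _ = d * d * A ^ 2 * ‖symGrad V (x + t • a)‖ := by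
        simp only [Finset.sum_const, Finset.card_univ, Fintype.card_fin, nsmul_eq_mul]
        ring

/-- A bump function centred at a large multiple of a coordinate direction. -/
noncomputable def dirBump (d : ℕ) (N : ℝ) (hN : 0 < N) (k : Fin d) :
    ContDiffBump (N • spaceDir k : Vec d) where
  rIn := N / (4 * (d + 1))
  -- For a in this ball, replacing a by N e_k changes a · V by at most N‖V‖ / (2(d + 1)). After
  -- division by N, the d errors add up to at most ‖V‖ / 2 and can be absorbed.
  rOut := N / (2 * (d + 1))
  rIn_pos := by positivity
  rIn_lt_rOut := by
    refine div_lt_div_of_pos_left hN (by positivity) ?_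
    have : (0 : ℝ) ≤ d := by positivity
    linarith

lemma norm_mem_of_mem_dirBump {N : ℝ} (hN : 0 < N) {k : Fin d} {a : Vec d}
    (ha : a ∈ Metric.ball (N • spaceDir k : Vec d) (N / (2 * (d + 1)))) :
    N / 2 ≤ ‖a‖ ∧ ‖a‖ ≤ 2 * N := by
  rw [mem_ball_iff_norm] at ha
  have h1 : ‖(N • spaceDir k : Vec d)‖ = N := by
    rw [norm_smul, norm_spaceDir, mul_one, Real.norm_of_nonneg hN.le]
  have h2 : N / (2 * (d + 1)) ≤ N / 2 := by
    refine div_le_div_of_nonneg_left hN.le two_pos ?_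
    have : (0 : ℝ) ≤ d := by positivity
    linarith
  have h3 := norm_sub_norm_le (N • spaceDir k : Vec d) a
  have h4 := norm_sub_norm_le a (N • spaceDir k : Vec d)
  rw [norm_sub_rev] at h3
  rw [h1] at h3 h4
  constructor <;> linarith

/-- The sum of the averaged line integrals of `f`. -/
noncomputable def conePotential (d : ℕ) (N : ℝ) (hN : 0 < N) (f : Vec d → ℝ≥0∞) (x : Vec d) :
    ℝ≥0∞ :=
  ∑ k : Fin d, ∫⁻ t in Set.Ioc (0 : ℝ) 1, ∫⁻ a, f (x + t • a) ∂(bumpMeasure (dirBump d N hN k))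

variable {N : ℝ} {hN : 0 < N}

lemma measurable_integrand {f : Vec d → ℝ≥0∞} (hf : Measurable f) {v : Vec d}
    (w : ContDiffBump v) :
    Measurable fun z : Vec d × ℝ => ∫⁻ a, f (z.1 + z.2 • a) ∂(bumpMeasure w) := by
  have := (isAveraging_bumpMeasure w).isProbabilityMeasure
  exact Measurable.lintegral_prod_right'
    (f := fun y : (Vec d × ℝ) × Vec d => f (y.1.1 + y.1.2 • y.2)) (hf.comp (by fun_prop))

lemma measurable_conePotential {f : Vec d → ℝ≥0∞} (hf : Measurable f) :
    Measurable (conePotential d N hN f) :=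
  Finset.measurable_sum _ fun _ _ => (measurable_integrand hf _).lintegral_prod_right'

lemma conePotential_le_add {f g : Vec d → ℝ≥0∞} (hf : Measurable f) (h : Vec d → ℝ≥0∞)
    (hle : ∀ y, h y ≤ f y + g y) (x : Vec d) :
    conePotential d N hN h x ≤ conePotential d N hN f x + conePotential d N hN g x := by
  simp only [conePotential, ← Finset.sum_add_distrib]
  refine Finset.sum_le_sum fun k _ => ?_
  have hm : Measurable fun t : ℝ => ∫⁻ a, f (x + t • a) ∂(bumpMeasure (dirBump d N hN k)) :=
    (measurable_integrand hf _).comp (measurable_const.prodMk measurable_id)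
  rw [← lintegral_add_left hm]
  refine lintegral_mono fun t => ?_
  dsimp only
  rw [← lintegral_add_left (show Measurable fun a : Vec d => f (x + t • a) from
    hf.comp (by fun_prop))]
  exact lintegral_mono fun a => hle _

lemma lintegral_conePotential {f : Vec d → ℝ≥0∞} (hf : Measurable f) :
    ∫⁻ x, conePotential d N hN f x = d * ∫⁻ y, f y := by
  simp only [conePotential]
  rw [lintegral_finsetSum _ fun k _ => (measurable_integrand hf _).lintegral_prod_right']
  have : ∀ k : Fin d, ∫⁻ x, ∫⁻ t in Set.Ioc (0 : ℝ) 1,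
      ∫⁻ a, f (x + t • a) ∂(bumpMeasure (dirBump d N hN k)) = ∫⁻ y, f y := by
    intro k
    rw [lintegral_lintegral_swap (measurable_integrand hf _).aemeasurable]
    calc _ = ∫⁻ _t in Set.Ioc (0 : ℝ) 1, ∫⁻ y, f y := by
          refine setLIntegral_congr_fun measurableSet_Ioc fun t ht => ?_
          exact (isAveraging_bumpMeasure _).lintegral_lintegral ht.1 hf.aemeasurable
      _ = _ := by simp
  simp [this]

/-- The pointwise Poincaré inequality for smooth fields, in terms of the symmetric gradient. -/
lemma enorm_le_conePotential {V : Vec d → Vec d} (hV : ContDiff ℝ (⊤ : ℕ∞) V) (hN1 : 1 ≤ N)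
    {x : Vec d} (hx : ∀ a : Vec d, N / 2 ≤ ‖a‖ → V (x + a) = 0) :
    ‖V x‖ₑ ≤ ENNReal.ofReal (2 * (d * d * (2 * N) ^ 2)) *
      conePotential d N hN (fun y => ‖symGrad V y‖ₑ) x := by
  set δ : ℝ := 1 / (2 * (d + 1))
  set C : ℝ := d * d * (2 * N) ^ 2
  have hsm : Measurable fun y => ‖symGrad V y‖ₑ := (continuous_symGrad hV).enorm.measurable
  -- The line estimate is averaged over directions near N e_k: single line integrals are not
  -- controlled by L^p norms, whereas their averages are handled by `IsAveraging`.
  have hk : ∀ k : Fin d, ENNReal.ofReal (|V x k| - δ * ‖V x‖) ≤ ENNReal.ofReal C *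
      ∫⁻ t in Set.Ioc (0 : ℝ) 1, ∫⁻ a, ‖symGrad V (x + t • a)‖ₑ
        ∂(bumpMeasure (dirBump d N hN k)) := by
    intro k
    have hp := (isAveraging_bumpMeasure (dirBump d N hN k)).isProbabilityMeasure
    rw [lintegral_lintegral_swap]
    swap
    · exact (hsm.comp (by fun_prop : Measurable fun z : ℝ × Vec d => x + z.1 • z.2)).aemeasurable
    calc ENNReal.ofReal (|V x k| - δ * ‖V x‖)
        = ∫⁻ _a, ENNReal.ofReal (|V x k| - δ * ‖V x‖) ∂(bumpMeasure (dirBump d N hN k)) := by simp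
      _ ≤ ∫⁻ a, ENNReal.ofReal C * (∫⁻ t in Set.Ioc (0 : ℝ) 1, ‖symGrad V (x + t • a)‖ₑ)
            ∂(bumpMeasure (dirBump d N hN k)) := by
          refine lintegral_mono_ae ?_
          rw [bumpMeasure, ae_withDensity_iff (continuous_normed _).measurable.ennreal_ofReal]
          refine ae_of_all _ fun a ha => ?_
          have h1 : a ∈ Function.support ((dirBump d N hN k).normed volume) :=
            fun h => ha (by rw [h]; simp)
          rw [ContDiffBump.support_normed_eq] at h1
          obtain ⟨h2, h3⟩ := norm_mem_of_mem_dirBump hN h1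
          refine le_trans ?_ (enorm_sum_mul_le_lintegral_symGrad hV (hx a h2) h3)
          rw [← ofReal_norm]
          refine ENNReal.ofReal_le_ofReal ?_
          rw [mem_ball_iff_norm] at h1
          have h4 : ∑ i, a i * V x i
              = N * V x k + ∑ i, (a - N • spaceDir k) i * V x i := by
            simp [spaceDir, sub_mul, Finset.sum_sub_distrib]
          have h5 : |∑ i, (a - N • spaceDir k) i * V x i| ≤ N * δ * ‖V x‖ := by
            have h6 : ∑ i, (a - N • spaceDir k) i * V x i
                = inner ℝ (V x) (a - N • spaceDir k) := by
              simp [PiLp.inner_apply]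
            rw [h6]
            refine (abs_real_inner_le_norm _ _).trans ?_
            have h7 : ‖a - N • spaceDir k‖ ≤ N * δ := by
              refine h1.le.trans_eq ?_
              simp only [dirBump, δ]; ring
            rw [mul_comm]
            gcongr
          have h8 : N * |V x k| - N * δ * ‖V x‖ ≤ |∑ i, a i * V x i| := by
            rw [h4]
            have h9 := abs_sub_abs_le_abs_add (N * V x k)
              (∑ i, (a - N • spaceDir k) i * V x i)
            rw [abs_mul, abs_of_pos hN] at h9
            linarith
          rw [Real.norm_eq_abs]
          rcases le_or_gt (|V x k| - δ * ‖V x‖) 0 with h | h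
          · exact h.trans (abs_nonneg _)
          · nlinarith
      _ = _ := by rw [lintegral_const_mul' _ _ ENNReal.ofReal_ne_top]
  -- Sum over the coordinates and absorb the total error, using d δ ≤ 1/2.
  have hsum : ‖V x‖ ≤ 2 * ∑ k, (|V x k| - δ * ‖V x‖) := by
    have h1 : ‖V x‖ ≤ ∑ k, |V x k| := by
      have h2 : V x = ∑ k, V x k • (spaceDir k : Vec d) := by
        ext i
        simp [spaceDir, Pi.single_apply, Finset.sum_apply]
      conv_lhs => rw [h2]
      refine (norm_sum_le _ _).trans (Finset.sum_le_sum fun k _ => ?_)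
      rw [norm_smul, norm_spaceDir, mul_one, Real.norm_eq_abs]
    have h3 : (d : ℝ) * δ ≤ 1 / 2 := by
      simp only [δ]
      rw [mul_one_div, div_le_div_iff₀ (by positivity) two_pos]
      linarith
    rw [Finset.sum_sub_distrib, Finset.sum_const, Finset.card_univ, Fintype.card_fin, nsmul_eq_mul]
    nlinarith [norm_nonneg (V x)]
  calc ‖V x‖ₑ ≤ ENNReal.ofReal 2 * ∑ k, ENNReal.ofReal (|V x k| - δ * ‖V x‖) := by
        rw [← ofReal_norm]
        refine (ENNReal.ofReal_le_ofReal hsum).trans ?_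
        rw [ENNReal.ofReal_mul zero_le_two]
        gcongr
        exact Finset.le_sum_of_subadditive _ ENNReal.ofReal_zero.le
          (fun _ _ => ENNReal.ofReal_add_le) _ _
    _ ≤ ENNReal.ofReal 2 * ∑ k : Fin d, ENNReal.ofReal C *
          ∫⁻ t in Set.Ioc (0 : ℝ) 1, ∫⁻ a, ‖symGrad V (x + t • a)‖ₑ
            ∂(bumpMeasure (dirBump d N hN k)) := by
        gcongr with k _
        exact hk k
    _ = _ := by
        rw [← Finset.mul_sum, ← mul_assoc, ← ENNReal.ofReal_mul zero_le_two]
        rfl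

/-- The pointwise Poincaré inequality for fields with zero trace. -/
lemma HasZeroSymGrad.ae_enorm_le_conePotential {Ω : Set (Vec d)} (hΩ : MeasurableSet Ω)
    (hN1 : 1 ≤ N) {u : Vec d → Vec d} {G : Vec d → Tensor d} (h : HasZeroSymGrad Ω u G)
    {R : ℝ} (hΩR : Ω ⊆ Metric.closedBall 0 R) (hNR : 4 * R + 2 < N) {g : Vec d → ℝ≥0∞}
    (hg : Measurable g) (hgG : (fun y => ‖Ω.indicator G y‖ₑ) =ᵐ[volume] g) :
    ∀ᵐ x, x ∈ Ω → ‖u x‖ₑ ≤ ENNReal.ofReal (2 * (d * d * (2 * N) ^ 2)) *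
      conePotential d N hN g x := by
  obtain ⟨iu, iG, -⟩ := (hasZeroSymGrad_iff hΩ).1 h
  set U := Ω.indicator u
  set C : ℝ≥0∞ := ENNReal.ofReal (2 * (d * d * (2 * N) ^ 2))
  let w : ContDiffBump (0 : Vec d) := ⟨1 / 2, 1, by norm_num, by norm_num⟩
  have hσ := isAveraging_bumpMeasure w
  -- For s ≤ 1 the mollified field is supported within radius R + 1. From a point of Ω a
  -- displacement of length at least N/2 > 2R + 1 therefore leaves the support, as the smooth
  -- inequality requires.
  set V : ℝ → Vec d → Vec d := fun s x => ∫ a, U (x + s • a) ∂(bumpMeasure w)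
  obtain ⟨F, hF, hFG⟩ := iG.1
  have hgF : ∀ᵐ y, g y = ‖F y‖ₑ := by
    filter_upwards [hgG, hFG] with y h1 h2
    rw [← h1, h2]
  -- The potential ignores null sets at every point x, because for each t > 0 the average has a
  -- density with respect to Lebesgue measure.
  have hcone : ∀ x, conePotential d N hN (fun y => ‖F y‖ₑ) x = conePotential d N hN g x := by
    intro x
    refine Finset.sum_congr rfl fun k _ => setLIntegral_congr_fun measurableSet_Ioc fun t ht => ?_
    refine lintegral_congr_ae ?_
    filter_upwards [((isAveraging_bumpMeasure (dirBump d N hN k)).quasiMeasurePreserving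
      ht.1 x).ae hgF] with a ha
    exact ha.symm
  have hsG : ∀ s, 0 < s → ∀ x, symGrad (V s) x = ∫ a, Ω.indicator G (x + s • a) ∂(bumpMeasure w) :=
    fun s hs x => symGrad_integral_bumpMeasure w hs hΩ h x
  have hVs : ∀ s, 0 < s → ContDiff ℝ (⊤ : ℕ∞) (V s) := fun s hs =>
    contDiff_integral_bumpMeasure w hs iu
  set E : ℝ → Vec d → ℝ≥0∞ := fun s x => ‖V s x - U x‖ₑ +
    C * conePotential d N hN (fun y => ‖symGrad (V s) y - F y‖ₑ) x
  have hme : ∀ s, 0 < s → Measurable fun y => ‖symGrad (V s) y - F y‖ₑ := fun s hs =>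
    ((continuous_symGrad (hVs s hs)).stronglyMeasurable.sub hF).enorm
  have hbound : ∀ s, 0 < s → s ≤ 1 → ∀ x ∈ Ω, ‖u x‖ₑ ≤ C * conePotential d N hN g x + E s x := by
    intro s hs hs1 x hx
    have hVx : ∀ a : Vec d, N / 2 ≤ ‖a‖ → V s (x + a) = 0 := by
      intro a ha
      by_contra hne
      obtain ⟨⟨y, b⟩, ⟨hy, hb⟩, hyb⟩ := support_integral_bumpMeasure_subset w s U hne
      have hyR : ‖y‖ ≤ R := by
        have h1 : tsupport U ⊆ Metric.closedBall 0 R :=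
          closure_minimal (Set.support_indicator_subset.trans hΩR) Metric.isClosed_closedBall
        simpa using h1 hy
      have hb1 : ‖b‖ ≤ 1 := by
        have : b ∈ Metric.closedBall (0 : Vec d) 1 := hb
        simpa using this
      have hxR : ‖x‖ ≤ R := by simpa using hΩR hx
      have e1 : a = y - s • b - x := by
        have : y - s • b = x + a := hyb
        rw [this, add_sub_cancel_left]
      have e2 : ‖s • b‖ ≤ 1 := by
        rw [norm_smul, Real.norm_of_nonneg hs.le]
        nlinarith [norm_nonneg b]
      have e3 : ‖a‖ ≤ ‖y‖ + ‖s • b‖ + ‖x‖ := by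
        rw [e1]
        exact (norm_sub_le _ _).trans (by gcongr; exact norm_sub_le _ _)
      linarith
    have h1 : ‖V s x‖ₑ ≤ C * conePotential d N hN (fun y => ‖symGrad (V s) y‖ₑ) x :=
      enorm_le_conePotential (hVs s hs) hN1 hVx
    have h2 := conePotential_le_add (d := d) (N := N) (hN := hN) hF.enorm
      (g := fun y => ‖symGrad (V s) y - F y‖ₑ) (fun y => ‖symGrad (V s) y‖ₑ) (fun y => by
        calc ‖symGrad (V s) y‖ₑ = ‖F y + (symGrad (V s) y - F y)‖ₑ := by rw [add_sub_cancel]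
          _ ≤ _ := enorm_add_le _ _) x
    rw [hcone] at h2
    have h3 : ‖u x‖ₑ ≤ ‖V s x‖ₑ + ‖V s x - U x‖ₑ := by
      have e : u x = V s x - (V s x - U x) := by
        rw [sub_sub_cancel]; simp [U, hx]
      conv_lhs => rw [e]
      exact enorm_sub_le
    calc ‖u x‖ₑ ≤ C * (conePotential d N hN g x +
          conePotential d N hN (fun y => ‖symGrad (V s) y - F y‖ₑ) x) + ‖V s x - U x‖ₑ :=
          h3.trans (by gcongr; exact h1.trans (by gcongr))
      _ = _ := by simp only [E]; ring
  have hE : Tendsto (fun s => ∫⁻ x in Ω, E s x) (𝓝[>] 0) (𝓝 0) := by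
    have t1 := hσ.tendsto_lintegral_integral_sub iu
    have t2 := hσ.tendsto_lintegral_integral_sub iG
    have t3 : Tendsto (fun s : ℝ => (∫⁻ x, ‖V s x - U x‖ₑ) + C * (d *
        ∫⁻ x, ‖(∫ a, Ω.indicator G (x + s • a) ∂(bumpMeasure w)) - Ω.indicator G x‖ₑ))
        (𝓝[>] 0) (𝓝 0) := by
      have := t1.add (ENNReal.Tendsto.const_mul (ENNReal.Tendsto.const_mul t2
        (Or.inr (ENNReal.natCast_ne_top d))) (Or.inr (ENNReal.ofReal_ne_top
          (r := 2 * (d * d * (2 * N) ^ 2)))))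
      simp only [mul_zero, add_zero] at this
      exact this
    refine tendsto_of_tendsto_of_tendsto_of_le_of_le' tendsto_const_nhds t3
      (Eventually.of_forall fun _ => zero_le) ?_
    filter_upwards [self_mem_nhdsWithin] with s hs
    refine (setLIntegral_le_lintegral _ _).trans ?_
    simp only [E]
    rw [lintegral_add_right _ ((measurable_conePotential (hme s hs)).const_mul _),
      lintegral_const_mul' _ _ ENNReal.ofReal_ne_top, lintegral_conePotential (hme s hs)]
    gcongr _ + C * (d * ?_)
    refine (lintegral_congr_ae ?_).le
    filter_upwards [hFG] with y hy
    rw [hsG s hs, hy]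
  -- Subtraction in `ℝ≥0∞` is truncated, so this integrand is the positive part of the defect; it is
  -- dominated by `E s`, whose integral over Ω tends to 0.
  have hzero : ∫⁻ x in Ω, (‖u x‖ₑ - C * conePotential d N hN g x) = 0 := by
    refine le_antisymm (ge_of_tendsto hE ?_) zero_le
    filter_upwards [Ioc_mem_nhdsGT (zero_lt_one (α := ℝ))] with s hs
    refine setLIntegral_mono' hΩ fun x hx => ?_
    exact tsub_le_iff_left.2 (hbound s hs.1 hs.2 x hx)
  rw [lintegral_eq_zero_iff' (show AEMeasurable (fun x => ‖u x‖ₑ - C * conePotential d N hN g x)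
    (volume.restrict Ω) from
      h.1.1.enorm.sub ((measurable_conePotential hg).const_mul _).aemeasurable)] at hzero
  have h4 := (ae_restrict_iff' hΩ).1 hzero
  filter_upwards [h4] with x hx hxΩ
  exact tsub_eq_zero_iff_le.1 (hx hxΩ)

/-- The averaging estimate holds with one constant for all scales t in (0, 1]. Combine it with
Jensen in t and with the fact that averages preserve the integral of g. -/
lemma setLIntegral_conePotential_rpow_lt_top {Ω : Set (Vec d)} (hΩ : MeasurableSet Ω)
    {p : Vec d → ℝ} (hlog : LogHolderOn Ω p) (hp : IsBddExponent Ω p) {f g : Vec d → ℝ≥0∞}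
    (hf : Measurable f) (hg : Measurable g) (hfg : ∀ᵐ y, y ∈ Ω → f y ^ p y + 1 ≤ g y)
    (hf0 : ∀ᵐ y, y ∉ Ω → f y = 0) (hgf : ∫⁻ y, g y ≠ ⊤) :
    ∫⁻ x in Ω, conePotential d N hN f x ^ p x < ⊤ := by
  obtain ⟨b, hb⟩ := hp.bdd
  have hp1 := (ae_restrict_iff' hΩ).1 hp.one_le
  have hσ := fun k : Fin d => isAveraging_bumpMeasure (dirBump d N hN k)
  have hex := fun k => (hσ k).exists_rpow_le hlog hp1 (b := b) hgf
  choose C hC hkey using hex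
  have hpt : ∀ᵐ x ∂(volume.restrict Ω), conePotential d N hN f x ^ p x ≤
      ENNReal.ofReal (max 1 (d : ℝ) ^ b) * ∑ k, C k *
        ∫⁻ t in Set.Ioc (0 : ℝ) 1, ∫⁻ a, g (x + t • a) ∂(bumpMeasure (dirBump d N hN k)) := by
    filter_upwards [hp.one_le, hb, ae_restrict_mem hΩ] with x h1 h2 hx
    refine (ENNReal.rpow_sum_le_const_mul_sum_rpow _ _ h1).trans ?_
    gcongr with k _
    · rw [Finset.card_univ, Fintype.card_fin, ← ENNReal.ofReal_rpow_of_pos (by positivity),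
        ← ENNReal.ofReal_natCast d]
      calc ENNReal.ofReal (d : ℝ) ^ (p x - 1) ≤ ENNReal.ofReal (max 1 (d : ℝ)) ^ (p x - 1) :=
            ENNReal.rpow_le_rpow (ENNReal.ofReal_le_ofReal (le_max_right _ _)) (by linarith)
        _ ≤ _ := ENNReal.rpow_le_rpow_of_exponent_le
            (ENNReal.one_le_ofReal.2 (le_max_left _ _)) (by linarith)
    · have : IsProbabilityMeasure (volume.restrict (Set.Ioc (0 : ℝ) 1)) := ⟨by simp⟩
      have hm : Measurable fun t : ℝ => ∫⁻ a, f (x + t • a) ∂(bumpMeasure (dirBump d N hN k)) :=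
        (measurable_integrand hf _).comp (measurable_const.prodMk measurable_id)
      refine (lintegral_rpow_le_of_isProbabilityMeasure hm.aemeasurable h1).trans ?_
      rw [← lintegral_const_mul' _ _ (hC k)]
      exact setLIntegral_mono' measurableSet_Ioc fun t ht =>
        hkey k f g hf.aemeasurable hfg hf0 le_rfl t ht.1 x hx h1 h2
  refine (lintegral_mono_ae hpt).trans_lt ?_
  have hmk : ∀ k : Fin d, Measurable fun x : Vec d => ∫⁻ t in Set.Ioc (0 : ℝ) 1,
      ∫⁻ a, g (x + t • a) ∂(bumpMeasure (dirBump d N hN k)) := fun k =>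
    (measurable_integrand hg _).lintegral_prod_right'
  rw [lintegral_const_mul' _ _ ENNReal.ofReal_ne_top,
    lintegral_finsetSum _ fun k _ => (hmk k).const_mul _]
  refine ENNReal.mul_lt_top ENNReal.ofReal_lt_top (ENNReal.sum_lt_top.2 fun k _ => ?_)
  rw [lintegral_const_mul' _ _ (hC k)]
  refine ENNReal.mul_lt_top (hC k).lt_top ((setLIntegral_le_lintegral _ _).trans_lt ?_)
  rw [lintegral_lintegral_swap (measurable_integrand hg _).aemeasurable]
  calc _ = ∫⁻ _t in Set.Ioc (0 : ℝ) 1, ∫⁻ y, g y := by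
        refine setLIntegral_congr_fun measurableSet_Ioc fun t ht => ?_
        exact (hσ k).lintegral_lintegral ht.1 hg.aemeasurable
    _ < ⊤ := by simpa using hgf.lt_top

/-- Poincaré's inequality for the symmetric gradient in variable Lebesgue spaces, qualitatively. -/
theorem HasZeroSymGrad.memVarLebesgue {Ω : Set (Vec d)} (hΩ : MeasurableSet Ω)
    (hΩb : Bornology.IsBounded Ω) {p : Vec d → ℝ} (hlog : LogHolderOn Ω p)
    (hp : IsBddExponent Ω p) {u : Vec d → Vec d} {G : Vec d → Tensor d}
    (h : HasZeroSymGrad Ω u G) (hG : MemVarLebesgue Ω p G) : MemVarLebesgue Ω p u := by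
  obtain ⟨b, hb⟩ := hp.bdd
  obtain ⟨R, hR⟩ := hΩb.subset_closedBall 0
  have hΩf : volume Ω ≠ ⊤ := hΩb.measure_lt_top.ne
  set N : ℝ := max 1 (4 * R + 3)
  have hN1 : 1 ≤ N := le_max_left _ _
  have hN : 0 < N := by linarith
  have hNR : 4 * R + 2 < N := by
    have : 4 * R + 3 ≤ N := le_max_right _ _
    linarith
  obtain ⟨-, iG, -⟩ := (hasZeroSymGrad_iff hΩ).1 h
  have hfm : AEMeasurable (fun y => ‖Ω.indicator G y‖ₑ) volume := iG.1.enorm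
  set f := hfm.mk
  have hf : Measurable f := hfm.measurable_mk
  have hff : (fun y => ‖Ω.indicator G y‖ₑ) =ᵐ[volume] f := hfm.ae_eq_mk
  have hpoi := h.ae_enorm_le_conePotential (hN := hN) hΩ hN1 hR hNR hf hff
  have hgm : AEMeasurable (Ω.indicator fun y => f y ^ p y + 1) volume :=
    (aemeasurable_indicator_iff hΩ).2 ((hf.aemeasurable.pow hp.aemeasurable).add_const 1)
  have hff' : ∀ᵐ y ∂(volume.restrict Ω), f y = ‖G y‖ₑ := by
    rw [ae_restrict_iff' hΩ]
    filter_upwards [hff] with y hy hyΩ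
    rw [← hy, Set.indicator_of_mem hyΩ]
  have hlt : ∫⁻ x in Ω, conePotential d N hN f x ^ p x < ⊤ := by
    refine setLIntegral_conePotential_rpow_lt_top (g := hgm.mk) hΩ hlog hp hf
      hgm.measurable_mk ?_ ?_ ?_
    · filter_upwards [hgm.ae_eq_mk] with y hy hyΩ
      rw [← hy, Set.indicator_of_mem hyΩ]
    · filter_upwards [hff] with y hy hyΩ
      rw [← hy, Set.indicator_of_notMem hyΩ, enorm_zero]
    · rw [← lintegral_congr_ae hgm.ae_eq_mk, lintegral_indicator hΩ,
        lintegral_add_right _ measurable_const]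
      refine ENNReal.add_ne_top.2 ⟨?_, by simpa using hΩf⟩
      have e : ∫⁻ y in Ω, f y ^ p y = modular Ω p G := by
        rw [modular_eq_lintegral hp.one_le]
        refine lintegral_congr_ae ?_
        filter_upwards [hff'] with y hy
        rw [hy]
      rw [e]
      exact hG.2.ne
  refine ⟨h.1.1, ?_⟩
  rw [modular_eq_lintegral hp.one_le]
  set c : ℝ := 2 * (d * d * (2 * N) ^ 2)
  calc ∫⁻ x in Ω, ‖u x‖ₑ ^ p x
      ≤ ∫⁻ x in Ω, ENNReal.ofReal (max 1 c ^ b) * conePotential d N hN f x ^ p x := by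
        refine lintegral_mono_ae ?_
        filter_upwards [hp.one_le, hb, (ae_restrict_iff' hΩ).2 hpoi] with x h1 h2 h3
        calc ‖u x‖ₑ ^ p x ≤ (ENNReal.ofReal (max 1 c) * conePotential d N hN f x) ^ p x := by
              refine ENNReal.rpow_le_rpow (h3.trans ?_) (by linarith)
              gcongr
              exact le_max_right _ _
          _ = ENNReal.ofReal (max 1 c) ^ p x * conePotential d N hN f x ^ p x :=
              ENNReal.mul_rpow_of_nonneg _ _ (by linarith)
          _ ≤ _ := by
              gcongr
              rw [← ENNReal.ofReal_rpow_of_pos (by positivity)]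
              exact ENNReal.rpow_le_rpow_of_exponent_le
                (ENNReal.one_le_ofReal.2 (le_max_left _ _)) h2
    _ < ⊤ := by
        rw [lintegral_const_mul' _ _ ENNReal.ofReal_ne_top]
        exact ENNReal.mul_lt_top ENNReal.ofReal_lt_top hlt

end Poincare


open scoped Manifold

/-! ### From vanishing traces to approximation by C_c^∞ fields. -/

section SmoothApproximation

variable {d : ℕ} {Ω : Set (Vec d)} {q p r s : Vec d → ℝ} {u v : Vec d → Vec d}
  {G H : Vec d → Tensor d}

lemma MemVarLebesgue.of_norm_le {X F F' : Type*} [MeasureSpace X] [NormedAddCommGroup F]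
    [NormedSpace ℝ F] [NormedAddCommGroup F'] {M : Set X} {p : X → ℝ} (hp : IsBddExponent M p)
    {u : X → F} {w : X → F'} (hu : MemVarLebesgue M p u)
    (hw : AEStronglyMeasurable w (volume.restrict M)) {C : ℝ}
    (h : ∀ᵐ z ∂(volume.restrict M), ‖w z‖ ≤ C * ‖u z‖) : MemVarLebesgue M p w := by
  refine ⟨hw, lt_of_le_of_lt ?_ (hu.const_smul hp C).2⟩
  refine lintegral_mono_ae ?_
  filter_upwards [h, hp.one_le] with z h1 h2
  refine ENNReal.ofReal_le_ofReal (Real.rpow_le_rpow (norm_nonneg _) (h1.trans ?_) (by linarith))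
  rw [Pi.smul_apply, norm_smul]
  gcongr
  exact le_abs_self C

/-- `(u, G)` is the limit of a sequence `(φ n, D φ n)` with `φ n ∈ C_c^∞(Ω)` in the sense of
modulars. -/
def HasSmoothApprox (Ω : Set (Vec d)) (q p : Vec d → ℝ) (u : Vec d → Vec d)
    (G : Vec d → Tensor d) : Prop :=
  ∃ φ : ℕ → Vec d → Vec d, (∀ n, ContDiff ℝ (⊤ : ℕ∞) (φ n) ∧ HasCompactSupport (φ n) ∧
    tsupport (φ n) ⊆ Ω) ∧ Tendsto (fun n => modular Ω q (u - φ n)) atTop (𝓝 0) ∧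
      Tendsto (fun n => modular Ω p (G - symGrad (φ n))) atTop (𝓝 0)

lemma symGrad_add {φ ψ : Vec d → Vec d} (hφ : ContDiff ℝ (⊤ : ℕ∞) φ)
    (hψ : ContDiff ℝ (⊤ : ℕ∞) ψ) : symGrad (φ + ψ) = symGrad φ + symGrad ψ := by
  ext x k
  have : fderiv ℝ (φ + ψ) x = fderiv ℝ φ x + fderiv ℝ ψ x :=
    fderiv_add (hφ.differentiable (by simp) x) (hψ.differentiable (by simp) x)
  simp only [symGrad, this, Pi.add_apply, add_apply, PiLp.add_apply]
  ring

lemma symGrad_const_smul {φ : Vec d → Vec d} (hφ : ContDiff ℝ (⊤ : ℕ∞) φ) (c : ℝ) :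
    symGrad (c • φ) = c • symGrad φ := by
  ext x k
  have : fderiv ℝ (c • φ) x = c • fderiv ℝ φ x :=
    fderiv_const_smul (hφ.differentiable (by simp) x) c
  simp only [symGrad, this, Pi.smul_apply, smul_apply, PiLp.smul_apply,
    smul_eq_mul]
  ring

lemma aestronglyMeasurable_symGrad {φ : Vec d → Vec d} {μ : Measure (Vec d)}
    (hφ : ContDiff ℝ (⊤ : ℕ∞) φ) : AEStronglyMeasurable (symGrad φ) μ :=
  (continuous_symGrad hφ).aestronglyMeasurable

lemma tendsto_modular_add {X F ι : Type*} [MeasureSpace X] [NormedAddCommGroup F]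
    [NormedSpace ℝ F] {M : Set X} {p : X → ℝ} (hp : IsBddExponent M p) {l : Filter ι}
    {f g : ι → X → F} (hf : ∀ i, AEStronglyMeasurable (f i) (volume.restrict M))
    (h1 : Tendsto (fun i => modular M p (f i)) l (𝓝 0))
    (h2 : Tendsto (fun i => modular M p (g i)) l (𝓝 0)) :
    Tendsto (fun i => modular M p (f i + g i)) l (𝓝 0) := by
  obtain ⟨b, hb⟩ := hp.bdd
  have h3 := ENNReal.Tendsto.const_mul (h1.add h2) (Or.inr (ENNReal.ofReal_ne_top (r := 2 ^ b)))
  rw [add_zero, mul_zero] at h3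
  exact tendsto_of_tendsto_of_tendsto_of_le_of_le tendsto_const_nhds h3 (fun _ => zero_le)
    fun i => modular_add_le hp hb (hf i)

lemma tendsto_modular_const_smul {X F ι : Type*} [MeasureSpace X] [NormedAddCommGroup F]
    [NormedSpace ℝ F] {M : Set X} {p : X → ℝ} (hp : IsBddExponent M p) {l : Filter ι}
    {f : ι → X → F} (h1 : Tendsto (fun i => modular M p (f i)) l (𝓝 0)) (c : ℝ) :
    Tendsto (fun i => modular M p (c • f i)) l (𝓝 0) := by
  obtain ⟨b, hb⟩ := hp.bdd
  have h3 := ENNReal.Tendsto.const_mul h1 (Or.inr (ENNReal.ofReal_ne_top (r := max 1 |c| ^ b)))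
  rw [mul_zero] at h3
  exact tendsto_of_tendsto_of_tendsto_of_le_of_le tendsto_const_nhds h3 (fun _ => zero_le)
    fun i => modular_smul_le hp.one_le hb c (f i)

lemma HasSmoothApprox.add (hq : IsBddExponent Ω q) (hp : IsBddExponent Ω p)
    (hum : AEStronglyMeasurable u (volume.restrict Ω))
    (hGm : AEStronglyMeasurable G (volume.restrict Ω))
    (hu : HasSmoothApprox Ω q p u G) (hv : HasSmoothApprox Ω q p v H) :
    HasSmoothApprox Ω q p (u + v) (G + H) := by
  obtain ⟨φ, hφ, h1, h2⟩ := hu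
  obtain ⟨ψ, hψ, h3, h4⟩ := hv
  refine ⟨fun n => φ n + ψ n, fun n => ⟨(hφ n).1.add (hψ n).1, (hφ n).2.1.add (hψ n).2.1,
    (tsupport_add _ _).trans (Set.union_subset (hφ n).2.2 (hψ n).2.2)⟩, ?_, ?_⟩
  · have := tendsto_modular_add hq
      (fun n => hum.sub (hφ n).1.continuous.aestronglyMeasurable) h1 h3
    refine this.congr fun n => ?_
    rw [add_sub_add_comm]
  · have := tendsto_modular_add hp
      (fun n => hGm.sub (aestronglyMeasurable_symGrad (hφ n).1)) h2 h4
    refine this.congr fun n => ?_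
    rw [symGrad_add (hφ n).1 (hψ n).1, add_sub_add_comm]

lemma HasSmoothApprox.const_smul (hq : IsBddExponent Ω q) (hp : IsBddExponent Ω p)
    (hu : HasSmoothApprox Ω q p u G) (c : ℝ) :
    HasSmoothApprox Ω q p (c • u) (c • G) := by
  obtain ⟨φ, hφ, h1, h2⟩ := hu
  refine ⟨fun n => c • φ n, fun n => ⟨(hφ n).1.const_smul c, (hφ n).2.1.smul_left,
    (tsupport_smul_subset_right (fun _ => c) (φ n)).trans (hφ n).2.2⟩, ?_, ?_⟩
  · refine (tendsto_modular_const_smul hq h1 c).congr fun n => ?_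
    rw [smul_sub]
  · refine (tendsto_modular_const_smul hp h2 c).congr fun n => ?_
    rw [symGrad_const_smul (hφ n).1, smul_sub]

lemma modular_zero {X F : Type*} [MeasureSpace X] [NormedAddCommGroup F] [NormedSpace ℝ F]
    {M : Set X} {p : X → ℝ} (hp : ∀ᵐ x ∂(volume.restrict M), 1 ≤ p x) :
    modular M p (0 : X → F) = 0 := by
  rw [modular]
  refine (lintegral_congr_ae ?_).trans lintegral_zero
  filter_upwards [hp] with x hx
  rw [Pi.zero_apply, norm_zero, Real.zero_rpow (by linarith), ENNReal.ofReal_zero]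

lemma symGrad_zero : symGrad (0 : Vec d → Vec d) = 0 := by
  ext x k
  simp [symGrad]

lemma hasSmoothApprox_zero (hq : IsBddExponent Ω q) (hp : IsBddExponent Ω p) :
    HasSmoothApprox Ω q p (0 : Vec d → Vec d) 0 := by
  refine ⟨fun _ => 0, fun _ => ⟨contDiff_const, HasCompactSupport.zero, by simp [tsupport]⟩, ?_, ?_⟩
  · simp only [sub_zero, modular_zero hq.one_le]
    exact tendsto_const_nhds
  · change Tendsto (fun _ => modular Ω p (0 - symGrad 0)) _ _
    simp only [symGrad_zero, sub_zero, modular_zero hp.one_le]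
    exact tendsto_const_nhds

lemma HasSmoothApprox.congr (hu : HasSmoothApprox Ω q p u G) (huv : u =ᵐ[volume.restrict Ω] v)
    (hGH : G =ᵐ[volume.restrict Ω] H) : HasSmoothApprox Ω q p v H := by
  obtain ⟨φ, hφ, h1, h2⟩ := hu
  refine ⟨φ, hφ, h1.congr fun n => modular_congr ?_, h2.congr fun n => modular_congr ?_⟩
  · filter_upwards [huv] with x hx
    simp [hx]
  · filter_upwards [hGH] with x hx
    simp [hx]

lemma HasSmoothApprox.mono_exponent (hΩ : volume Ω ≠ ⊤) (hq : IsBddExponent Ω q)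
    (hp : IsBddExponent Ω p) (hr : ∀ᵐ x ∂(volume.restrict Ω), 1 ≤ r x)
    (hs : ∀ᵐ x ∂(volume.restrict Ω), 1 ≤ s x) (hrq : ∀ᵐ x ∂(volume.restrict Ω), r x ≤ q x)
    (hsp : ∀ᵐ x ∂(volume.restrict Ω), s x ≤ p x) (hu : HasSmoothApprox Ω q p u G) :
    HasSmoothApprox Ω r s u G := by
  obtain ⟨φ, hφ, h1, h2⟩ := hu
  exact ⟨φ, hφ, tendsto_modular_of_exponent_le hΩ hq hr hrq h1,
    tendsto_modular_of_exponent_le hΩ hp hs hsp h2⟩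

/-- On a set of finite measure both exponents may be lowered to 1, and vanishing traces survive L^1
limits. -/
lemma HasSmoothApprox.hasZeroSymGrad (hΩ : volume Ω ≠ ⊤) (hq : IsBddExponent Ω q)
    (hp : IsBddExponent Ω p) (hu : MemVarLebesgue Ω q u) (hG : MemVarLebesgue Ω p G)
    (h : HasSmoothApprox Ω q p u G) : HasZeroSymGrad Ω u G := by
  obtain ⟨φ, hφ, h1, h2⟩ := h.mono_exponent (r := 1) (s := 1) hΩ hq hp (by simp) (by simp)
    hq.one_le hp.one_le
  simp only [modular_one] at h1 h2
  refine HasZeroSymGrad.of_tendsto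
    (fun n => hasZeroSymGrad_of_contDiff (hφ n).1 (hφ n).2.1 (hφ n).2.2)
    (hu.integrableOn hΩ hq) (hG.integrableOn hΩ hp) (h1.congr fun n => ?_) (h2.congr fun n => ?_)
  · refine lintegral_congr fun x => ?_
    rw [Pi.sub_apply, enorm_sub_rev]
  · refine lintegral_congr fun x => ?_
    rw [Pi.sub_apply, enorm_sub_rev]

lemma HasSmoothApprox.memSymSobolevZero (hΩo : IsOpen Ω) (hΩ : volume Ω ≠ ⊤)
    (hq : IsBddExponent Ω q) (hp : IsBddExponent Ω p) (hu : MemVarLebesgue Ω q u)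
    (hG : MemVarLebesgue Ω p G) (h : HasSmoothApprox Ω q p u G) :
    MemSymSobolevZero Ω q p u := by
  have hw := (h.hasZeroSymGrad hΩ hq hp hu hG).hasWeakSymGrad
  refine ⟨⟨hu, G, hw, hG⟩, ?_⟩
  obtain ⟨φ, hφ, h1, h2⟩ := h
  intro ε hε
  have t1 := (tendsto_luxNorm_of_tendsto_modular hq h1).add
    (tendsto_luxNorm_of_tendsto_modular hp h2)
  rw [add_zero] at t1
  obtain ⟨n, hn⟩ := (t1.eventually (gt_mem_nhds hε)).exists
  refine ⟨φ n, (hφ n).1, (hφ n).2.1, (hφ n).2.2, ?_⟩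
  rw [symSobolevNorm_eq hΩo (hw.sub
    (hasZeroSymGrad_of_contDiff (hφ n).1 (hφ n).2.1 (hφ n).2.2).hasWeakSymGrad)]
  exact hn

lemma MemSymSobolevZero.exists_hasSmoothApprox (hΩo : IsOpen Ω) (hΩ : volume Ω ≠ ⊤)
    (hq : IsBddExponent Ω q) (hp : IsBddExponent Ω p) (hu : MemSymSobolevZero Ω q p u) :
    ∃ G, MemVarLebesgue Ω q u ∧ MemVarLebesgue Ω p G ∧ HasSmoothApprox Ω q p u G := by
  obtain ⟨⟨huq, G, hw, hG⟩, happ⟩ := hu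
  refine ⟨G, huq, hG, ?_⟩
  choose φ hφ hφc hφΩ hφn using fun n : ℕ => happ (1 / ((n : ℝ) + 1)) (by positivity)
  have ht : Tendsto (fun n : ℕ => ENNReal.ofReal (1 / ((n : ℝ) + 1))) atTop (𝓝 0) := by
    have := ENNReal.tendsto_ofReal (tendsto_one_div_add_atTop_nhds_zero_nat (𝕜 := ℝ))
    simpa using this
  have hle1 : ∀ n : ℕ, 1 / ((n : ℝ) + 1) ≤ 1 := fun n => by
    rw [div_le_one (by positivity)]
    have : (0 : ℝ) ≤ n := by positivity
    linarith
  have key : ∀ n, luxNorm Ω q (u - φ n) < 1 / ((n : ℝ) + 1) ∧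
      luxNorm Ω p (G - symGrad (φ n)) < 1 / ((n : ℝ) + 1) := by
    intro n
    have h1 := hφn n
    rw [symSobolevNorm_eq hΩo (hw.sub
      (hasZeroSymGrad_of_contDiff (hφ n) (hφc n) (hφΩ n)).hasWeakSymGrad)] at h1
    have h2 := luxNorm_nonneg Ω q (u - φ n)
    have h3 := luxNorm_nonneg Ω p (G - symGrad (φ n))
    constructor <;> linarith
  refine ⟨φ, fun n => ⟨hφ n, hφc n, hφΩ n⟩, ?_, ?_⟩
  · refine tendsto_of_tendsto_of_tendsto_of_le_of_le tendsto_const_nhds ht (fun _ => zero_le)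
      fun n => ?_
    obtain ⟨C, hC⟩ := (hφ n).continuous.bounded_above_of_compact_support (hφc n)
    exact modular_le_of_luxNorm_lt hq (huq.sub hq (memVarLebesgue_of_bound hΩ hq
      (hφ n).continuous.aestronglyMeasurable (ae_of_all _ hC))) (hle1 n) (key n).1
  · refine tendsto_of_tendsto_of_tendsto_of_le_of_le tendsto_const_nhds ht (fun _ => zero_le)
      fun n => ?_
    have hsc : HasCompactSupport (symGrad (φ n)) :=
      HasCompactSupport.intro (hφc n) fun x hx => symGrad_eq_zero_of_notMem_tsupport hx
    obtain ⟨C, hC⟩ := (continuous_symGrad (hφ n)).bounded_above_of_compact_support hsc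
    exact modular_le_of_luxNorm_lt hp (hG.sub hp (memVarLebesgue_of_bound hΩ hp
      (aestronglyMeasurable_symGrad (hφ n)) (ae_of_all _ hC))) (hle1 n) (key n).2

/-- Approximation by shifting inwards and mollifying, for fields whose support can be shifted
into `Ω`. -/
lemma hasSmoothApprox_of_shift (hΩo : IsOpen Ω) (hΩ : volume Ω ≠ ⊤)
    (hq : IsBddExponent Ω q) (hp : IsBddExponent Ω p) (hql : LogHolderOn Ω q)
    (hpl : LogHolderOn Ω p) (hu : MemVarLebesgue Ω q u) (hG : MemVarLebesgue Ω p G)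
    (h : HasZeroSymGrad Ω u G) {K : Set (Vec d)} (hK : IsCompact K)
    (huK : ∀ x ∈ Ω, x ∉ K → u x = 0) {ν : Vec d} {c η : ℝ} (hc : 0 < c) (hη : 0 < η)
    (hshift : ∀ t, 0 < t → t < η → ∀ y ∈ K, ∀ a ∈ Metric.closedBall ν c, y - t • a ∈ Ω) :
    HasSmoothApprox Ω q p u G := by
  have hΩm := hΩo.measurableSet
  obtain ⟨iu, iG, -⟩ := (hasZeroSymGrad_iff hΩm).1 h
  -- Centre ν and outer radius c make the mollified support consist of points y - t a with a in the
  -- closed ball of `hshift`; those points lie in Ω.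
  let w : ContDiffBump ν := ⟨c / 2, c, by positivity, by linarith⟩
  have hσ := isAveraging_bumpMeasure w
  set t : ℕ → ℝ := fun n => η / (n + 2)
  have ht0 : ∀ n, 0 < t n := fun n => by positivity
  have htη : ∀ n, t n < η := fun n => by
    simp only [t]
    rw [div_lt_iff₀ (by positivity)]
    have : (0 : ℝ) ≤ n := by positivity
    nlinarith
  have ht : Tendsto t atTop (𝓝[>] 0) := by
    refine tendsto_nhdsWithin_iff.2 ⟨?_, Eventually.of_forall ht0⟩
    exact tendsto_const_nhds.div_atTop
      (tendsto_atTop_add_const_right _ _ tendsto_natCast_atTop_atTop)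
  have hsupp : tsupport (Ω.indicator u) ⊆ K := by
    refine closure_minimal (fun x hx => ?_) hK.isClosed
    by_contra hxK
    by_cases hxΩ : x ∈ Ω
    · exact hx (by rw [Set.indicator_of_mem hxΩ, huK x hxΩ hxK])
    · exact hx (Set.indicator_of_notMem hxΩ u)
  have hcs : HasCompactSupport (Ω.indicator u) := hK.of_isClosed_subset (isClosed_tsupport _) hsupp
  have hrest : ∀ {F : Type} [NormedAddCommGroup F] (f : Vec d → F),
      f =ᵐ[volume.restrict Ω] Ω.indicator f := fun f => by
    filter_upwards [ae_restrict_mem hΩm] with x hx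
    rw [Set.indicator_of_mem hx]
  refine ⟨fun n x => ∫ a, Ω.indicator u (x + t n • a) ∂(bumpMeasure w), fun n =>
    ⟨contDiff_integral_bumpMeasure w (ht0 n) iu, hasCompactSupport_integral_bumpMeasure w _ hcs,
      (tsupport_integral_bumpMeasure_subset w _ hcs).trans ?_⟩, ?_, ?_⟩
  · rintro _ ⟨⟨y, a⟩, ⟨hy, ha⟩, rfl⟩
    exact hshift (t n) (ht0 n) (htη n) y (hsupp hy) a ha
  · have := (hσ.tendsto_modular hΩm hΩ hql hq (hu.congr (hrest u))
      (fun y hy => Set.indicator_of_notMem hy u)).comp ht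
    refine this.congr fun n => ?_
    refine lintegral_congr_ae ?_
    filter_upwards [ae_restrict_mem hΩm] with x hx
    rw [Pi.sub_apply, norm_sub_rev, Set.indicator_of_mem hx]
  · have := (hσ.tendsto_modular hΩm hΩ hpl hp (hG.congr (hrest G))
      (fun y hy => Set.indicator_of_notMem hy G)).comp ht
    refine this.congr fun n => ?_
    refine lintegral_congr_ae ?_
    filter_upwards [ae_restrict_mem hΩm] with x hx
    rw [Pi.sub_apply, norm_sub_rev, symGrad_integral_bumpMeasure w (ht0 n) hΩm h,
      Set.indicator_of_mem hx]

/-- Near every point of its closure, a set with Lipschitz boundary can be shifted inwards. -/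
lemma HasLipschitzBoundary.exists_shift (hΩo : IsOpen Ω) (hL : HasLipschitzBoundary Ω)
    {x : Vec d} (hx : x ∈ closure Ω) : ∃ ρ > 0, ∃ (ν : Vec d) (c η : ℝ), 0 < c ∧ 0 < η ∧
      ∀ t, 0 < t → t < η → ∀ y ∈ closure Ω ∩ Metric.closedBall x ρ,
        ∀ a ∈ Metric.closedBall ν c, y - t • a ∈ Ω := by
  by_cases hxΩ : x ∈ Ω
  · obtain ⟨ρ, hρ, hball⟩ := Metric.isOpen_iff.1 hΩo x hxΩ
    refine ⟨ρ / 2, by positivity, 0, 1, ρ / 2, one_pos, by positivity, ?_⟩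
    rintro t ht0 ht y ⟨-, hy⟩ a ha
    refine hball ?_
    rw [mem_closedBall_iff_norm] at hy ha
    rw [sub_zero] at ha
    rw [mem_ball_iff_norm]
    have h1 : ‖t • a‖ ≤ t := by
      rw [norm_smul, Real.norm_of_nonneg ht0.le]
      nlinarith
    calc ‖y - t • a - x‖ = ‖(y - x) - t • a‖ := by congr 1; abel
      _ ≤ ‖y - x‖ + ‖t • a‖ := norm_sub_le _ _
      _ < ρ := by linarith
  · have hfr : x ∈ frontier Ω := by
      rw [frontier, hΩo.interior_eq]
      exact ⟨hx, hxΩ⟩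
    obtain ⟨ν, hν, γ, L, hγ, ρ, hρ, hiff⟩ := hL x hfr
    set P : Vec d → Vec d := fun z => z - inner ℝ ν z • ν
    have hPc : Continuous P := by fun_prop
    -- Moving by t ν raises the height by t. A perturbation of size c t costs at most c t in height
    -- and 2 L c t in the value of γ, and (2L + 1) c = 1/2 < 1.
    set c : ℝ := 1 / (4 * L + 2)
    have hL0 : (0 : ℝ) ≤ L := L.2
    have hc0 : 0 < c := by positivity
    have hc : (4 * L + 2) * c = 1 := by simp only [c]; field_simp
    have hc1 : c ≤ 1 / 2 := by nlinarith
    -- The direction is -ν because the shifted point is y - t a. A displacement of length at most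
    -- t(1 + c) < ρ/2 stays inside the chart.
    refine ⟨ρ / 2, by positivity, -ν, c, ρ / 4, hc0, by positivity, ?_⟩
    rintro t ht0 ht y ⟨hy, hyx⟩ a ha
    rw [mem_closedBall_iff_norm] at hyx ha
    rw [sub_neg_eq_add] at ha
    set b := a + ν
    have hab : y - t • a = y + t • ν - t • b := by simp only [b]; module
    have hνb : |inner ℝ ν b| ≤ c := by
      refine (abs_real_inner_le_norm _ _).trans ?_
      rw [hν, one_mul]; exact ha
    have hνν : inner ℝ ν ν = 1 := by rw [real_inner_self_eq_norm_sq, hν]; norm_num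
    -- Points of the closure satisfy the epigraph inequality only weakly; the shift makes it strict.
    have hle : γ (P y) ≤ inner ℝ ν y := by
      have hcl : IsClosed {z : Vec d | γ (P z) ≤ inner ℝ ν z} :=
        isClosed_le (hγ.continuous.comp hPc) (by fun_prop)
      have hsub : Metric.ball x ρ ∩ Ω ⊆ {z : Vec d | γ (P z) ≤ inner ℝ ν z} :=
        fun z hz => ((hiff z hz.1).1 hz.2).le
      have hyb : y ∈ Metric.ball x ρ := by
        rw [mem_ball_iff_norm]; linarith
      exact closure_minimal hsub hcl (Metric.isOpen_ball.inter_closure ⟨hyb, hy⟩)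
    have hmem : y - t • a ∈ Metric.ball x ρ := by
      rw [mem_ball_iff_norm, hab]
      calc ‖y + t • ν - t • b - x‖ = ‖(y - x) + (t • ν - t • b)‖ := by congr 1; abel
        _ ≤ ‖y - x‖ + (‖t • ν‖ + ‖t • b‖) :=
            (norm_add_le _ _).trans (by gcongr; exact norm_sub_le _ _)
        _ < ρ := by
            rw [norm_smul, norm_smul, Real.norm_of_nonneg ht0.le, hν]
            nlinarith
    rw [hiff _ hmem]
    have hin : inner ℝ ν (y - t • a) = inner ℝ ν y + t - t * inner ℝ ν b := by
      rw [hab, inner_sub_right, inner_add_right, real_inner_smul_right, real_inner_smul_right, hνν]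
      ring
    have hP : ‖P (y - t • a) - P y‖ ≤ t * (2 * c) := by
      have e1 : P (y - t • a) - P y = -(t • (b - inner ℝ ν b • ν)) := by
        simp only [P, hin]
        rw [hab]
        module
      rw [e1, norm_neg, norm_smul, Real.norm_of_nonneg ht0.le]
      gcongr
      calc ‖b - inner ℝ ν b • ν‖ ≤ ‖b‖ + ‖inner ℝ ν b • ν‖ := norm_sub_le _ _
        _ ≤ c + c := by
            rw [norm_smul, hν, mul_one]
            exact add_le_add ha hνb
        _ = 2 * c := by ring
    have hγle : γ (P (y - t • a)) ≤ γ (P y) + L * (t * (2 * c)) := by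
      have h1 := hγ.dist_le_mul (P (y - t • a)) (P y)
      rw [Real.dist_eq, dist_eq_norm] at h1
      have h2 := le_abs_self (γ (P (y - t • a)) - γ (P y))
      have h3 : (L : ℝ) * ‖P (y - t • a) - P y‖ ≤ L * (t * (2 * c)) := by gcongr
      linarith
    change γ (P (y - t • a)) < inner ℝ ν (y - t • a)
    rw [hin]
    have h4 := (abs_le.1 hνb).2
    nlinarith [mul_pos ht0 hc0, mul_le_mul_of_nonneg_left h4 ht0.le]

/-- In a bounded open set with Lipschitz boundary and for log-Hölder continuous exponents, fields
with zero trace can be approximated by smooth fields with compact support. -/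
theorem HasZeroSymGrad.hasSmoothApprox (hΩo : IsOpen Ω) (hΩb : Bornology.IsBounded Ω)
    (hL : HasLipschitzBoundary Ω) (hq : IsBddExponent Ω q) (hp : IsBddExponent Ω p)
    (hql : LogHolderOn Ω q) (hpl : LogHolderOn Ω p) (hu : MemVarLebesgue Ω q u)
    (hG : MemVarLebesgue Ω p G) (h : HasZeroSymGrad Ω u G) : HasSmoothApprox Ω q p u G := by
  have hΩm := hΩo.measurableSet
  have hΩ : volume Ω ≠ ⊤ := hΩb.measure_lt_top.ne
  -- Needed for the terms ∇f_i ⊗ u of the localized gradients, since the exponents q and p are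
  -- unrelated.
  have hup : MemVarLebesgue Ω p u := h.memVarLebesgue hΩm hΩb hpl hp hG
  have hKc : IsCompact (closure Ω) := hΩb.isCompact_closure
  choose! ρ hρ ν c η hc hη hshift using fun x hx => hL.exists_shift hΩo (x := x) hx
  obtain ⟨T, hT, hcover⟩ := hKc.elim_nhds_subcover (fun x => Metric.ball x (ρ x))
    fun x hx => Metric.ball_mem_nhds x (hρ x hx)
  obtain ⟨f, hf⟩ := SmoothPartitionOfUnity.exists_isSubordinate 𝓘(ℝ, Vec d)
    (isClosed_closure (s := Ω)) (fun i : T => Metric.ball (i : Vec d) (ρ i))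
    (fun i => Metric.isOpen_ball) (fun x hx => by
      obtain ⟨i, hi, hxi⟩ := Set.mem_iUnion₂.1 (hcover hx)
      exact Set.mem_iUnion.2 ⟨⟨i, hi⟩, hxi⟩)
  have hfs : ∀ i, ContDiff ℝ (⊤ : ℕ∞) (f i) := fun i => (f i).contMDiff.contDiff
  have hfc : ∀ i, HasCompactSupport (f i) := fun i =>
    (isCompact_closedBall (i : Vec d) (ρ i)).of_isClosed_subset (isClosed_tsupport _)
      ((hf i).trans Metric.ball_subset_closedBall)
  set ui : T → Vec d → Vec d := fun i x => f i x • u x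
  set Gi : T → Vec d → Tensor d := fun i x => f i x • G x + symOuter (f i) u x
  have hz : ∀ i, HasZeroSymGrad Ω (ui i) (Gi i) := fun i => h.cutoff (hfs i) (hfc i)
  have hle1 : ∀ i x, ‖f i x‖ ≤ 1 := fun i x => by
    rw [Real.norm_of_nonneg (f.nonneg i x)]
    exact f.le_one i x
  have hui : ∀ i, MemVarLebesgue Ω q (ui i) := fun i =>
    hu.of_norm_le hq (hz i).1.1 (C := 1) (ae_of_all _ fun x => by
      simp only [ui]
      rw [norm_smul]
      gcongr
      exact hle1 i x)
  have hGi : ∀ i, MemVarLebesgue Ω p (Gi i) := by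
    intro i
    obtain ⟨B, hB⟩ := exists_bound_fderiv (hfs i) (hfc i)
    refine MemVarLebesgue.add hp (u := fun x => f i x • G x) (v := symOuter (f i) u) ?_ ?_
    · refine hG.of_norm_le hp ((hfs i).continuous.aestronglyMeasurable.smul hG.1) (C := 1)
        (ae_of_all _ fun x => ?_)
      rw [norm_smul]
      gcongr
      exact hle1 i x
    · exact hup.of_norm_le hp (aestronglyMeasurable_symOuter (hfs i) hu.1)
        (ae_of_all _ fun x => norm_symOuter_le hB x)
  have happ : ∀ i, HasSmoothApprox Ω q p (ui i) (Gi i) := by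
    intro i
    have hi := hT i i.2
    refine hasSmoothApprox_of_shift hΩo hΩ hq hp hql hpl (hui i) (hGi i) (hz i)
      (hKc.inter_right (Metric.isClosed_closedBall (x := (i : Vec d)) (ε := ρ i))) ?_
      (hc i hi) (hη i hi) (hshift i hi)
    intro x hx hxK
    have : f i x = 0 := by
      refine image_eq_zero_of_notMem_tsupport fun hmem => hxK ⟨subset_closure hx, ?_⟩
      exact Metric.ball_subset_closedBall (hf i hmem)
    simp only [ui, this, zero_smul]
  -- sum up
  have hsum : ∀ S : Finset T, HasSmoothApprox Ω q p (∑ i ∈ S, ui i) (∑ i ∈ S, Gi i) ∧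
      HasZeroSymGrad Ω (∑ i ∈ S, ui i) (∑ i ∈ S, Gi i) := by
    intro S
    classical
    induction S using Finset.induction_on with
    | empty =>
      refine ⟨hasSmoothApprox_zero hq hp, ?_⟩
      have h0 := hasZeroSymGrad_of_contDiff (Ω := Ω) (φ := (0 : Vec d → Vec d)) contDiff_const
        HasCompactSupport.zero (by simp [tsupport])
      rwa [symGrad_zero] at h0
    | insert i S hi ih =>
      rw [Finset.sum_insert hi, Finset.sum_insert hi]
      exact ⟨(happ i).add hq hp (hui i).1 (hGi i).1 ih.1, (hz i).add hΩm ih.2⟩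
  obtain ⟨h1, h2⟩ := hsum Finset.univ
  have e1 : ∀ᵐ x ∂(volume.restrict Ω), (∑ i, ui i) x = u x := by
    filter_upwards [ae_restrict_mem hΩm] with x hx
    have h3 := f.sum_eq_one (subset_closure hx)
    rw [finsum_eq_sum_of_fintype] at h3
    rw [Finset.sum_apply, ← Finset.sum_smul, h3, one_smul]
  -- The sum of the localized gradients is identified by uniqueness, without computing that the
  -- terms ∇f_i ⊗ u cancel.
  have e2 : ∑ i, Gi i =ᵐ[volume.restrict Ω] G :=
    (h2.congr e1 (ae_eq_refl _)).hasWeakSymGrad.ae_unique hΩo h.hasWeakSymGrad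
  exact h1.congr e1 e2

end SmoothApproximation


/-! ### Convex combinations of tails that converge strongly in L^1. -/

section ForwardConvexCombinations

/-- Weights of convex combinations of terms with index at least `n`. -/
def forwardWeights (n : ℕ) : Set (ℕ →₀ ℝ) :=
  convexHull ℝ ((fun k => Finsupp.single k (1 : ℝ)) '' Set.Ici n)

/-- Keeping the weights apart from the vectors allows one choice of weights to serve a sequence and
all of its truncations at once. -/
lemma linearCombination_image_forwardWeights {V : Type*} [AddCommGroup V] [Module ℝ V]
    (f : ℕ → V) (n : ℕ) :
    Finsupp.linearCombination ℝ f '' forwardWeights n = convexHull ℝ (f '' Set.Ici n) := by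
  rw [forwardWeights, LinearMap.image_convexHull, Set.image_image]
  simp

lemma linearCombination_mem_of_convex {V : Type*} [AddCommGroup V] [Module ℝ V]
    {f : ℕ → V} {n : ℕ} {w : ℕ →₀ ℝ} (hw : w ∈ forwardWeights n) {S : Set V} (hS : Convex ℝ S)
    (hf : ∀ k, n ≤ k → f k ∈ S) : Finsupp.linearCombination ℝ f w ∈ S := by
  have h1 : Finsupp.linearCombination ℝ f w ∈ convexHull ℝ (f '' Set.Ici n) := by
    rw [← linearCombination_image_forwardWeights]
    exact Set.mem_image_of_mem _ hw
  refine convexHull_min ?_ hS h1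
  rintro _ ⟨k, hk, rfl⟩
  exact hf k hk

/-- A bounded sequence in a Hilbert space has strongly convergent forward convex combinations. -/
lemma exists_forwardWeights_tendsto {H : Type*} [NormedAddCommGroup H] [InnerProductSpace ℝ H]
    [CompleteSpace H] {x : ℕ → H} {B : ℝ} (hB : ∀ n, ‖x n‖ ≤ B) :
    ∃ w : ℕ → ℕ →₀ ℝ, (∀ n, w n ∈ forwardWeights n) ∧
      ∃ z, Tendsto (fun n => Finsupp.linearCombination ℝ x (w n)) atTop (𝓝 z) := by
  -- The elements z n of minimal norm in these decreasing closed convex sets have increasing,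
  -- bounded norms, and the parallelogram law makes them a Cauchy sequence. Genuine convex
  -- combinations are then chosen within 1/(n + 1) of z n.
  set K : ℕ → Set H := fun n => closure (convexHull ℝ (x '' Set.Ici n))
  have hKne : ∀ n, (K n).Nonempty := fun n =>
    ⟨x n, subset_closure (subset_convexHull ℝ _ ⟨n, Set.self_mem_Ici, rfl⟩)⟩
  have hKc : ∀ n, Convex ℝ (K n) := fun n => (convex_convexHull ℝ _).closure
  have hKm : ∀ n m, n ≤ m → K m ⊆ K n := fun n m h =>
    closure_mono (convexHull_mono (Set.image_mono (Set.Ici_subset_Ici.2 h)))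
  have hex : ∀ n, ∃ z ∈ K n, ∀ y ∈ K n, ‖z‖ ≤ ‖y‖ := by
    intro n
    obtain ⟨z, hz, hz'⟩ := exists_norm_eq_iInf_of_complete_convex (hKne n)
      isClosed_closure.isComplete (hKc n) 0
    refine ⟨z, hz, fun y hy => ?_⟩
    rw [zero_sub, norm_neg] at hz'
    rw [hz']
    have hbd : BddBelow (Set.range fun w : K n => ‖(0 : H) - w‖) :=
      ⟨0, by rintro _ ⟨w, rfl⟩; exact norm_nonneg _⟩
    have := ciInf_le hbd ⟨y, hy⟩
    simpa using this
  choose z hzK hzmin using hex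
  have hmono : Monotone fun n => ‖z n‖ ^ 2 := fun n m h =>
    pow_le_pow_left₀ (norm_nonneg _) (hzmin n _ (hKm n m h (hzK m))) 2
  have hzB : ∀ n, ‖z n‖ ≤ B := fun n =>
    (hzmin n _ (subset_closure (subset_convexHull ℝ _ ⟨n, Set.self_mem_Ici, rfl⟩))).trans (hB n)
  have hbdd : BddAbove (Set.range fun n => ‖z n‖ ^ 2) := by
    refine ⟨B ^ 2, ?_⟩
    rintro _ ⟨n, rfl⟩
    exact pow_le_pow_left₀ (norm_nonneg _) (hzB n) 2
  have hlim := (tendsto_atTop_ciSup hmono hbdd).cauchySeq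
  have hpar : ∀ n m, n ≤ m → ‖z n - z m‖ ^ 2 ≤ 2 * (‖z m‖ ^ 2 - ‖z n‖ ^ 2) := by
    intro n m h
    have h1 := parallelogram_law_with_norm ℝ (z n) (z m)
    have h2 : ‖z n‖ ≤ ‖(1 / 2 : ℝ) • (z n + z m)‖ := by
      refine hzmin n _ ?_
      rw [smul_add]
      exact hKc n (hzK n) (hKm n m h (hzK m)) (by norm_num) (by norm_num) (by norm_num)
    rw [norm_smul, Real.norm_of_nonneg (by norm_num)] at h2
    have h3 : 4 * ‖z n‖ ^ 2 ≤ ‖z n + z m‖ ^ 2 := by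
      have := pow_le_pow_left₀ (norm_nonneg _) h2 2
      nlinarith
    linarith
  have hcauchy : CauchySeq z := by
    rw [Metric.cauchySeq_iff'] at hlim ⊢
    intro ε hε
    obtain ⟨N, hN⟩ := hlim (ε ^ 2 / 2) (by positivity)
    refine ⟨N, fun n hn => ?_⟩
    have h1 := hN n hn
    rw [Real.dist_eq, abs_of_nonneg (sub_nonneg.2 (hmono hn))] at h1
    have h2 := hpar N n hn
    rw [dist_eq_norm, norm_sub_rev]
    exact lt_of_pow_lt_pow_left₀ 2 hε.le (by linarith)
  obtain ⟨z', hz'⟩ := cauchySeq_tendsto_of_complete hcauchy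
  have hw : ∀ n : ℕ, ∃ w ∈ forwardWeights n,
      ‖Finsupp.linearCombination ℝ x w - z n‖ < 1 / ((n : ℝ) + 1) := by
    intro n
    obtain ⟨y, hy, hyz⟩ := Metric.mem_closure_iff.1 (hzK n) (1 / ((n : ℝ) + 1)) (by positivity)
    rw [← linearCombination_image_forwardWeights] at hy
    obtain ⟨w, hw, rfl⟩ := hy
    exact ⟨w, hw, by rwa [← dist_eq_norm, dist_comm]⟩
  choose w hw1 hw2 using hw
  refine ⟨w, hw1, z', ?_⟩
  have h3 : Tendsto (fun n => Finsupp.linearCombination ℝ x (w n) - z n) atTop (𝓝 0) :=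
    squeeze_zero_norm (fun n => (hw2 n).le) tendsto_one_div_add_atTop_nhds_zero_nat
  simpa using h3.add hz'

variable {α F : Type*} [MeasurableSpace α] {μ : Measure α} [NormedAddCommGroup F]

lemma coeFn_linearCombination_toLp [NormedSpace ℝ F] {p : ℝ≥0∞} [Fact (1 ≤ p)] {f : ℕ → α → F}
    (hf : ∀ k, MemLp (f k) p μ) (w : ℕ →₀ ℝ) :
    ⇑(Finsupp.linearCombination ℝ (fun k => (hf k).toLp (f k)) w)
      =ᵐ[μ] Finsupp.linearCombination ℝ f w := by
  induction w using Finsupp.induction_linear with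
  | zero => simpa using Lp.coeFn_zero F p μ
  | add v w hv hw =>
    rw [map_add, map_add]
    exact (Lp.coeFn_add _ _).trans (hv.add hw)
  | single k c =>
    rw [Finsupp.linearCombination_single, Finsupp.linearCombination_single]
    filter_upwards [Lp.coeFn_smul c ((hf k).toLp (f k)), (hf k).coeFn_toLp] with x h1 h2
    rw [h1, Pi.smul_apply, h2, Pi.smul_apply]

/-- Truncation of `f` at height `M`. -/
noncomputable def truncation (M : ℕ) (f : α → F) : α → F := {z | ‖f z‖ ≤ M}.indicator f

lemma norm_truncation_le (M : ℕ) (f : α → F) (z : α) : ‖truncation M f z‖ ≤ M := by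
  by_cases hz : ‖f z‖ ≤ M
  · rw [truncation, Set.indicator_of_mem (by exact hz)]
    exact hz
  · rw [truncation, Set.indicator_of_notMem (by exact hz), norm_zero]
    positivity

lemma aestronglyMeasurable_truncation {f : α → F} (hf : AEStronglyMeasurable f μ) (M : ℕ) :
    AEStronglyMeasurable (truncation M f) μ := by
  have : NullMeasurableSet {z | ‖f z‖ ≤ M} μ :=
    nullMeasurableSet_le hf.norm.aemeasurable aemeasurable_const
  exact hf.indicator₀ this

/-- The difference lives where ‖f‖ > M, and there ‖f‖ ≤ M^{1-a} ‖f‖^a. -/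
lemma lintegral_enorm_sub_truncation_le (f : α → F) {a : ℝ} (ha : 1 < a) {M : ℕ} (hM : 0 < M) :
    ∫⁻ z, ‖f z - truncation M f z‖ₑ ∂μ ≤
      ENNReal.ofReal ((M : ℝ) ^ (1 - a)) * ∫⁻ z, ‖f z‖ₑ ^ a ∂μ := by
  rw [← lintegral_const_mul' _ _ ENNReal.ofReal_ne_top]
  refine lintegral_mono fun z => ?_
  dsimp only
  by_cases hz : ‖f z‖ ≤ M
  · rw [truncation, Set.indicator_of_mem (by exact hz), sub_self, enorm_zero]
    exact zero_le
  · rw [truncation, Set.indicator_of_notMem (by exact hz), sub_zero, ← ofReal_norm,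
      ENNReal.ofReal_rpow_of_nonneg (norm_nonneg _) (by linarith),
      ← ENNReal.ofReal_mul (by positivity)]
    refine ENNReal.ofReal_le_ofReal ?_
    have hM' : (0 : ℝ) < M := by exact_mod_cast hM
    have hz' : (M : ℝ) < ‖f z‖ := not_le.1 hz
    have h0 : 0 < ‖f z‖ := hM'.trans hz'
    calc ‖f z‖ = (M : ℝ) ^ (1 - a) * (M : ℝ) ^ (a - 1) * ‖f z‖ := by
          rw [← Real.rpow_add hM']; simp
      _ ≤ (M : ℝ) ^ (1 - a) * ‖f z‖ ^ (a - 1) * ‖f z‖ := by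
          have : (M : ℝ) ^ (a - 1) ≤ ‖f z‖ ^ (a - 1) :=
            Real.rpow_le_rpow hM'.le hz'.le (by linarith)
          gcongr
      _ = (M : ℝ) ^ (1 - a) * ‖f z‖ ^ a := by
          rw [mul_assoc, Real.rpow_sub_one h0.ne', div_mul_cancel₀ _ h0.ne']

/-- A sequence that is bounded in `L^a`, `a > 1`, over a finite measure space has forward convex
combinations that converge in `L^1`. -/
theorem exists_forwardWeights_tendsto_lintegral [InnerProductSpace ℝ F] [CompleteSpace F]
    [IsFiniteMeasure μ] {f : ℕ → α → F} (hf : ∀ k, AEStronglyMeasurable (f k) μ) {a : ℝ}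
    (ha : 1 < a) {C : ℝ≥0∞} (hC : C ≠ ⊤) (hfC : ∀ k, ∫⁻ z, ‖f k z‖ₑ ^ a ∂μ ≤ C) :
    ∃ w : ℕ → ℕ →₀ ℝ, (∀ n, w n ∈ forwardWeights n) ∧ ∃ g : α → F, Integrable g μ ∧
      Tendsto (fun n => ∫⁻ z, ‖Finsupp.linearCombination ℝ f (w n) z - g z‖ₑ ∂μ) atTop (𝓝 0) := by
  -- truncations as elements of a Hilbert space
  have hT : ∀ (p : ℝ≥0∞) M k, MemLp (truncation M (f k)) p μ := fun p M k =>
    MemLp.of_bound (aestronglyMeasurable_truncation (hf k) M) M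
      (ae_of_all _ (norm_truncation_le M (f k)))
  set A : ℝ := (μ Set.univ ^ ((2 : ℝ≥0∞).toReal⁻¹)).toReal
  have hA0 : 0 ≤ A := ENNReal.toReal_nonneg
  have hTn : ∀ M k, ‖(hT 2 M k).toLp _‖ ≤ A * M := by
    intro M k
    rw [Lp.norm_toLp]
    have h1 := eLpNorm_le_of_ae_bound (p := 2) (μ := μ)
      (ae_of_all _ (norm_truncation_le M (f k)))
    have h2 : μ Set.univ ^ ((2 : ℝ≥0∞).toReal⁻¹) ≠ ⊤ :=
      ENNReal.rpow_ne_top_of_nonneg (by positivity) (measure_ne_top _ _)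
    calc _ ≤ (μ Set.univ ^ ((2 : ℝ≥0∞).toReal⁻¹) * ENNReal.ofReal M).toReal :=
          ENNReal.toReal_mono (ENNReal.mul_ne_top h2 ENNReal.ofReal_ne_top) h1
      _ = A * M := by
          rw [ENNReal.toReal_mul, ENNReal.toReal_ofReal (by positivity)]
  -- The truncation at height M has L² norm at most A M. These weights make the family of all
  -- truncations a bounded element of the single Hilbert space ℓ²(L²), so that one sequence of
  -- convex weights works at every height.
  set c : ℕ → ℝ := fun M => (1 / 2) ^ M / (M + 1)
  have hc0 : ∀ M, 0 < c M := fun M => by positivity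
  have hcn : ∀ M k, ‖c M • (hT 2 M k).toLp _‖ ≤ A * (1 / 2) ^ M := by
    intro M k
    rw [norm_smul, Real.norm_of_nonneg (hc0 M).le]
    calc c M * ‖(hT 2 M k).toLp _‖ ≤ c M * (A * (M + 1)) := by
          gcongr
          exact (hTn M k).trans (by gcongr; linarith)
      _ = A * (1 / 2) ^ M := by simp only [c]; field_simp
  have hsq : ∀ M k, ‖c M • (hT 2 M k).toLp _‖ ^ (2 : ℝ≥0∞).toReal ≤ A ^ 2 * (1 / 4) ^ M := by
    intro M k
    rw [ENNReal.toReal_ofNat, Real.rpow_two]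
    calc _ ≤ (A * (1 / 2) ^ M) ^ 2 := pow_le_pow_left₀ (norm_nonneg _) (hcn M k) 2
      _ = _ := by rw [mul_pow, ← pow_mul, mul_comm M 2, pow_mul]; norm_num
  have hsum : Summable fun M : ℕ => A ^ 2 * (1 / 4 : ℝ) ^ M :=
    (summable_geometric_of_lt_one (by norm_num) (by norm_num)).mul_left _
  have hsumk : ∀ k, Summable fun M => ‖c M • (hT 2 M k).toLp _‖ ^ (2 : ℝ≥0∞).toReal := fun k =>
    Summable.of_nonneg_of_le (fun M => by positivity) (fun M => hsq M k) hsum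
  let X : ℕ → lp (fun _ : ℕ => Lp F 2 μ) 2 := fun k =>
    ⟨fun M => c M • (hT 2 M k).toLp _, memℓp_gen (hsumk k)⟩
  set S := ∑' M : ℕ, A ^ 2 * (1 / 4 : ℝ) ^ M
  have hS : 0 ≤ S := tsum_nonneg fun M => by positivity
  have hX : ∀ k, ‖X k‖ ≤ Real.sqrt S := fun k => by
    refine lp.norm_le_of_tsum_le (by simp) (Real.sqrt_nonneg _) ?_
    refine ((hsumk k).tsum_le_tsum (fun M => hsq M k) hsum).trans ?_
    rw [ENNReal.toReal_ofNat, Real.rpow_two, Real.sq_sqrt hS]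
  obtain ⟨w, hw, z, hz⟩ := exists_forwardWeights_tendsto hX
  refine ⟨w, hw, ?_⟩
  -- each truncation gives a Cauchy sequence in `L^1`
  have hT2 : ∀ M, CauchySeq fun n =>
      Finsupp.linearCombination ℝ (fun k => (hT 2 M k).toLp _) (w n) := by
    intro M
    have h1 := (((lp.evalCLM ℝ (fun _ : ℕ => Lp F 2 μ) 2 M).continuous.tendsto z).comp
      hz).const_smul (c M)⁻¹
    refine (h1.congr fun n => ?_).cauchySeq
    have h2 := Finsupp.apply_linearCombination ℝ
      ((c M)⁻¹ • (lp.evalCLM ℝ (fun _ : ℕ => Lp F 2 μ) 2 M).toLinearMap) X (w n)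
    refine Eq.trans h2 ?_
    congr 2
    ext1 k
    exact inv_smul_smul₀ (hc0 M).ne' _
  set D : ℝ := (μ Set.univ ^ (1 / (1 : ℝ≥0∞).toReal - 1 / (2 : ℝ≥0∞).toReal)).toReal
  have hD : ∀ M (v : ℕ →₀ ℝ), ‖Finsupp.linearCombination ℝ (fun k => (hT 1 M k).toLp _) v‖ ≤
      ‖Finsupp.linearCombination ℝ (fun k => (hT 2 M k).toLp _) v‖ * D := by
    intro M v
    rw [Lp.norm_def, Lp.norm_def, ← ENNReal.toReal_mul]
    have h0 : μ Set.univ ^ (1 / (1 : ℝ≥0∞).toReal - 1 / (2 : ℝ≥0∞).toReal) ≠ ⊤ :=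
      ENNReal.rpow_ne_top_of_nonneg (by norm_num) (measure_ne_top _ _)
    refine ENNReal.toReal_mono (ENNReal.mul_ne_top (Lp.eLpNorm_ne_top _) h0) ?_
    rw [eLpNorm_congr_ae ((coeFn_linearCombination_toLp (hT 1 M) v).trans
      (coeFn_linearCombination_toLp (hT 2 M) v).symm)]
    exact eLpNorm_le_eLpNorm_mul_rpow_measure_univ (by norm_num) (Lp.aestronglyMeasurable _)
  have hT1 : ∀ M, CauchySeq fun n =>
      Finsupp.linearCombination ℝ (fun k => (hT 1 M k).toLp _) (w n) := by
    intro M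
    have h1 := hT2 M
    rw [Metric.cauchySeq_iff] at h1 ⊢
    intro ε hε
    obtain ⟨N, hN⟩ := h1 (ε / (D + 1)) (by positivity)
    refine ⟨N, fun n hn m hm => ?_⟩
    have h2 := hN n hn m hm
    rw [dist_eq_norm, ← map_sub] at h2 ⊢
    refine (hD M _).trans_lt ?_
    rw [lt_div_iff₀ (by positivity)] at h2
    nlinarith [norm_nonneg (Finsupp.linearCombination ℝ
      (fun k => (hT 2 M k).toLp (truncation M (f k))) (w n - w m))]
  -- tails
  have htail : ∀ ε : ℝ, 0 < ε → ∃ M : ℕ, ∀ k, ∫⁻ z, ‖f k z - truncation M (f k) z‖ₑ ∂μ ≤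
      ENNReal.ofReal ε := by
    intro ε hε
    have h1 : Tendsto (fun M : ℕ => ENNReal.ofReal ((M : ℝ) ^ (1 - a)) * C) atTop (𝓝 0) := by
      have h2 := (tendsto_rpow_neg_atTop (y := a - 1) (by linarith)).comp
        (tendsto_natCast_atTop_atTop (R := ℝ))
      have h3 := ENNReal.tendsto_ofReal h2
      rw [ENNReal.ofReal_zero] at h3
      have h4 := ENNReal.Tendsto.mul_const h3 (Or.inr hC)
      rw [zero_mul] at h4
      refine h4.congr fun M => ?_
      simp [neg_sub]
    obtain ⟨M, h2, h3⟩ := ((h1.eventually (ge_mem_nhds (ENNReal.ofReal_pos.2 hε))).and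
      (eventually_gt_atTop 0)).exists
    refine ⟨M, fun k => (lintegral_enorm_sub_truncation_le (f k) ha h3).trans (le_trans ?_ h2)⟩
    gcongr
    exact hfC k
  have hf1 : ∀ k, MemLp (f k) 1 μ := by
    intro k
    obtain ⟨M, hM⟩ := htail 1 one_pos
    have h1 : MemLp (fun z => f k z - truncation M (f k) z) 1 μ := by
      refine ⟨(hf k).sub (aestronglyMeasurable_truncation (hf k) M), ?_⟩
      rw [eLpNorm_one_eq_lintegral_enorm]
      exact (hM k).trans_lt ENNReal.ofReal_lt_top
    have h2 := h1.add (hT 1 M k)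
    refine h2.ae_eq (ae_of_all _ fun z => ?_)
    simp
  have hcauchy : CauchySeq fun n =>
      Finsupp.linearCombination ℝ (fun k => (hf1 k).toLp (f k)) (w n) := by
    rw [Metric.cauchySeq_iff]
    intro ε hε
    obtain ⟨M, hM⟩ := htail (ε / 3) (by positivity)
    -- The tail bound is uniform in k, so convex combinations inherit it; balls are convex.
    have hr : ∀ n, ‖Finsupp.linearCombination ℝ (fun k => (hf1 k).toLp (f k)) (w n) -
        Finsupp.linearCombination ℝ (fun k => (hT 1 M k).toLp _) (w n)‖ ≤ ε / 3 := by
      intro n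
      have e1 : Finsupp.linearCombination ℝ (fun k => (hf1 k).toLp (f k)) (w n) -
          Finsupp.linearCombination ℝ (fun k => (hT 1 M k).toLp _) (w n)
          = Finsupp.linearCombination ℝ
            (fun k => (hf1 k).toLp (f k) - (hT 1 M k).toLp _) (w n) := by
        simp [Finsupp.linearCombination_apply, Finsupp.sum, smul_sub, Finset.sum_sub_distrib]
      rw [e1, ← mem_closedBall_zero_iff]
      refine linearCombination_mem_of_convex (hw n) (convex_closedBall _ _) fun k _ => ?_
      rw [mem_closedBall_zero_iff, ← MemLp.toLp_sub, Lp.norm_toLp,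
        eLpNorm_one_eq_lintegral_enorm]
      refine ENNReal.toReal_le_of_le_ofReal (by positivity) (hM k)
    obtain ⟨N, hN⟩ := Metric.cauchySeq_iff.1 (hT1 M) (ε / 3) (by positivity)
    refine ⟨N, fun n hn m hm => ?_⟩
    have h1 := hN n hn m hm
    have h2 := hr n
    have h3 := hr m
    rw [← dist_eq_norm] at h2 h3
    rw [dist_comm] at h3
    have h4 := dist_triangle4 (Finsupp.linearCombination ℝ (fun k => (hf1 k).toLp (f k)) (w n))
      (Finsupp.linearCombination ℝ (fun k => (hT 1 M k).toLp _) (w n))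
      (Finsupp.linearCombination ℝ (fun k => (hT 1 M k).toLp _) (w m))
      (Finsupp.linearCombination ℝ (fun k => (hf1 k).toLp (f k)) (w m))
    linarith
  obtain ⟨g, hg⟩ := cauchySeq_tendsto_of_complete hcauchy
  refine ⟨g, L1.integrable_coeFn g, ?_⟩
  rw [tendsto_iff_edist_tendsto_0] at hg
  refine hg.congr fun n => ?_
  rw [Lp.edist_def, eLpNorm_one_eq_lintegral_enorm]
  refine lintegral_congr_ae ?_
  filter_upwards [coeFn_linearCombination_toLp hf1 (w n)] with x hx
  rw [Pi.sub_apply, hx]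

end ForwardConvexCombinations


/-! ### Uniqueness of the weak limit along further subsequences. -/

section WeakLimits

/-- The algebra generated by a countable generating family is itself countable. Integrals over its
members determine an integrable function, and countability permits extracting one subsequence for
all of them. -/
lemma exists_countable_isPiSystem (α : Type*) [mα : MeasurableSpace α]
    [MeasurableSpace.CountablyGenerated α] : ∃ S : Set (Set α), S.Countable ∧ IsPiSystem S ∧
      Set.univ ∈ S ∧ mα = MeasurableSpace.generateFrom S := by
  refine ⟨generateSetAlgebra (MeasurableSpace.countableGeneratingSet α),
    countable_generateSetAlgebra (MeasurableSpace.countable_countableGeneratingSet (α := α)), ?_, ?_, ?_⟩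
  · intro s hs t ht _
    exact isSetAlgebra_generateSetAlgebra.inter_mem hs ht
  · exact isSetAlgebra_generateSetAlgebra.univ_mem
  · rw [generateFrom_generateSetAlgebra_eq, MeasurableSpace.generateFrom_countableGeneratingSet]

variable {α F : Type*} [mα : MeasurableSpace α] [NormedAddCommGroup F] [NormedSpace ℝ F]
  {μ : Measure α}

lemma ae_eq_of_forall_setIntegral_eq_of_isPiSystem [CompleteSpace F] {S : Set (Set α)}
    (hS : IsPiSystem S) (huniv : Set.univ ∈ S) (hgen : mα = MeasurableSpace.generateFrom S)
    {f g : α → F} (hf : Integrable f μ) (hg : Integrable g μ)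
    (h : ∀ s ∈ S, ∫ z in s, f z ∂μ = ∫ z in s, g z ∂μ) : f =ᵐ[μ] g := by
  have hSm : ∀ s ∈ S, MeasurableSet s := fun s hs => by
    rw [hgen]; exact MeasurableSpace.measurableSet_generateFrom hs
  have key : ∀ s, MeasurableSet s → ∫ z in s, f z ∂μ = ∫ z in s, g z ∂μ := by
    intro s hs
    induction s, hs using MeasurableSpace.induction_on_inter hgen hS with
    | empty => simp
    | basic s hs => exact h s hs
    | compl s hs ih =>
      have h1 := h _ huniv
      rw [setIntegral_univ, setIntegral_univ] at h1
      rw [setIntegral_compl hs hf, setIntegral_compl hs hg, h1, ih]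
    | iUnion s hd hs ih =>
      rw [integral_iUnion hs hd hf.integrableOn, integral_iUnion hs hd hg.integrableOn]
      simp only [ih]
  exact Integrable.ae_eq_of_forall_setIntegral_eq _ _ hf hg fun s hs _ => key s hs

lemma setIntegral_linearCombination {f : ℕ → α → F} (hf : ∀ k, Integrable (f k) μ) (w : ℕ →₀ ℝ)
    (s : Set α) : ∫ z in s, Finsupp.linearCombination ℝ f w z ∂μ
      = Finsupp.linearCombination ℝ (fun k => ∫ z in s, f k z ∂μ) w := by
  simp only [Finsupp.linearCombination_apply, Finsupp.sum, Finset.sum_apply, Pi.smul_apply]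
  rw [integral_finsetSum (f := fun k z => w k • f k z) _
    fun k _ => ((hf k).smul (w k)).integrableOn]
  simp only [integral_smul]

lemma integrable_linearCombination {f : ℕ → α → F} (hf : ∀ k, Integrable (f k) μ) (w : ℕ →₀ ℝ) :
    Integrable (Finsupp.linearCombination ℝ f w) μ := by
  simp only [Finsupp.linearCombination_apply, Finsupp.sum]
  exact integrable_finsetSum' _ fun k _ => (hf k).smul _

lemma tendsto_linearCombination_forwardWeights {x : ℕ → F} {y : F} (hx : Tendsto x atTop (𝓝 y))
    {w : ℕ → ℕ →₀ ℝ} (hw : ∀ n, w n ∈ forwardWeights n) :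
    Tendsto (fun n => Finsupp.linearCombination ℝ x (w n)) atTop (𝓝 y) := by
  rw [Metric.nhds_basis_closedBall.tendsto_right_iff] at hx ⊢
  intro ε hε
  obtain ⟨N, hN⟩ := eventually_atTop.1 (hx ε hε)
  filter_upwards [eventually_ge_atTop N] with n hn
  exact linearCombination_mem_of_convex (hw n) (convex_closedBall y ε)
    fun k hk => hN k (hn.trans hk)

lemma lintegral_enorm_le_of_rpow {C : ℝ≥0∞} {f : α → F} {a : ℝ} (ha : 1 ≤ a)
    (hC : ∫⁻ z, ‖f z‖ₑ ^ a ∂μ ≤ C) : ∫⁻ z, ‖f z‖ₑ ∂μ ≤ μ Set.univ + C := by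
  calc ∫⁻ z, ‖f z‖ₑ ∂μ ≤ ∫⁻ z, 1 + ‖f z‖ₑ ^ a ∂μ := by
        refine lintegral_mono fun z => ?_
        rcases le_total ‖f z‖ₑ 1 with h | h
        · exact h.trans le_self_add
        · refine le_trans ?_ le_add_self
          simpa using ENNReal.rpow_le_rpow_of_exponent_le h ha
    _ = μ Set.univ + ∫⁻ z, ‖f z‖ₑ ^ a ∂μ := by
        rw [lintegral_add_left measurable_const, lintegral_one]
    _ ≤ _ := by gcongr

end WeakLimits

/-- A sequence that is bounded in `L^a`, `a > 1`, has a subsequence with a weak limit, expressed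
by means of strong `L^1` limits of forward convex combinations. -/
theorem exists_subseq_forwardWeights_tendsto_lintegral {α F : Type*} [MeasurableSpace α]
    [MeasurableSpace.CountablyGenerated α]
    [NormedAddCommGroup F] [InnerProductSpace ℝ F] [FiniteDimensional ℝ F]
    {μ : Measure α} [IsFiniteMeasure μ] {f : ℕ → α → F} {a : ℝ} {C : ℝ≥0∞}
    (hf : ∀ k, AEStronglyMeasurable (f k) μ) (ha : 1 < a) (hC : C ≠ ⊤)
    (hfC : ∀ k, ∫⁻ z, ‖f k z‖ₑ ^ a ∂μ ≤ C) :
    ∃ κ : ℕ → ℕ, StrictMono κ ∧ ∃ g, Integrable g μ ∧ ∀ σ : ℕ → ℕ, StrictMono σ →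
      ∃ w : ℕ → ℕ →₀ ℝ, (∀ n, w n ∈ forwardWeights n) ∧
        Tendsto (fun n => ∫⁻ z, ‖Finsupp.linearCombination ℝ (fun k => f (κ (σ k))) (w n) z
          - g z‖ₑ ∂μ) atTop (𝓝 0) := by
  obtain ⟨S, hSc, hSpi, huniv, hgen⟩ := exists_countable_isPiSystem α
  have hCt : μ Set.univ + C ≠ ⊤ := ENNReal.add_ne_top.2 ⟨measure_ne_top _ _, hC⟩
  have hle : ∀ k, ∫⁻ z, ‖f k z‖ₑ ∂μ ≤ μ Set.univ + C := fun k =>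
    lintegral_enorm_le_of_rpow ha.le (hfC k)
  have hint : ∀ k, Integrable (f k) μ := fun k => ⟨hf k, (hle k).trans_lt hCt.lt_top⟩
  set B := (μ Set.univ + C).toReal
  have hB : ∀ k (s : Set α), ‖∫ z in s, f k z ∂μ‖ ≤ B := by
    intro k s
    rw [← toReal_enorm]
    refine ENNReal.toReal_mono hCt ((enorm_integral_le_lintegral_enorm _).trans ?_)
    exact (setLIntegral_le_lintegral s _).trans (hle k)
  have : Countable S := hSc.to_subtype
  -- The integrals over the sets of S form a sequence in a countable product of closed balls of a
  -- finite-dimensional space, which is compact and metrizable.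
  obtain ⟨x, -, κ, hκ, hx⟩ := (isCompact_univ_pi fun _ : S =>
    isCompact_closedBall (0 : F) B).tendsto_subseq (x := fun k (s : S) => ∫ z in s, f k z ∂μ)
    (fun k => by simpa [Set.mem_univ_pi] using fun s _ => hB k s)
  rw [tendsto_pi_nhds] at hx
  -- Forward convex combinations of a convergent sequence keep its limit. Every limit g produced
  -- along a further subsequence therefore has the prescribed integrals `x s`, so all these limits
  -- agree almost everywhere.
  have key : ∀ σ : ℕ → ℕ, StrictMono σ → ∃ w : ℕ → ℕ →₀ ℝ, (∀ n, w n ∈ forwardWeights n) ∧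
      ∃ g, Integrable g μ ∧ (∀ s : S, ∫ z in s, g z ∂μ = x s) ∧
        Tendsto (fun n => ∫⁻ z, ‖Finsupp.linearCombination ℝ (fun k => f (κ (σ k))) (w n) z
          - g z‖ₑ ∂μ) atTop (𝓝 0) := by
    intro σ hσ
    obtain ⟨w, hw, g, hg, hlim⟩ := exists_forwardWeights_tendsto_lintegral
      (fun k => hf (κ (σ k))) ha hC (fun k => hfC _)
    refine ⟨w, hw, g, hg, fun s => ?_, hlim⟩
    have h1 := tendsto_setIntegral_of_L1 g hg.1
      (Eventually.of_forall fun n => integrable_linearCombination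
        (fun k => hint (κ (σ k))) (w n)) hlim (s : Set α)
    have h2 := tendsto_linearCombination_forwardWeights ((hx s).comp hσ.tendsto_atTop) hw
    refine tendsto_nhds_unique h1 (h2.congr fun n => ?_)
    rw [setIntegral_linearCombination fun k => hint (κ (σ k))]
    rfl
  obtain ⟨w, hw, g, hg, hgx, hlim⟩ := key id strictMono_id
  refine ⟨κ, hκ, g, hg, fun σ hσ => ?_⟩
  obtain ⟨w', hw', g', hg', hgx', hlim'⟩ := key σ hσ
  have h1 : g' =ᵐ[μ] g := ae_eq_of_forall_setIntegral_eq_of_isPiSystem hSpi huniv hgen hg' hg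
    fun s hs => (hgx' ⟨s, hs⟩).trans (hgx ⟨s, hs⟩).symm
  refine ⟨w', hw', hlim'.congr fun n => lintegral_congr_ae ?_⟩
  filter_upwards [h1] with z hz
  rw [hz]


/-! ### Time slices of exponents, functions and weak gradients. -/

section Slices

variable {d : ℕ} {T : ℝ} {Ω : Set (Vec d)} {q p : ℝ × Vec d → ℝ} {u : ℝ × Vec d → Vec d}
  {G : ℝ × Vec d → Tensor d}

lemma volume_restrict_cylinder (T : ℝ) (Ω : Set (Vec d)) :
    (volume : Measure (ℝ × Vec d)).restrict (cylinder T Ω)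
      = (volume.restrict (Set.Ioo 0 T)).prod (volume.restrict Ω) := by
  rw [Measure.prod_restrict, cylinder]
  rfl

lemma volume_cylinder_ne_top (hΩ : volume Ω ≠ ⊤) : volume (cylinder T Ω) ≠ ⊤ := by
  rw [cylinder, Measure.volume_eq_prod, Measure.prod_prod]
  exact ENNReal.mul_ne_top (by simp) hΩ

lemma isOpen_cylinder (hΩ : IsOpen Ω) : IsOpen (cylinder T Ω) :=
  isOpen_Ioo.prod hΩ

lemma ae_ae_of_ae_cylinder {P : ℝ × Vec d → Prop}
    (h : ∀ᵐ z ∂(volume.restrict (cylinder T Ω)), P z) :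
    ∀ᵐ t ∂(volume.restrict (Set.Ioo 0 T)), ∀ᵐ x ∂(volume.restrict Ω), P (t, x) := by
  rw [volume_restrict_cylinder] at h
  exact Measure.ae_ae_of_ae_prod h

lemma IsBddExponent.slice (h : IsBddExponent (cylinder T Ω) q) :
    ∀ᵐ t ∂(volume.restrict (Set.Ioo 0 T)), IsBddExponent Ω fun x => q (t, x) := by
  obtain ⟨b, hb⟩ := h.bdd
  have h1 := h.aemeasurable.aestronglyMeasurable
  rw [volume_restrict_cylinder] at h1
  filter_upwards [h1.prodMk_left, ae_ae_of_ae_cylinder h.one_le, ae_ae_of_ae_cylinder hb]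
    with t h2 h3 h4
  exact ⟨h2.aemeasurable, h3, b, h4⟩

lemma MemVarLebesgue.slice {F : Type*} [NormedAddCommGroup F] [NormedSpace ℝ F]
    {f : ℝ × Vec d → F} (hq : IsBddExponent (cylinder T Ω) q)
    (h : MemVarLebesgue (cylinder T Ω) q f) :
    ∀ᵐ t ∂(volume.restrict (Set.Ioo 0 T)),
      MemVarLebesgue Ω (fun x => q (t, x)) fun x => f (t, x) := by
  obtain ⟨h1, h2⟩ := h
  have h3 := aemeasurable_enorm_rpow hq.aemeasurable h1
  rw [modular_eq_lintegral hq.one_le] at h2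
  rw [volume_restrict_cylinder] at h1 h2 h3
  rw [lintegral_prod _ h3] at h2
  filter_upwards [h1.prodMk_left, ae_ae_of_ae_cylinder hq.one_le,
    ae_lt_top' h3.lintegral_prod_right' h2.ne] with t h4 h5 h6
  refine ⟨h4, ?_⟩
  rwa [modular_eq_lintegral h5]

lemma IsLogExponent.slice (h : IsLogExponent (cylinder T Ω) q) {t : ℝ} (ht : t ∈ Set.Ioo 0 T) :
    LogHolderOn Ω fun x => q (t, x) := by
  obtain ⟨c, hc, h1⟩ := h.logHolder
  refine ⟨c, hc, fun x hx y hy => ?_⟩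
  have h2 : euclDist (t, x) (t, y) = ‖x - y‖ := by
    simp [euclDist, Real.sqrt_sq]
  have h3 := h1 (t, x) ⟨ht, hx⟩ (t, y) ⟨ht, hy⟩
  rwa [h2] at h3

/-- Countably many test functions suffice for the weak symmetric gradient. -/
lemma exists_countable_testFunctions (hΩ : Bornology.IsBounded Ω) :
    ∃ D : Set (Vec d → ℝ), D.Countable ∧
      (∀ φ ∈ D, ContDiff ℝ (⊤ : ℕ∞) φ ∧ HasCompactSupport φ ∧ tsupport φ ⊆ Ω) ∧
      ∀ φ : Vec d → ℝ, ContDiff ℝ (⊤ : ℕ∞) φ → HasCompactSupport φ → tsupport φ ⊆ Ω →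
        ∀ ε > 0, ∃ ψ ∈ D, ∀ x ∈ Ω, |φ x - ψ x| ≤ ε ∧ ‖fderiv ℝ φ x - fderiv ℝ ψ x‖ ≤ ε := by
  have : CompactSpace (closure Ω) := isCompact_iff_compactSpace.1 hΩ.isCompact_closure
  let A := {φ : Vec d → ℝ // ContDiff ℝ (⊤ : ℕ∞) φ ∧ HasCompactSupport φ ∧ tsupport φ ⊆ Ω}
  -- A test function is encoded by its value and derivative on the compact closure. Subsets of the
  -- separable metric space of continuous maps are separable, which gives a countable family dense
  -- in C^1.
  let Φ : A → C(closure Ω, ℝ × (Vec d →L[ℝ] ℝ)) := fun φ =>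
    ⟨fun x => (φ.1 x, fderiv ℝ φ.1 x), by
      have h1 := φ.2.1.continuous
      have h2 := φ.2.1.continuous_fderiv (by simp)
      fun_prop⟩
  obtain ⟨t, ht, htc, hd⟩ := (TopologicalSpace.IsSeparable.of_separableSpace
    (Set.range Φ)).exists_countable_dense_subset
  have : Nonempty A := ⟨⟨0, contDiff_const, HasCompactSupport.zero, by simp [tsupport]⟩⟩
  have ht' : ∀ y ∈ t, ∃ φ, Φ φ = y := fun y hy => ht hy
  choose! g hg using ht'
  refine ⟨(fun y => (g y).1) '' t, htc.image _, ?_, ?_⟩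
  · rintro _ ⟨y, -, rfl⟩
    exact (g y).2
  · intro φ h1 h2 h3 ε hε
    obtain ⟨y, hy, hlt⟩ := (Metric.mem_closure_iff
      (α := C(closure Ω, ℝ × (Vec d →L[ℝ] ℝ)))).1
      (hd (Set.mem_range_self (⟨φ, h1, h2, h3⟩ : A))) ε hε
    refine ⟨_, ⟨y, hy, rfl⟩, fun x hx => ?_⟩
    rw [← hg y hy] at hlt
    have h4 := (ContinuousMap.dist_apply_le_dist ⟨x, subset_closure hx⟩).trans hlt.le
    rw [Prod.dist_eq, max_le_iff, dist_eq_norm, dist_eq_norm] at h4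
    exact h4

lemma abs_symPairing_add_le {u : Vec d → Vec d} {G : Vec d → Tensor d} {φ ψ : Vec d → ℝ}
    {ε : ℝ} {x : Vec d} (h : |φ x - ψ x| ≤ ε) (h' : ‖fderiv ℝ φ x - fderiv ℝ ψ x‖ ≤ ε)
    (i j : Fin d) :
    |(symPairing spaceDir u φ i j x + G x (i, j) * φ x)
      - (symPairing spaceDir u ψ i j x + G x (i, j) * ψ x)| ≤ ε * (‖u x‖ + ‖G x‖) := by
  have hd : ∀ k : Fin d, |fderiv ℝ φ x (spaceDir k) - fderiv ℝ ψ x (spaceDir k)| ≤ ε := by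
    intro k
    have h1 := (fderiv ℝ φ x - fderiv ℝ ψ x).le_opNorm (spaceDir k)
    rw [sub_apply, Real.norm_eq_abs, spaceDir, EuclideanSpace.single,
      PiLp.norm_single, norm_one, mul_one] at h1
    exact h1.trans h'
  have hu : ∀ k : Fin d, |u x k| ≤ ‖u x‖ := fun k => PiLp.norm_apply_le (u x) k
  have hG : |G x (i, j)| ≤ ‖G x‖ := PiLp.norm_apply_le (G x) (i, j)
  have e1 : (symPairing spaceDir u φ i j x + G x (i, j) * φ x)
      - (symPairing spaceDir u ψ i j x + G x (i, j) * ψ x)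
      = 1 / 2 * (u x i * (fderiv ℝ φ x (spaceDir j) - fderiv ℝ ψ x (spaceDir j)))
        + 1 / 2 * (u x j * (fderiv ℝ φ x (spaceDir i) - fderiv ℝ ψ x (spaceDir i)))
        + G x (i, j) * (φ x - ψ x) := by
    simp only [symPairing]; ring
  rw [e1]
  refine (abs_add_three _ _ _).trans ?_
  rw [abs_mul, abs_mul, abs_mul, abs_mul, abs_mul, abs_of_pos (by norm_num : (0 : ℝ) < 1 / 2)]
  have a1 := mul_le_mul (hu i) (hd j) (abs_nonneg _) (norm_nonneg _)
  have a2 := mul_le_mul (hu j) (hd i) (abs_nonneg _) (norm_nonneg _)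
  have a3 := mul_le_mul hG h (abs_nonneg _) (norm_nonneg _)
  linarith

lemma fderiv_mul_prod {g : ℝ → ℝ} {φ : Vec d → ℝ} (hg : ContDiff ℝ (⊤ : ℕ∞) g)
    (hφ : ContDiff ℝ (⊤ : ℕ∞) φ) (z : ℝ × Vec d) (j : Fin d) :
    fderiv ℝ (fun z : ℝ × Vec d => g z.1 * φ z.2) z (cylDir j)
      = g z.1 * fderiv ℝ φ z.2 (spaceDir j) := by
  have h1 : HasFDerivAt (fun z : ℝ × Vec d => g z.1) _ z :=
    ((hg.differentiable (by simp) z.1).hasFDerivAt).comp z hasFDerivAt_fst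
  have h2 : HasFDerivAt (fun z : ℝ × Vec d => φ z.2) _ z :=
    ((hφ.differentiable (by simp) z.2).hasFDerivAt).comp z hasFDerivAt_snd
  have h3 := (h1.mul h2).fderiv
  change fderiv ℝ (fun z : ℝ × Vec d => g z.1 * φ z.2) z = _ at h3
  rw [h3]
  simp [cylDir, spaceDir]

/-- Test with g(t) φ(x), apply Fubini, and use the fundamental lemma of the calculus of variations
in t. -/
lemma HasWeakSymGrad.ae_integral_slice_eq_zero (hu : IntegrableOn u (cylinder T Ω))
    (hG : IntegrableOn G (cylinder T Ω)) (h : HasWeakSymGrad cylDir (cylinder T Ω) u G)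
    {φ : Vec d → ℝ} (hφ : ContDiff ℝ (⊤ : ℕ∞) φ) (hφc : HasCompactSupport φ)
    (hφΩ : tsupport φ ⊆ Ω) (i j : Fin d) :
    ∀ᵐ t ∂(volume.restrict (Set.Ioo 0 T)), ∫ x in Ω,
      (symPairing spaceDir (fun x => u (t, x)) φ i j x + G (t, x) (i, j) * φ x) = 0 := by
  set Ψ : ℝ × Vec d → ℝ := fun z =>
    symPairing spaceDir (fun x => u (z.1, x)) φ i j z.2 + G z (i, j) * φ z.2
  set F : ℝ → ℝ := fun t => ∫ x in Ω, Ψ (t, x)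
  have hu' := hu
  have hG' := hG
  rw [IntegrableOn, volume_restrict_cylinder] at hu' hG'
  have hΨ : Integrable Ψ ((volume.restrict (Set.Ioo 0 T)).prod (volume.restrict Ω)) := by
    have hD : ∀ a k, Integrable (fun z : ℝ × Vec d => u z k * fderiv ℝ φ z.2 a)
        ((volume.restrict (Set.Ioo 0 T)).prod (volume.restrict Ω)) := by
      intro a k
      obtain ⟨C, hC⟩ := exists_bound_fderiv_apply hφ hφc a
      exact Integrable.coord_mul hu' ((continuous_fderiv_apply_const hφ a).comp
        continuous_snd).aestronglyMeasurable (fun z => hC z.2) k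
    obtain ⟨C, hC⟩ := hφ.continuous.bounded_above_of_compact_support hφc
    exact (((hD (spaceDir j) i).add (hD (spaceDir i) j)).const_mul _).add
      (Integrable.coord_mul hG' (hφ.continuous.comp continuous_snd).aestronglyMeasurable
        (fun z => hC z.2) (i, j))
  have hF : IntegrableOn F (Set.Ioo 0 T) := hΨ.integral_prod_left
  have key := isOpen_Ioo.ae_eq_zero_of_integral_contDiff_smul_eq_zero
    hF.locallyIntegrableOn (μ := volume) ?_
  · rwa [ae_restrict_iff' measurableSet_Ioo]
  intro g hg hgc hgI
  set ψ : ℝ × Vec d → ℝ := fun z => g z.1 * φ z.2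
  have hψ : ContDiff ℝ (⊤ : ℕ∞) ψ := (hg.comp contDiff_fst).mul (hφ.comp contDiff_snd)
  have hψ0 : ∀ z, z ∉ tsupport g ×ˢ tsupport φ → ψ z = 0 := by
    intro z hz
    rw [Set.mem_prod, not_and_or] at hz
    rcases hz with hz | hz
    · simp only [ψ, image_eq_zero_of_notMem_tsupport hz, zero_mul]
    · simp only [ψ, image_eq_zero_of_notMem_tsupport hz, mul_zero]
  have hψc : HasCompactSupport ψ := HasCompactSupport.intro (hgc.isCompact.prod hφc.isCompact) hψ0
  have hψQ : tsupport ψ ⊆ cylinder T Ω := by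
    refine (closure_minimal (fun z hz => ?_)
      ((isClosed_tsupport g).prod (isClosed_tsupport φ))).trans (Set.prod_mono hgI hφΩ)
    by_contra hn
    exact hz (hψ0 z hn)
  have i1 := LocallyIntegrableOn.integrable_symPairing (e := cylDir) h.1 hψ hψc hψQ i j
  have i2 := LocallyIntegrableOn.integrable_mul_of_tsupport_subset
    (LocallyIntegrableOn.coord h.2 (i, j)) hψ.continuous hψc hψQ
  have e0 := integral_add i1 i2
  have e1 : ∫ z in cylinder T Ω, symPairing cylDir u ψ i j z = _ :=
    h.integral_eq ψ hψ hψc hψQ i j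
  rw [e1, neg_add_cancel] at e0
  have e2 : (fun z => symPairing cylDir u ψ i j z + G z (i, j) * ψ z)
      = fun z => g z.1 * Ψ z := by
    ext z
    simp only [symPairing, Ψ, ψ, fderiv_mul_prod hg hφ]
    ring
  have i3 := i1.add i2
  change Integrable (fun z => symPairing cylDir u ψ i j z + G z (i, j) * ψ z) _ at i3
  rw [e2, volume_restrict_cylinder] at i3
  rw [e2, volume_restrict_cylinder, integral_prod _ i3] at e0
  simp only [integral_const_mul] at e0
  rw [← setIntegral_eq_integral_of_forall_compl_eq_zero (s := Set.Ioo 0 T)]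
  · exact e0
  · intro t ht
    rw [image_eq_zero_of_notMem_tsupport fun hh => ht (hgI hh), zero_smul]

/-- The exceptional set of times depends on the test function. Countably many test functions give
one null set, and C^1 approximation then reaches all the others, since `u` and `G` are integrable on
almost every slice. -/
theorem HasWeakSymGrad.slice (hΩo : IsOpen Ω) (hΩ : Bornology.IsBounded Ω)
    (hu : IntegrableOn u (cylinder T Ω))
    (hG : IntegrableOn G (cylinder T Ω)) (h : HasWeakSymGrad cylDir (cylinder T Ω) u G) :
    ∀ᵐ t ∂(volume.restrict (Set.Ioo 0 T)),
      HasWeakSymGrad spaceDir Ω (fun x => u (t, x)) fun x => G (t, x) := by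
  obtain ⟨D, hDc, hD, hdense⟩ := exists_countable_testFunctions hΩ
  have hu' := hu
  have hG' := hG
  rw [IntegrableOn, volume_restrict_cylinder] at hu' hG'
  have h1 : ∀ᵐ t ∂(volume.restrict (Set.Ioo 0 T)), ∀ φ ∈ D, ∀ i j : Fin d, ∫ x in Ω,
      (symPairing spaceDir (fun x => u (t, x)) φ i j x + G (t, x) (i, j) * φ x) = 0 := by
    rw [ae_ball_iff hDc]
    intro φ hφ
    rw [ae_all_iff]
    intro i
    rw [ae_all_iff]
    intro j
    exact h.ae_integral_slice_eq_zero hu hG (hD φ hφ).1 (hD φ hφ).2.1 (hD φ hφ).2.2 i j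
  filter_upwards [h1, hu'.prod_right_ae, hG'.prod_right_ae] with t h1 h2 h3
  have hl2 : LocallyIntegrableOn (fun x => u (t, x)) Ω :=
    IntegrableOn.locallyIntegrableOn h2
  have hl3 : LocallyIntegrableOn (fun x => G (t, x)) Ω :=
    IntegrableOn.locallyIntegrableOn h3
  refine ⟨hl2, hl3, fun φ hφ hφc hφΩ i j => ?_⟩
  have hi : ∀ ψ : Vec d → ℝ, ContDiff ℝ (⊤ : ℕ∞) ψ → HasCompactSupport ψ → tsupport ψ ⊆ Ω →
      Integrable (symPairing spaceDir (fun x => u (t, x)) ψ i j) (volume.restrict Ω) ∧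
      Integrable (fun x => G (t, x) (i, j) * ψ x) (volume.restrict Ω) := fun ψ a b c =>
    ⟨LocallyIntegrableOn.integrable_symPairing hl2 a b c i j,
      LocallyIntegrableOn.integrable_mul_of_tsupport_subset
        (LocallyIntegrableOn.coord hl3 (i, j)) a.continuous b c⟩
  obtain ⟨a1, a2⟩ := hi φ hφ hφc hφΩ
  change ∫ x in Ω, symPairing spaceDir (fun x => u (t, x)) φ i j x = _
  rw [eq_neg_iff_add_eq_zero, ← integral_add a1 a2, ← abs_nonpos_iff]
  set K := ∫ x in Ω, (‖u (t, x)‖ + ‖G (t, x)‖)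
  have hK : 0 ≤ K := integral_nonneg fun x => by positivity
  refine le_of_forall_pos_le_add fun ε hε => ?_
  obtain ⟨ψ, hψ, hψφ⟩ := hdense φ hφ hφc hφΩ (ε / (K + 1)) (by positivity)
  obtain ⟨b1, b2⟩ := hi ψ (hD ψ hψ).1 (hD ψ hψ).2.1 (hD ψ hψ).2.2
  have e1 : ∫ x in Ω,
      (symPairing spaceDir (fun x => u (t, x)) φ i j x + G (t, x) (i, j) * φ x)
      = ∫ x in Ω, ((symPairing spaceDir (fun x => u (t, x)) φ i j x + G (t, x) (i, j) * φ x)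
      - (symPairing spaceDir (fun x => u (t, x)) ψ i j x + G (t, x) (i, j) * ψ x)) := by
    have := integral_sub (a1.add a2) (b1.add b2)
    simp only [Pi.add_apply] at this
    rw [this, h1 ψ hψ i j, sub_zero]
  have e2 : |∫ x in Ω,
      (symPairing spaceDir (fun x => u (t, x)) φ i j x + G (t, x) (i, j) * φ x)|
      ≤ ε / (K + 1) * K := by
    rw [e1, ← Real.norm_eq_abs, ← integral_const_mul]
    refine norm_integral_le_of_norm_le ((h2.norm.add h3.norm).const_mul _) ?_
    filter_upwards [ae_restrict_mem hΩo.measurableSet] with x hx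
    exact abs_symPairing_add_le (u := fun x => u (t, x)) (G := fun x => G (t, x))
      (hψφ x hx).1 (hψφ x hx).2 i j
  refine e2.trans ?_
  rw [zero_add, div_mul_eq_mul_div, div_le_iff₀ (by positivity)]
  nlinarith

end Slices


/-- Along a subsequence whose integrals are at most 2^{-n} the series is integrable, hence finite
almost everywhere, and its terms tend to zero. -/
lemma exists_strictMono_ae_tendsto_zero {α : Type*} [MeasurableSpace α] {μ : Measure α}
    {h : ℕ → α → ℝ≥0∞} (hm : ∀ n, AEMeasurable (h n) μ)
    (hlim : Tendsto (fun n => ∫⁻ x, h n x ∂μ) atTop (𝓝 0)) :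
    ∃ σ : ℕ → ℕ, StrictMono σ ∧ ∀ᵐ x ∂μ, Tendsto (fun n => h (σ n) x) atTop (𝓝 0) := by
  obtain ⟨σ, hσ, hle⟩ := extraction_forall_of_eventually
    (P := fun n k => ∫⁻ x, h k x ∂μ ≤ (2⁻¹ : ℝ≥0∞) ^ n) fun n =>
      hlim.eventually (ge_mem_nhds (ENNReal.pow_pos (ENNReal.inv_pos.2 ENNReal.ofNat_ne_top) n))
  refine ⟨σ, hσ, ?_⟩
  have h1 : ∫⁻ x, ∑' n, h (σ n) x ∂μ ≠ ⊤ := by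
    rw [lintegral_tsum fun n => hm (σ n)]
    refine ne_top_of_le_ne_top ?_ (ENNReal.tsum_le_tsum hle)
    rw [ENNReal.tsum_geometric]
    simp
  filter_upwards [ae_lt_top' (AEMeasurable.tsum fun n => hm (σ n)) h1] with x hx
  exact ENNReal.tendsto_atTop_zero_of_tsum_ne_top hx.ne

/-! ### Lower semicontinuity and convexity of modulars. -/

section Modular

variable {X : Type*} [MeasureSpace X] {F : Type*} [NormedAddCommGroup F] [NormedSpace ℝ F]
  {M : Set X} {r : X → ℝ} {u : X → F} {C : ℝ≥0∞}

/-- Fatou's lemma for modulars. -/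
lemma modular_le_of_ae_tendsto {rk : ℕ → X → ℝ} {v : ℕ → X → F}
    (hr : ∀ᵐ z ∂(volume.restrict M), 0 < r z)
    (hrk : ∀ k, AEMeasurable (rk k) (volume.restrict M))
    (hv : ∀ k, AEStronglyMeasurable (v k) (volume.restrict M))
    (hrlim : ∀ᵐ z ∂(volume.restrict M), Tendsto (fun k => rk k z) atTop (𝓝 (r z)))
    (hvlim : ∀ᵐ z ∂(volume.restrict M), Tendsto (fun k => v k z) atTop (𝓝 (u z)))
    (h : ∀ k, modular M (rk k) (v k) ≤ C) : modular M r u ≤ C := by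
  calc modular M r u
      = ∫⁻ z in M, liminf (fun k => ENNReal.ofReal (‖v k z‖ ^ rk k z)) atTop := by
        refine lintegral_congr_ae ?_
        filter_upwards [hr, hrlim, hvlim] with z h1 h2 h3
        have h4 := (Real.continuousAt_rpow (‖u z‖, r z) (Or.inr h1)).tendsto.comp
          (h3.norm.prodMk_nhds h2)
        exact ((ENNReal.tendsto_ofReal h4).liminf_eq).symm
    _ ≤ liminf (fun k => modular M (rk k) (v k)) atTop :=
        lintegral_liminf_le' fun k => ((hv k).norm.aemeasurable.pow (hrk k)).ennreal_ofReal
    _ ≤ liminf (fun _ : ℕ => C) atTop := liminf_le_liminf (Eventually.of_forall h)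
    _ = C := liminf_const C

lemma modular_le_of_tendsto_lintegral {v : ℕ → X → F} (hr : ∀ᵐ z ∂(volume.restrict M), 0 < r z)
    (hrm : AEMeasurable r (volume.restrict M))
    (hv : ∀ k, AEStronglyMeasurable (v k) (volume.restrict M))
    (hu : AEStronglyMeasurable u (volume.restrict M))
    (hlim : Tendsto (fun k => ∫⁻ z in M, ‖v k z - u z‖ₑ) atTop (𝓝 0))
    (h : ∀ k, modular M r (v k) ≤ C) : modular M r u ≤ C := by
  obtain ⟨σ, -, h1⟩ := exists_strictMono_ae_tendsto_zero (fun k => ((hv k).sub hu).enorm) hlim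
  refine modular_le_of_ae_tendsto hr (fun _ => hrm) (fun k => hv (σ k))
    (ae_of_all _ fun _ => tendsto_const_nhds) ?_ fun k => h (σ k)
  filter_upwards [h1] with z hz
  rw [tendsto_iff_edist_tendsto_0]
  simpa only [edist_eq_enorm_sub, Pi.sub_apply] using hz

lemma convex_modular_le (hrm : AEMeasurable r (volume.restrict M))
    (hr : ∀ᵐ z ∂(volume.restrict M), 1 ≤ r z) (C : ℝ≥0∞) :
    Convex ℝ {u : X → F | AEStronglyMeasurable u (volume.restrict M) ∧ modular M r u ≤ C} := by
  rintro u ⟨hum, hu⟩ v ⟨hvm, hv⟩ a b ha hb hab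
  refine ⟨(hum.const_smul a).add (hvm.const_smul b), ?_⟩
  have h1 : modular M r (a • u + b • v)
      ≤ ENNReal.ofReal a * modular M r u + ENNReal.ofReal b * modular M r v := by
    unfold modular
    rw [← lintegral_const_mul' _ _ ENNReal.ofReal_ne_top,
      ← lintegral_const_mul' _ _ ENNReal.ofReal_ne_top, ← lintegral_add_left'
        (((hum.norm.aemeasurable.pow hrm).ennreal_ofReal).const_mul _)]
    refine lintegral_mono_ae ?_
    filter_upwards [hr] with z hz
    rw [← ENNReal.ofReal_mul ha, ← ENNReal.ofReal_mul hb,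
      ← ENNReal.ofReal_add (by positivity) (by positivity)]
    refine ENNReal.ofReal_le_ofReal ?_
    have h2 : ‖(a • u + b • v) z‖ ≤ a * ‖u z‖ + b * ‖v z‖ := by
      refine (norm_add_le _ _).trans_eq ?_
      simp [norm_smul, abs_of_nonneg ha, abs_of_nonneg hb]
    refine (Real.rpow_le_rpow (norm_nonneg _) h2 (by linarith)).trans ?_
    exact (convexOn_rpow hz).2 (norm_nonneg (u z)) (norm_nonneg (v z)) ha hb hab
  refine h1.trans ?_
  calc _ ≤ ENNReal.ofReal a * C + ENNReal.ofReal b * C := by gcongr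
    _ = C := by rw [← add_mul, ← ENNReal.ofReal_add ha hb, hab, ENNReal.ofReal_one, one_mul]

end Modular

/-! ### Elements of the Bochner space paired with their gradients. -/

section BochnerPairs

variable {d : ℕ} {T : ℝ} {Ω : Set (Vec d)} {q p r s : ℝ × Vec d → ℝ}
  {u v : ℝ × Vec d → Vec d} {G H : ℝ × Vec d → Tensor d}

/-- `u ∈ 𝒰^{q,p}` with `D_x u = G`. -/
structure IsBochnerPair (T : ℝ) (Ω : Set (Vec d)) (q p : ℝ × Vec d → ℝ)
    (u : ℝ × Vec d → Vec d) (G : ℝ × Vec d → Tensor d) : Prop where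
  memVarLebesgue : MemVarLebesgue (cylinder T Ω) q u
  memVarLebesgue_grad : MemVarLebesgue (cylinder T Ω) p G
  hasWeakSymGrad : HasWeakSymGrad cylDir (cylinder T Ω) u G
  hasSmoothApprox : ∀ᵐ t ∂(volume.restrict (Set.Ioo 0 T)),
    HasSmoothApprox Ω (fun x => q (t, x)) (fun x => p (t, x)) (fun x => u (t, x))
      fun x => G (t, x)

lemma IsBochnerPair.mem_bochnerSpace (hΩo : IsOpen Ω) (hΩ : volume Ω ≠ ⊤)
    (hq : IsBddExponent (cylinder T Ω) q) (hp : IsBddExponent (cylinder T Ω) p)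
    (h : IsBochnerPair T Ω q p u G) : u ∈ bochnerSpace T Ω q p := by
  refine ⟨⟨h.1, G, h.3, h.2⟩, ?_⟩
  filter_upwards [hq.slice, hp.slice, h.1.slice hq, h.2.slice hp, h.4] with t h1 h2 h3 h4 h5
  exact h5.memSymSobolevZero hΩo hΩ h1 h2 h3 h4

/-- The approximation of a slice comes with its own gradient. Slicing the space-time gradient and
uniqueness on Ω identify it with G(t, ·) for almost every t. -/
lemma exists_isBochnerPair (hΩo : IsOpen Ω) (hΩb : Bornology.IsBounded Ω)
    (hq : IsBddExponent (cylinder T Ω) q) (hp : IsBddExponent (cylinder T Ω) p)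
    (h : u ∈ bochnerSpace T Ω q p) : ∃ G, IsBochnerPair T Ω q p u G := by
  have hΩ : volume Ω ≠ ⊤ := hΩb.measure_lt_top.ne
  have hQ : volume (cylinder T Ω) ≠ ⊤ := volume_cylinder_ne_top hΩ
  obtain ⟨⟨hu, G, hw, hG⟩, h0⟩ := h
  refine ⟨G, hu, hG, hw, ?_⟩
  filter_upwards [hq.slice, hp.slice, h0,
    hw.slice hΩo hΩb (hu.integrableOn hQ hq) (hG.integrableOn hQ hp)] with t h1 h2 h3 h4
  obtain ⟨G', h5, h6, h7⟩ := h3.exists_hasSmoothApprox hΩo hΩ h1 h2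
  have h8 := (h7.hasZeroSymGrad hΩ h1 h2 h5 h6).hasWeakSymGrad
  exact h7.congr EventuallyEq.rfl (h8.ae_unique hΩo h4)

lemma IsBochnerPair.bochnerNorm_eq (hΩo : IsOpen Ω) (h : IsBochnerPair T Ω q p u G) :
    bochnerNorm T Ω q p u = luxNorm (cylinder T Ω) q u + luxNorm (cylinder T Ω) p G :=
  symSobolevNorm_eq (isOpen_cylinder hΩo) h.3

lemma IsBochnerPair.add (hq : IsBddExponent (cylinder T Ω) q)
    (hp : IsBddExponent (cylinder T Ω) p) (hu : IsBochnerPair T Ω q p u G)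
    (hv : IsBochnerPair T Ω q p v H) : IsBochnerPair T Ω q p (u + v) (G + H) := by
  refine ⟨hu.1.add hq hv.1, hu.2.add hp hv.2, hu.3.add hv.3, ?_⟩
  filter_upwards [hq.slice, hp.slice, hu.1.slice hq, hu.2.slice hp, hu.4, hv.4]
    with t h1 h2 h3 h4 h5 h6
  exact h5.add h1 h2 h3.1 h4.1 h6

lemma IsBochnerPair.const_smul (hq : IsBddExponent (cylinder T Ω) q)
    (hp : IsBddExponent (cylinder T Ω) p) (hu : IsBochnerPair T Ω q p u G) (c : ℝ) :
    IsBochnerPair T Ω q p (c • u) (c • G) := by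
  refine ⟨hu.1.const_smul hq c, hu.2.const_smul hp c, hu.3.const_smul c, ?_⟩
  filter_upwards [hq.slice, hp.slice, hu.4] with t h1 h2 h3
  exact h3.const_smul h1 h2 c

lemma IsBochnerPair.mono_exponent (hΩ : volume Ω ≠ ⊤) (hq : IsBddExponent (cylinder T Ω) q)
    (hp : IsBddExponent (cylinder T Ω) p) (hr : IsBddExponent (cylinder T Ω) r)
    (hs : IsBddExponent (cylinder T Ω) s)
    (hrq : ∀ᵐ z ∂(volume.restrict (cylinder T Ω)), r z ≤ q z)
    (hsp : ∀ᵐ z ∂(volume.restrict (cylinder T Ω)), s z ≤ p z)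
    (hu : IsBochnerPair T Ω q p u G) : IsBochnerPair T Ω r s u G := by
  have hQ : volume (cylinder T Ω) ≠ ⊤ := volume_cylinder_ne_top hΩ
  refine ⟨hu.1.mono_exponent hQ hq hr.one_le hrq, hu.2.mono_exponent hQ hp hs.one_le hsp,
    hu.3, ?_⟩
  filter_upwards [hq.slice, hp.slice, hr.slice, hs.slice, ae_ae_of_ae_cylinder hrq,
    ae_ae_of_ae_cylinder hsp, hu.4] with t h1 h2 h3 h4 h5 h6 h7
  exact h7.mono_exponent hΩ h1 h2 h3.one_le h4.one_le h5 h6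

lemma IsBochnerPair.ae_hasZeroSymGrad (hΩ : volume Ω ≠ ⊤)
    (hq : IsBddExponent (cylinder T Ω) q) (hp : IsBddExponent (cylinder T Ω) p)
    (h : IsBochnerPair T Ω q p u G) : ∀ᵐ t ∂(volume.restrict (Set.Ioo 0 T)),
      HasZeroSymGrad Ω (fun x => u (t, x)) fun x => G (t, x) := by
  filter_upwards [hq.slice, hp.slice, h.1.slice hq, h.2.slice hp, h.4] with t h1 h2 h3 h4 h5
  exact h5.hasZeroSymGrad hΩ h1 h2 h3 h4

/-- For log-Hölder continuous exponents, membership in `𝒰^{q,p}` follows from integrability and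
vanishing traces. -/
lemma isBochnerPair_of_ae_hasZeroSymGrad (hΩo : IsOpen Ω) (hΩb : Bornology.IsBounded Ω)
    (hL : HasLipschitzBoundary Ω) (hq : IsLogExponent (cylinder T Ω) q)
    (hp : IsLogExponent (cylinder T Ω) p) (hu : MemVarLebesgue (cylinder T Ω) q u)
    (hG : MemVarLebesgue (cylinder T Ω) p G)
    (hw : HasWeakSymGrad cylDir (cylinder T Ω) u G)
    (h : ∀ᵐ t ∂(volume.restrict (Set.Ioo 0 T)),
      HasZeroSymGrad Ω (fun x => u (t, x)) fun x => G (t, x)) : IsBochnerPair T Ω q p u G := by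
  refine ⟨hu, hG, hw, ?_⟩
  filter_upwards [hq.1.slice, hp.1.slice, hu.slice hq.1, hG.slice hp.1, h,
    ae_restrict_mem measurableSet_Ioo] with t h1 h2 h3 h4 h5 ht
  exact h5.hasSmoothApprox hΩo hΩb hL h1 h2 (hq.slice ht) (hp.slice ht) h3 h4

/-- Vanishing traces of almost all time slices are preserved by convergence in `L^1`. -/
lemma ae_hasZeroSymGrad_of_tendsto {w : ℕ → ℝ × Vec d → Vec d} {K : ℕ → ℝ × Vec d → Tensor d}
    (hwi : ∀ k, IntegrableOn (w k) (cylinder T Ω)) (hKi : ∀ k, IntegrableOn (K k) (cylinder T Ω))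
    (hu : IntegrableOn u (cylinder T Ω)) (hG : IntegrableOn G (cylinder T Ω))
    (hlim : Tendsto (fun k => ∫⁻ z in cylinder T Ω, ‖w k z - u z‖ₑ) atTop (𝓝 0))
    (hlim' : Tendsto (fun k => ∫⁻ z in cylinder T Ω, ‖K k z - G z‖ₑ) atTop (𝓝 0))
    (h : ∀ k, ∀ᵐ t ∂(volume.restrict (Set.Ioo 0 T)),
      HasZeroSymGrad Ω (fun x => w k (t, x)) fun x => K k (t, x)) :
    ∀ᵐ t ∂(volume.restrict (Set.Ioo 0 T)),
      HasZeroSymGrad Ω (fun x => u (t, x)) fun x => G (t, x) := by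
  simp only [IntegrableOn, volume_restrict_cylinder] at *
  have m1 : ∀ k, AEMeasurable (fun z => ‖w k z - u z‖ₑ)
      ((volume.restrict (Set.Ioo 0 T)).prod (volume.restrict Ω)) :=
    fun k => ((hwi k).1.sub hu.1).enorm
  have m2 : ∀ k, AEMeasurable (fun z => ‖K k z - G z‖ₑ)
      ((volume.restrict (Set.Ioo 0 T)).prod (volume.restrict Ω)) :=
    fun k => ((hKi k).1.sub hG.1).enorm
  have m3 := fun k => (m1 k).lintegral_prod_right'
  have m4 := fun k => (m2 k).lintegral_prod_right'
  have l1 := hlim.add hlim'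
  rw [add_zero] at l1
  -- By Tonelli the L^1(Ω) distances of the slices tend to 0 in L^1(0, T), so along a subsequence
  -- they tend to 0 for almost every t.
  obtain ⟨σ, hσ, h1⟩ := exists_strictMono_ae_tendsto_zero (fun k => (m3 k).add (m4 k))
    (l1.congr fun k => by
      rw [lintegral_prod _ (m1 k), lintegral_prod _ (m2 k), ← lintegral_add_left' (m3 k)]
      rfl)
  filter_upwards [h1, ae_all_iff.2 h, hu.prod_right_ae, hG.prod_right_ae] with t h1 h2 h3 h4
  refine HasZeroSymGrad.of_tendsto (l := atTop) (fun k => h2 (σ k)) h3 h4 ?_ ?_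
  · exact tendsto_of_tendsto_of_tendsto_of_le_of_le tendsto_const_nhds h1 (fun _ => zero_le)
      fun k => le_self_add
  · exact tendsto_of_tendsto_of_tendsto_of_le_of_le tendsto_const_nhds h1 (fun _ => zero_le)
      fun k => le_add_self

end BochnerPairs


/-- A sequence that is bounded in `L^a`, `a > 1`, has a subsequence with a weak limit, which lies
in the `L^1` closure of every convex set that is frequently visited by the subsequence. -/
theorem exists_subseq_mem_closure_convex {α F : Type*} [MeasurableSpace α]
    [MeasurableSpace.CountablyGenerated α]
    [NormedAddCommGroup F] [InnerProductSpace ℝ F] [FiniteDimensional ℝ F]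
    {μ : Measure α} [IsFiniteMeasure μ] {f : ℕ → α → F} {a : ℝ} {C : ℝ≥0∞}
    (hf : ∀ k, AEStronglyMeasurable (f k) μ) (ha : 1 < a) (hC : C ≠ ⊤)
    (hfC : ∀ k, ∫⁻ z, ‖f k z‖ₑ ^ a ∂μ ≤ C) :
    ∃ κ : ℕ → ℕ, StrictMono κ ∧ ∃ g, Integrable g μ ∧ ∀ S : Set (α → F), Convex ℝ S →
      (∃ᶠ k in atTop, f (κ k) ∈ S) → ∃ v : ℕ → α → F, (∀ n, v n ∈ S) ∧
        Tendsto (fun n => ∫⁻ z, ‖v n z - g z‖ₑ ∂μ) atTop (𝓝 0) := by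
  obtain ⟨κ, hκ, g, hg, h⟩ := exists_subseq_forwardWeights_tendsto_lintegral hf ha hC hfC
  refine ⟨κ, hκ, g, hg, fun S hS hfreq => ?_⟩
  obtain ⟨σ, hσ, hmem⟩ := extraction_of_frequently_atTop hfreq
  obtain ⟨w, hw, hlim⟩ := h σ hσ
  exact ⟨_, fun n => linearCombination_mem_of_convex (hw n) hS fun k _ => hmem k, hlim⟩

/-! ### A field and its gradient as one Hilbert-space valued function. -/

section PairFields

variable {d : ℕ} {T : ℝ} {Ω : Set (Vec d)} {q p r s : ℝ × Vec d → ℝ}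

lemma Convex.preimage_fst {X E E' : Type*} [NormedAddCommGroup E] [NormedAddCommGroup E']
    [NormedSpace ℝ E] [NormedSpace ℝ E'] {S : Set (X → E)} (hS : Convex ℝ S) :
    Convex ℝ {f : X → WithLp 2 (E × E') | (fun z => (f z).fst) ∈ S} :=
  fun _ hf _ hg _ _ ha hb hab => hS hf hg ha hb hab

lemma Convex.preimage_snd {X E E' : Type*} [NormedAddCommGroup E] [NormedAddCommGroup E']
    [NormedSpace ℝ E] [NormedSpace ℝ E'] {S : Set (X → E')} (hS : Convex ℝ S) :
    Convex ℝ {f : X → WithLp 2 (E × E') | (fun z => (f z).snd) ∈ S} :=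
  fun _ hf _ hg _ _ ha hb hab => hS hf hg ha hb hab

lemma convex_isBochnerPair (hq : IsBddExponent (cylinder T Ω) q)
    (hp : IsBddExponent (cylinder T Ω) p) :
    Convex ℝ {f : ℝ × Vec d → WithLp 2 (Vec d × Tensor d) |
      IsBochnerPair T Ω q p (fun z => (f z).fst) fun z => (f z).snd} :=
  fun _ hf _ hg a b _ _ _ => (hf.const_smul hq hp a).add hq hp (hg.const_smul hq hp b)

end PairFields

/-! ### Exponents strictly below the limit exponent. -/

section Exponents

variable {X : Type*} [MeasureSpace X] {F : Type*} [NormedAddCommGroup F] [NormedSpace ℝ F]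
  {M : Set X} {q r : X → ℝ} {u : X → F}

lemma IsBddExponent.add_const (hr : IsBddExponent M r) {ε : ℝ} (hε : 0 ≤ ε) :
    IsBddExponent M fun z => r z + ε := by
  obtain ⟨b, hb⟩ := hr.bdd
  refine ⟨hr.aemeasurable.add_const ε, ?_, b + ε, ?_⟩
  · filter_upwards [hr.one_le] with z hz
    linarith
  · filter_upwards [hb] with z hz
    linarith

lemma IsBddExponent.exists_one_lt_le (hq : IsBddExponent M q)
    (h : 1 < essInf q (volume.restrict M)) :
    ∃ a : ℝ, 1 < a ∧ ∀ᵐ z ∂(volume.restrict M), a ≤ q z := by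
  obtain ⟨a, h1, h2⟩ := exists_between h
  refine ⟨a, h1, ?_⟩
  -- The real-valued essential infimum is meaningful only for functions bounded below; here q ≥ 1
  -- provides the bound.
  have h3 : IsBoundedUnder (· ≥ ·) (ae (volume.restrict M)) q := ⟨1, by simpa using hq.one_le⟩
  filter_upwards [eventually_lt_of_lt_liminf h2 h3] with z hz
  exact hz.le

lemma eventually_ae_abs_sub_le {qn : ℕ → X → ℝ}
    (h : Tendsto (fun n => eLpNorm (qn n - q) ⊤ (volume.restrict M)) atTop (𝓝 0)) {δ : ℝ}
    (hδ : 0 < δ) : ∀ᶠ n in atTop, ∀ᵐ z ∂(volume.restrict M), |qn n z - q z| ≤ δ := by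
  filter_upwards [h.eventually (ge_mem_nhds (ENNReal.ofReal_pos.2 hδ))] with n hn
  rw [eLpNorm_exponent_top] at hn
  filter_upwards [ae_le_eLpNormEssSup (f := qn n - q) (μ := volume.restrict M)] with z hz
  have h1 := hz.trans hn
  rw [Pi.sub_apply, Real.enorm_eq_ofReal_abs, ENNReal.ofReal_le_ofReal_iff hδ.le] at h1
  exact h1

/-- Uniform modular bounds for exponents strictly below the limit exponent. -/
lemma exists_modular_bound (hM : volume M ≠ ⊤) (hq : IsBddExponent M q) {qn : ℕ → X → ℝ}
    (hqn : ∀ n, IsBddExponent M (qn n))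
    (h : Tendsto (fun n => eLpNorm (qn n - q) ⊤ (volume.restrict M)) atTop (𝓝 0))
    {un : ℕ → X → F} (hu : ∀ n, MemVarLebesgue M (qn n) (un n)) {K : ℝ}
    (hK : ∀ n, luxNorm M (qn n) (un n) ≤ K) :
    ∃ C : ℝ≥0∞, C ≠ ⊤ ∧ ∀ r : X → ℝ, (∀ᵐ z ∂(volume.restrict M), 1 ≤ r z) →
      StrictlyBelow M r q → ∀ᶠ n in atTop, modular M r (un n) ≤ C := by
  obtain ⟨b, hb⟩ := hq.bdd
  set B := max (b + 1) 0
  have hB0 : 0 ≤ B := le_max_right _ _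
  -- Eventually q_n ≤ q + 1 ≤ B. The constant does not involve r; only the index from which the
  -- bound holds does. This allows r to increase to q later.
  refine ⟨volume M + ENNReal.ofReal (1 + 1) * ENNReal.ofReal ((K + 1) ^ B), ?_, ?_⟩
  · exact ENNReal.add_ne_top.2 ⟨hM, ENNReal.mul_ne_top ENNReal.ofReal_ne_top
      ENNReal.ofReal_ne_top⟩
  rintro r hr ⟨ε, hε, hrq⟩
  filter_upwards [eventually_ae_abs_sub_le h hε, eventually_ae_abs_sub_le h one_pos]
    with n h1 h2
  have h3 : ∀ᵐ z ∂(volume.restrict M), r z ≤ qn n z := by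
    filter_upwards [h1, hrq] with z h4 h5
    linarith [(abs_le.1 h4).1]
  have h4 : ∀ᵐ z ∂(volume.restrict M), qn n z ≤ B := by
    filter_upwards [h2, hb] with z h5 h6
    exact le_trans (by linarith [(abs_le.1 h5).2]) (le_max_left _ _)
  have h5 := modular_le_of_luxNorm_le (hqn n) h4 hB0 (hu n) (hK n)
  have h6 := modular_le_of_exponent_le hr h3 h4 one_pos le_rfl (un n)
  rw [inv_one, Real.one_rpow, ENNReal.ofReal_one, one_mul] at h6
  exact h6.trans (by gcongr)

/-- If `u` lies in the `L^1` closure of all sets of functions that satisfy a uniform modular bound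
with exponent strictly below `q`, then the bound holds for the exponent `q`. -/
lemma modular_le_of_forall_strictlyBelow (hq : IsBddExponent M q) {a : ℝ} (ha : 1 < a)
    (haq : ∀ᵐ z ∂(volume.restrict M), a ≤ q z) (hu : AEStronglyMeasurable u (volume.restrict M))
    {C : ℝ≥0∞} (h : ∀ r : X → ℝ, AEMeasurable r (volume.restrict M) →
      (∀ᵐ z ∂(volume.restrict M), 1 ≤ r z) → StrictlyBelow M r q →
      ∃ v : ℕ → X → F, (∀ n, AEStronglyMeasurable (v n) (volume.restrict M) ∧
        modular M r (v n) ≤ C) ∧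
        Tendsto (fun n => ∫⁻ z in M, ‖v n z - u z‖ₑ) atTop (𝓝 0)) : modular M q u ≤ C := by
  -- The numerator a - 1 keeps q - δ_k ≥ 1. For fixed k the bound passes to `u` by L^1 convergence;
  -- then Fatou's lemma with `u` fixed and varying exponent lets k tend to infinity.
  set δ : ℕ → ℝ := fun k => (a - 1) / ((k : ℝ) + 1)
  have hδ0 : ∀ k, 0 < δ k := fun k => div_pos (by linarith) (by positivity)
  have hδ1 : ∀ k, δ k ≤ a - 1 := fun k =>
    div_le_self (by linarith) (by linarith [(k.cast_nonneg : (0 : ℝ) ≤ k)])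
  have hδ : Tendsto δ atTop (𝓝 0) := by
    have := (tendsto_one_div_add_atTop_nhds_zero_nat (𝕜 := ℝ)).const_mul (a - 1)
    rw [mul_zero] at this
    refine this.congr fun k => ?_
    simp only [δ]; ring
  have hr1 : ∀ k, ∀ᵐ z ∂(volume.restrict M), 1 ≤ q z - δ k := fun k => by
    filter_upwards [haq] with z hz
    linarith [hδ1 k]
  refine modular_le_of_ae_tendsto (rk := fun k z => q z - δ k) (v := fun _ => u) ?_
    (fun k => hq.aemeasurable.sub_const _) (fun _ => hu) ?_
    (ae_of_all _ fun _ => tendsto_const_nhds) fun k => ?_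
  · filter_upwards [haq] with z hz
    linarith
  · refine ae_of_all _ fun z => ?_
    simpa using hδ.const_sub (q z)
  · obtain ⟨v, hv, hlim⟩ := h (fun z => q z - δ k) (hq.aemeasurable.sub_const _) (hr1 k)
      ⟨δ k, hδ0 k, by simp⟩
    refine modular_le_of_tendsto_lintegral ?_ (hq.aemeasurable.sub_const _) (fun n => (hv n).1)
      hu hlim fun n => (hv n).2
    filter_upwards [hr1 k] with z hz
    linarith

end Exponents


/-! ### From L^1 convergence to convergence in norm. -/

section LuxNorm

variable {X : Type*} [MeasureSpace X] {F : Type*} [NormedAddCommGroup F] [NormedSpace ℝ F]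
  {M : Set X} {r : X → ℝ} {u : X → F} {v : ℕ → X → F}

/-- Convergence in `L^1` and a modular bound for a strictly larger exponent give convergence in
the Luxembourg norm. -/
lemma tendsto_luxNorm_sub (hr : IsBddExponent M r) {ε : ℝ} (hε : 0 < ε)
    (hv : ∀ n, AEStronglyMeasurable (v n) (volume.restrict M)) {C : ℝ≥0∞} (hC : C ≠ ⊤)
    (hvC : ∀ n, modular M (fun z => r z + ε) (v n) ≤ C)
    (hu : MemVarLebesgue M (fun z => r z + ε) u)
    (hlim : Tendsto (fun n => ∫⁻ z in M, ‖v n z - u z‖ₑ) atTop (𝓝 0)) :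
    Tendsto (fun n => luxNorm M r (v n - u)) atTop (𝓝 0) := by
  have hrε := hr.add_const hε.le
  obtain ⟨b, hb⟩ := hrε.bdd
  refine tendsto_luxNorm_of_tendsto_modular hr (tendsto_modular_of_tendsto_lintegral hε hr
    (fun n => (hv n).sub hu.1) hlim (C := ENNReal.ofReal (2 ^ b) *
      (C + modular M (fun z => r z + ε) ((-1 : ℝ) • u))) ?_ (Eventually.of_forall fun n => ?_))
  · exact ENNReal.mul_ne_top ENNReal.ofReal_ne_top
      (ENNReal.add_ne_top.2 ⟨hC, (hu.const_smul hrε (-1)).2.ne⟩)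
  · have h1 : v n - u = v n + (-1 : ℝ) • u := by simp [sub_eq_add_neg]
    rw [h1]
    refine (modular_add_le hrε hb (hv n)).trans ?_
    gcongr
    exact hvC n

end LuxNorm

/-! ### Membership of the limit, and convergence of functionals. -/

section Limits

variable {d : ℕ} {T : ℝ} {Ω : Set (Vec d)} {q p r s : ℝ × Vec d → ℝ}
  {f : ℕ → ℝ × Vec d → WithLp 2 (Vec d × Tensor d)} {g : ℝ × Vec d → WithLp 2 (Vec d × Tensor d)}

lemma tendsto_lintegral_fst_sub {X E E' : Type*} [MeasurableSpace X] {μ : Measure X}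
    [NormedAddCommGroup E] [NormedAddCommGroup E'] {v : ℕ → X → WithLp 2 (E × E')}
    {g : X → WithLp 2 (E × E')}
    (h : Tendsto (fun n => ∫⁻ z, ‖v n z - g z‖ₑ ∂μ) atTop (𝓝 0)) :
    Tendsto (fun n => ∫⁻ z, ‖(v n z).fst - (g z).fst‖ₑ ∂μ) atTop (𝓝 0) :=
  tendsto_of_tendsto_of_tendsto_of_le_of_le tendsto_const_nhds h (fun _ => zero_le)
    fun n => lintegral_mono fun z => WithLp.enorm_fst_le _ (v n z - g z)

lemma tendsto_lintegral_snd_sub {X E E' : Type*} [MeasurableSpace X] {μ : Measure X}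
    [NormedAddCommGroup E] [NormedAddCommGroup E'] {v : ℕ → X → WithLp 2 (E × E')}
    {g : X → WithLp 2 (E × E')}
    (h : Tendsto (fun n => ∫⁻ z, ‖v n z - g z‖ₑ ∂μ) atTop (𝓝 0)) :
    Tendsto (fun n => ∫⁻ z, ‖(v n z).snd - (g z).snd‖ₑ ∂μ) atTop (𝓝 0) :=
  tendsto_of_tendsto_of_tendsto_of_le_of_le tendsto_const_nhds h (fun _ => zero_le)
    fun n => lintegral_mono fun z => WithLp.enorm_snd_le _ (v n z - g z)

lemma integrable_fst {X E E' : Type*} [MeasurableSpace X] {μ : Measure X}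
    [NormedAddCommGroup E] [NormedAddCommGroup E'] {g : X → WithLp 2 (E × E')}
    (hg : Integrable g μ) : Integrable (fun z => (g z).fst) μ :=
  hg.mono ((WithLp.continuous_fst 2 E E').comp_aestronglyMeasurable hg.1)
    (ae_of_all _ fun z => WithLp.norm_fst_le _ (g z))

lemma integrable_snd {X E E' : Type*} [MeasurableSpace X] {μ : Measure X}
    [NormedAddCommGroup E] [NormedAddCommGroup E'] {g : X → WithLp 2 (E × E')}
    (hg : Integrable g μ) : Integrable (fun z => (g z).snd) μ :=
  hg.mono ((WithLp.continuous_snd 2 E E').comp_aestronglyMeasurable hg.1)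
    (ae_of_all _ fun z => WithLp.norm_snd_le _ (g z))

/-- Integrable pairs `(u, D_x u)` on the cylinder whose time slices have vanishing traces. -/
def zeroTracePairs (T : ℝ) (Ω : Set (Vec d)) : Set (ℝ × Vec d → WithLp 2 (Vec d × Tensor d)) :=
  {f | HasWeakSymGrad cylDir (cylinder T Ω) (fun z => (f z).fst) (fun z => (f z).snd) ∧
    IntegrableOn (fun z => (f z).fst) (cylinder T Ω) ∧
    IntegrableOn (fun z => (f z).snd) (cylinder T Ω) ∧
    ∀ᵐ t ∂(volume.restrict (Set.Ioo 0 T)),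
      HasZeroSymGrad Ω (fun x => (f (t, x)).fst) fun x => (f (t, x)).snd}

lemma convex_zeroTracePairs (hΩ : MeasurableSet Ω) : Convex ℝ (zeroTracePairs T Ω) := by
  rintro f ⟨h1, h2, h3, h4⟩ g ⟨k1, k2, k3, k4⟩ a b - - -
  refine ⟨(h1.const_smul a).add (k1.const_smul b), (h2.smul a).add (k2.smul b),
    (h3.smul a).add (k3.smul b), ?_⟩
  filter_upwards [h4, k4] with t h5 k5
  exact (h5.const_smul hΩ a).add hΩ (k5.const_smul hΩ b)

/-- Three convex sets are inserted into the closure property: modular balls for `u`, modular balls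
for its gradient, and `zeroTracePairs`. Smooth approximability is not passed to the limit; it is
recovered at the end from vanishing traces and log-Hölder continuity. -/
lemma isBochnerPair_of_forall_convex (hΩo : IsOpen Ω) (hΩb : Bornology.IsBounded Ω)
    (hL : HasLipschitzBoundary Ω) (hq : IsLogExponent (cylinder T Ω) q)
    (hp : IsLogExponent (cylinder T Ω) p) {a : ℝ} (ha : 1 < a)
    (haq : ∀ᵐ z ∂(volume.restrict (cylinder T Ω)), a ≤ q z)
    (hap : ∀ᵐ z ∂(volume.restrict (cylinder T Ω)), a ≤ p z)
    (hf : ∀ k, f k ∈ zeroTracePairs T Ω) (hg : IntegrableOn g (cylinder T Ω))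
    (hfg : ∀ S : Set (ℝ × Vec d → WithLp 2 (Vec d × Tensor d)), Convex ℝ S →
      (∃ᶠ k in atTop, f k ∈ S) → ∃ v : ℕ → ℝ × Vec d → WithLp 2 (Vec d × Tensor d),
        (∀ n, v n ∈ S) ∧
          Tendsto (fun n => ∫⁻ z in cylinder T Ω, ‖v n z - g z‖ₑ) atTop (𝓝 0))
    {C C' : ℝ≥0∞} (hC : C ≠ ⊤) (hC' : C' ≠ ⊤)
    (hbq : ∀ r, (∀ᵐ z ∂(volume.restrict (cylinder T Ω)), 1 ≤ r z) →
      StrictlyBelow (cylinder T Ω) r q →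
      ∀ᶠ k in atTop, modular (cylinder T Ω) r (fun z => (f k z).fst) ≤ C)
    (hbp : ∀ r, (∀ᵐ z ∂(volume.restrict (cylinder T Ω)), 1 ≤ r z) →
      StrictlyBelow (cylinder T Ω) r p →
      ∀ᶠ k in atTop, modular (cylinder T Ω) r (fun z => (f k z).snd) ≤ C') :
    IsBochnerPair T Ω q p (fun z => (g z).fst) fun z => (g z).snd := by
  have g1 : IntegrableOn (fun z => (g z).fst) (cylinder T Ω) := integrable_fst hg
  have g2 : IntegrableOn (fun z => (g z).snd) (cylinder T Ω) := integrable_snd hg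
  have hu : MemVarLebesgue (cylinder T Ω) q (fun z => (g z).fst) := by
    refine ⟨g1.1, (modular_le_of_forall_strictlyBelow hq.1 ha haq g1.1
      fun r hrm hr hrq => ?_).trans_lt hC.lt_top⟩
    obtain ⟨v, hv, hlim⟩ := hfg _ (Convex.preimage_fst (convex_modular_le hrm hr C))
      ((hbq r hr hrq).mono fun k hk => ⟨(hf k).2.1.1, hk⟩).frequently
    exact ⟨_, hv, tendsto_lintegral_fst_sub hlim⟩
  have hG : MemVarLebesgue (cylinder T Ω) p (fun z => (g z).snd) := by
    refine ⟨g2.1, (modular_le_of_forall_strictlyBelow hp.1 ha hap g2.1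
      fun r hrm hr hrp => ?_).trans_lt hC'.lt_top⟩
    obtain ⟨v, hv, hlim⟩ := hfg _ (Convex.preimage_snd (convex_modular_le hrm hr C'))
      ((hbp r hr hrp).mono fun k hk => ⟨(hf k).2.2.1.1, hk⟩).frequently
    exact ⟨_, hv, tendsto_lintegral_snd_sub hlim⟩
  obtain ⟨v, hv, hlim⟩ := hfg _ (convex_zeroTracePairs hΩo.measurableSet)
    (Eventually.of_forall hf).frequently
  have l1 := tendsto_lintegral_fst_sub hlim
  have l2 := tendsto_lintegral_snd_sub hlim
  refine isBochnerPair_of_ae_hasZeroSymGrad hΩo hΩb hL hq hp hu hG ?_ ?_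
  · exact HasWeakSymGrad.of_tendsto (fun k => (hv k).1) (fun k => (hv k).2.1)
      (fun k => (hv k).2.2.1) g1 g2 l1 l2
  · exact ae_hasZeroSymGrad_of_tendsto (fun k => (hv k).2.1) (fun k => (hv k).2.2.1) g1 g2 l1 l2
      fun k => (hv k).2.2.2

/-- A Mazur argument by contradiction: pairs with ℓ ≥ a form a convex set, and if they recur
infinitely often the limit inherits ℓ ≥ a. -/
lemma eventually_lt_of_isBoundedLinearOn (hΩo : IsOpen Ω) (hΩ : volume Ω ≠ ⊤)
    (hr : IsBddExponent (cylinder T Ω) r) (hs : IsBddExponent (cylinder T Ω) s)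
    {ε : ℝ} (hε : 0 < ε)
    (hf : ∀ᶠ k in atTop, IsBochnerPair T Ω r s (fun z => (f k z).fst) fun z => (f k z).snd)
    (hg : IsBochnerPair T Ω (fun z => r z + ε) (fun z => s z + ε)
      (fun z => (g z).fst) fun z => (g z).snd)
    (hfg : ∀ S : Set (ℝ × Vec d → WithLp 2 (Vec d × Tensor d)), Convex ℝ S →
      (∃ᶠ k in atTop, f k ∈ S) → ∃ v : ℕ → ℝ × Vec d → WithLp 2 (Vec d × Tensor d),
        (∀ n, v n ∈ S) ∧
          Tendsto (fun n => ∫⁻ z in cylinder T Ω, ‖v n z - g z‖ₑ) atTop (𝓝 0))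
    {C C' : ℝ≥0∞} (hC : C ≠ ⊤) (hC' : C' ≠ ⊤)
    (hbq : ∀ᶠ k in atTop,
      modular (cylinder T Ω) (fun z => r z + ε) (fun z => (f k z).fst) ≤ C)
    (hbp : ∀ᶠ k in atTop,
      modular (cylinder T Ω) (fun z => s z + ε) (fun z => (f k z).snd) ≤ C')
    {ℓ : (ℝ × Vec d → Vec d) → ℝ}
    (hℓ : IsBoundedLinearOn (bochnerSpace T Ω r s) (bochnerNorm T Ω r s) ℓ) {a : ℝ}
    (ha : ℓ (fun z => (g z).fst) < a) : ∀ᶠ k in atTop, ℓ (fun z => (f k z).fst) < a := by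
  by_contra hcon
  rw [not_eventually] at hcon
  have hrε := hr.add_const hε.le
  have hsε := hs.add_const hε.le
  have hS : Convex ℝ {w : ℝ × Vec d → WithLp 2 (Vec d × Tensor d) |
      IsBochnerPair T Ω r s (fun z => (w z).fst) (fun z => (w z).snd) ∧
        a ≤ ℓ (fun z => (w z).fst)} := by
    rintro w ⟨h1, h2⟩ w' ⟨h1', h2'⟩ α β hα hβ hαβ
    refine ⟨convex_isBochnerPair hr hs h1 h1' hα hβ hαβ, ?_⟩
    have m1 := h1.mem_bochnerSpace hΩo hΩ hr hs
    have m2 := h1'.mem_bochnerSpace hΩo hΩ hr hs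
    have m3 := (h1.const_smul hr hs α).mem_bochnerSpace hΩo hΩ hr hs
    have m4 := (h1'.const_smul hr hs β).mem_bochnerSpace hΩo hΩ hr hs
    have e1 := hℓ.map_add _ m3 _ m4
    rw [hℓ.map_smul _ _ m1, hℓ.map_smul _ _ m2] at e1
    refine le_of_le_of_eq ?_ e1.symm
    calc a = α * a + β * a := by rw [← add_mul, hαβ, one_mul]
      _ ≤ _ := by gcongr
  -- The functional is continuous for the 𝒰^{r,s} norm and not for L^1. The extra modular bounds for
  -- r + ε and s + ε upgrade the L^1 convergence to convergence in that norm.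
  obtain ⟨v, hv, hlim⟩ := hfg _ ((hS.inter (Convex.preimage_fst
    (convex_modular_le hrε.aemeasurable hrε.one_le C))).inter (Convex.preimage_snd
    (convex_modular_le hsε.aemeasurable hsε.one_le C')))
    ((hcon.and_eventually (hf.and (hbq.and hbp))).mono fun k hk =>
      ⟨⟨⟨hk.2.1, not_lt.1 hk.1⟩, hk.2.1.1.1, hk.2.2.1⟩, hk.2.1.2.1, hk.2.2.2⟩)
  have hg' : IsBochnerPair T Ω r s (fun z => (g z).fst) fun z => (g z).snd :=
    hg.mono_exponent hΩ hrε hsε hr hs (ae_of_all _ fun z => by linarith)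
      (ae_of_all _ fun z => by linarith)
  have t1 := tendsto_luxNorm_sub hr hε (fun n => (hv n).1.2.1) hC (fun n => (hv n).1.2.2) hg.1
    (tendsto_lintegral_fst_sub hlim)
  have t2 := tendsto_luxNorm_sub hs hε (fun n => (hv n).2.1) hC' (fun n => (hv n).2.2) hg.2
    (tendsto_lintegral_snd_sub hlim)
  obtain ⟨B, hB⟩ := hℓ.bound
  have t3 := ((t1.add t2).const_mul B).add_const (ℓ fun z => (g z).fst)
  rw [add_zero, mul_zero, zero_add] at t3
  refine absurd (ge_of_tendsto' t3 fun n => ?_) (not_le.2 ha)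
  have hd : IsBochnerPair T Ω r s ((fun z => (v n z).fst) - fun z => (g z).fst)
      ((fun z => (v n z).snd) - fun z => (g z).snd) := by
    have := (hv n).1.1.1.add hr hs (hg'.const_smul hr hs (-1))
    simpa only [neg_smul, one_smul, ← sub_eq_add_neg] using this
  have hdm := hd.mem_bochnerSpace hΩo hΩ hr hs
  have e1 := hℓ.map_add _ hdm _ (hg'.mem_bochnerSpace hΩo hΩ hr hs)
  rw [sub_add_cancel] at e1
  have e2 := hB _ hdm
  rw [hd.bochnerNorm_eq hΩo] at e2
  linarith [(hv n).1.1.2, le_abs_self (ℓ ((fun z => (v n z).fst) - fun z => (g z).fst))]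

end Limits


/-! ### Assembly of the compactness theorem. -/

lemma StrictlyBelow.add_const {X : Type*} [MeasureSpace X] {M : Set X} {r q : X → ℝ} {ε δ : ℝ}
    (h : ∀ᵐ z ∂(volume.restrict M), r z + ε ≤ q z) (hδ : δ < ε) :
    StrictlyBelow M (fun z => r z + δ) q := by
  refine ⟨ε - δ, sub_pos.2 hδ, ?_⟩
  filter_upwards [h] with z hz
  linarith

/-- Split the pair as (u, 0) + (0, G), whose summands have the norms of `u` and `G`. -/
lemma lintegral_toLp_rpow_le {X E E' : Type*} [MeasureSpace X] {M : Set X}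
    [NormedAddCommGroup E] [NormedSpace ℝ E] [NormedAddCommGroup E'] [NormedSpace ℝ E']
    {u : X → E} {G : X → E'} {a : ℝ} (ha : 1 ≤ a) (hu : AEStronglyMeasurable u (volume.restrict M)) :
    ∫⁻ z in M, ‖WithLp.toLp 2 (u z, G z)‖ₑ ^ a
      ≤ ENNReal.ofReal (2 ^ a) * (modular M (fun _ => a) u + modular M (fun _ => a) G) := by
  have hc : ∀ᵐ z ∂(volume.restrict M), (1 : ℝ) ≤ a := ae_of_all _ fun _ => ha
  have hb : IsBddExponent M fun _ => a := ⟨aemeasurable_const, hc, a, by simp⟩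
  have hm : AEStronglyMeasurable (fun z => WithLp.toLp 2 (u z, (0 : E'))) (volume.restrict M) :=
    (WithLp.prod_continuous_toLp 2 E E').comp_aestronglyMeasurable
      (hu.prodMk aestronglyMeasurable_const)
  have h1 := modular_add_le hb (ae_of_all _ fun _ => le_refl a) hm
    (v := fun z => WithLp.toLp 2 ((0 : E), G z))
  rw [modular_eq_lintegral hc] at h1
  refine le_trans (le_of_eq (lintegral_congr fun z => ?_)) (h1.trans_eq ?_)
  · rw [Pi.add_apply, ← WithLp.toLp_add, Prod.mk_add_mk, add_zero, zero_add]
  · simp only [modular, WithLp.norm_toLp_fst, WithLp.norm_toLp_snd]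

/-- Weak compactness in variable Bochner-Lebesgue spaces along converging exponents. -/
theorem exists_subseq_weaklyTendstoIn {d : ℕ} {T : ℝ}
    {Ω : Set (Vec d)} (hΩ : IsSimplicialLipschitzDomain Ω)
    {q p : ℝ × Vec d → ℝ}
    (hq : IsLogExponent (cylinder T Ω) q)
    (hp : IsLogExponent (cylinder T Ω) p)
    (hq1 : 1 < essInf q (volume.restrict (cylinder T Ω)))
    (hp1 : 1 < essInf p (volume.restrict (cylinder T Ω)))
    {qn pn : ℕ → ℝ × Vec d → ℝ}
    (hqn : ∀ n, IsBddExponent (cylinder T Ω) (qn n))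
    (hpn : ∀ n, IsBddExponent (cylinder T Ω) (pn n))
    (hqn_lim : Tendsto
      (fun n => eLpNorm (qn n - q) ⊤ (volume.restrict (cylinder T Ω))) atTop (𝓝 0))
    (hpn_lim : Tendsto
      (fun n => eLpNorm (pn n - p) ⊤ (volume.restrict (cylinder T Ω))) atTop (𝓝 0))
    {un : ℕ → ℝ × Vec d → Vec d}
    (hun : ∀ n, un n ∈ bochnerSpace T Ω (qn n) (pn n))
    (hbdd : BddAbove (Set.range fun n => bochnerNorm T Ω (qn n) (pn n) (un n))) :
    ∃ κ : ℕ → ℕ, StrictMono κ ∧ ∃ u ∈ bochnerSpace T Ω q p,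
      ∀ r s : ℝ × Vec d → ℝ,
        IsBddExponent (cylinder T Ω) r →
        IsBddExponent (cylinder T Ω) s →
        StrictlyBelow (cylinder T Ω) r q →
        StrictlyBelow (cylinder T Ω) s p →
          WeaklyTendstoIn (bochnerSpace T Ω r s)
            (bochnerNorm T Ω r s) (fun k => un (κ k)) u := by
  have hΩo := hΩ.isOpen
  have hΩb := hΩ.isBounded
  have hΩv : volume Ω ≠ ⊤ := hΩb.measure_lt_top.ne
  have hQ : volume (cylinder T Ω) ≠ ⊤ := volume_cylinder_ne_top hΩv
  have : IsFiniteMeasure (volume.restrict (cylinder T Ω)) := ⟨by simpa using hQ.lt_top⟩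
  choose G hG using fun n => exists_isBochnerPair hΩo hΩb (hqn n) (hpn n) (hun n)
  obtain ⟨K, hK⟩ := hbdd
  have hK' : ∀ n, luxNorm (cylinder T Ω) (qn n) (un n)
      + luxNorm (cylinder T Ω) (pn n) (G n) ≤ K := fun n => by
    rw [← (hG n).bochnerNorm_eq hΩo]
    exact hK ⟨n, rfl⟩
  obtain ⟨C, hC, hbq⟩ := exists_modular_bound hQ hq.1 hqn hqn_lim (fun n => (hG n).1)
    (K := K) fun n => by linarith [hK' n, luxNorm_nonneg (cylinder T Ω) (pn n) (G n)]
  obtain ⟨C', hC', hbp⟩ := exists_modular_bound hQ hp.1 hpn hpn_lim (fun n => (hG n).2)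
    (K := K) fun n => by linarith [hK' n, luxNorm_nonneg (cylinder T Ω) (qn n) (un n)]
  obtain ⟨a, ha, haq, hap⟩ : ∃ a : ℝ, 1 < a ∧
      (∀ᵐ z ∂(volume.restrict (cylinder T Ω)), a ≤ q z) ∧
      ∀ᵐ z ∂(volume.restrict (cylinder T Ω)), a ≤ p z := by
    obtain ⟨a₁, h1, h2⟩ := hq.1.exists_one_lt_le hq1
    obtain ⟨a₂, h3, h4⟩ := hp.1.exists_one_lt_le hp1
    exact ⟨min a₁ a₂, lt_min h1 h3, h2.mono fun z hz => (min_le_left _ _).trans hz,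
      h4.mono fun z hz => (min_le_right _ _).trans hz⟩
  -- The constant exponent a' is strictly below both q and p, so the uniform modular bounds apply to
  -- it and give reflexive-type control in L^{a'}.
  obtain ⟨a', ha', haa'⟩ := exists_between ha
  have hbelow : ∀ {m : ℝ × Vec d → ℝ}, (∀ᵐ z ∂(volume.restrict (cylinder T Ω)), a ≤ m z) →
      StrictlyBelow (cylinder T Ω) (fun _ => a') m := fun h =>
    ⟨a - a', sub_pos.2 haa', h.mono fun z hz => by linarith⟩
  -- The L^{a'} bounds hold only from some index N on, so the compactness result is applied to the
  -- shifted sequence.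
  obtain ⟨N, hN⟩ := eventually_atTop.1
    ((hbq _ (ae_of_all _ fun _ => ha'.le) (hbelow haq)).and
      (hbp _ (ae_of_all _ fun _ => ha'.le) (hbelow hap)))
  let f : ℕ → ℝ × Vec d → WithLp 2 (Vec d × Tensor d) :=
    fun n z => WithLp.toLp 2 (un n z, G n z)
  obtain ⟨κ, hκ, g, hg, hfg⟩ := exists_subseq_mem_closure_convex
    (μ := volume.restrict (cylinder T Ω)) (f := fun n => f (n + N)) (a := a')
    (C := ENNReal.ofReal (2 ^ a') * (C + C'))
    (fun n => (WithLp.prod_continuous_toLp 2 _ _).comp_aestronglyMeasurable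
      ((hG (n + N)).1.1.prodMk (hG (n + N)).2.1)) ha'
    (ENNReal.mul_ne_top ENNReal.ofReal_ne_top (ENNReal.add_ne_top.2 ⟨hC, hC'⟩))
    fun n => (lintegral_toLp_rpow_le ha'.le (hG (n + N)).1.1).trans (by
      gcongr
      · exact (hN (n + N) (Nat.le_add_left _ _)).1
      · exact (hN (n + N) (Nat.le_add_left _ _)).2)
  have hκN : StrictMono fun k => κ k + N := hκ.add_const N
  have hκt := hκN.tendsto_atTop
  have hgpair : IsBochnerPair T Ω q p (fun z => (g z).fst) fun z => (g z).snd :=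
    isBochnerPair_of_forall_convex (f := fun k => f (κ k + N)) hΩo hΩb hΩ.lipschitz hq hp ha
      haq hap (fun k => ⟨(hG _).3, (hG _).1.integrableOn hQ (hqn _),
        (hG _).2.integrableOn hQ (hpn _), (hG _).ae_hasZeroSymGrad hΩv (hqn _) (hpn _)⟩)
      hg hfg hC hC' (fun r hr hrq => hκt.eventually (hbq r hr hrq))
      fun r hr hrp => hκt.eventually (hbp r hr hrp)
  refine ⟨fun k => κ k + N, hκN, fun z => (g z).fst,
    hgpair.mem_bochnerSpace hΩo hΩv hq.1 hp.1, ?_⟩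
  rintro r s hr hs ⟨ε₁, hε₁, hrq⟩ ⟨ε₂, hε₂, hsp⟩
  -- With ε below both gaps, r + ε and s + ε are still strictly below q and p, leaving room for the
  -- interpolation.
  obtain ⟨ε, hε, hεm⟩ := exists_between (lt_min hε₁ hε₂)
  have hε1 : ε < ε₁ := hεm.trans_le (min_le_left _ _)
  have hε2 : ε < ε₂ := hεm.trans_le (min_le_right _ _)
  have hrε := hr.add_const hε.le
  have hsε := hs.add_const hε.le
  have hpair : ∀ᶠ k in atTop, IsBochnerPair T Ω r s (un (κ k + N)) (G (κ k + N)) := by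
    refine hκt.eventually (p := fun n => IsBochnerPair T Ω r s (un n) (G n)) ?_
    filter_upwards [eventually_ae_abs_sub_le hqn_lim hε₁, eventually_ae_abs_sub_le hpn_lim hε₂]
      with n h1 h2
    refine (hG n).mono_exponent hΩv (hqn n) (hpn n) hr hs ?_ ?_
    · filter_upwards [h1, hrq] with z h3 h4
      linarith [(abs_le.1 h3).1]
    · filter_upwards [h2, hsp] with z h3 h4
      linarith [(abs_le.1 h3).1]
  have hgε : IsBochnerPair T Ω (fun z => r z + ε) (fun z => s z + ε) (fun z => (g z).fst)
      fun z => (g z).snd :=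
    hgpair.mono_exponent hΩv hq.1 hp.1 hrε hsε (hrq.mono fun z hz => by linarith)
      (hsp.mono fun z hz => by linarith)
  have hgrs : (fun z => (g z).fst) ∈ bochnerSpace T Ω r s :=
    (hgpair.mono_exponent hΩv hq.1 hp.1 hr hs (hrq.mono fun z hz => by linarith)
      (hsp.mono fun z hz => by linarith)).mem_bochnerSpace hΩo hΩv hr hs
  have hlt : ∀ ℓ, IsBoundedLinearOn (bochnerSpace T Ω r s) (bochnerNorm T Ω r s) ℓ → ∀ b,
      ℓ (fun z => (g z).fst) < b → ∀ᶠ k in atTop, ℓ (un (κ k + N)) < b := fun ℓ hℓ b hb =>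
    eventually_lt_of_isBoundedLinearOn (f := fun k => f (κ k + N)) hΩo hΩv hr hs hε hpair hgε
      hfg hC hC' (hκt.eventually (hbq _ hrε.one_le (StrictlyBelow.add_const hrq hε1)))
      (hκt.eventually (hbp _ hsε.one_le (StrictlyBelow.add_const hsp hε2))) hℓ hb
  have hmem : ∀ᶠ k in atTop, un (κ k + N) ∈ bochnerSpace T Ω r s :=
    hpair.mono fun k hk => hk.mem_bochnerSpace hΩo hΩv hr hs
  refine ⟨hmem, hgrs, fun ℓ hℓ => tendsto_order.2 ⟨fun b hb => ?_, hlt ℓ hℓ⟩⟩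
  -- The upper estimate for -ℓ is the missing lower estimate for ℓ.
  have hneg : IsBoundedLinearOn (bochnerSpace T Ω r s) (bochnerNorm T Ω r s) fun v => -ℓ v := by
    obtain ⟨B, hB⟩ := hℓ.bound
    refine ⟨fun v hv w hw => ?_, fun c v hv => ?_, B, fun v hv => ?_⟩
    · rw [hℓ.map_add v hv w hw, neg_add]
    · rw [hℓ.map_smul c v hv, mul_neg]
    · rw [abs_neg]
      exact hB v hv
  exact (hlt _ hneg (-b) (neg_lt_neg hb)).mono fun k hk => neg_lt_neg_iff.1 hk

end VarBochner

theorem proposition4p3 (d : ℕ) (hd : 2 ≤ d) (T : ℝ) (hT : 0 < T)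
    (Ω : Set (VarBochner.Vec d)) (hΩ : VarBochner.IsSimplicialLipschitzDomain Ω)
    (q p : ℝ × VarBochner.Vec d → ℝ)
    (hq : VarBochner.IsLogExponent (VarBochner.cylinder T Ω) q)
    (hp : VarBochner.IsLogExponent (VarBochner.cylinder T Ω) p)
    (hq1 : 1 < essInf q (volume.restrict (VarBochner.cylinder T Ω)))
    (hp1 : 1 < essInf p (volume.restrict (VarBochner.cylinder T Ω)))
    (qn pn : ℕ → ℝ × VarBochner.Vec d → ℝ)
    (hqn : ∀ n, VarBochner.IsBddExponent (VarBochner.cylinder T Ω) (qn n))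
    (hpn : ∀ n, VarBochner.IsBddExponent (VarBochner.cylinder T Ω) (pn n))
    (hqn_lim : Tendsto
      (fun n => eLpNorm (qn n - q) ⊤ (volume.restrict (VarBochner.cylinder T Ω))) atTop (𝓝 0))
    (hpn_lim : Tendsto
      (fun n => eLpNorm (pn n - p) ⊤ (volume.restrict (VarBochner.cylinder T Ω))) atTop (𝓝 0))
    (un : ℕ → ℝ × VarBochner.Vec d → VarBochner.Vec d)
    (hun : ∀ n, un n ∈ VarBochner.bochnerSpace T Ω (qn n) (pn n))
    (hbdd : BddAbove (Set.range fun n => VarBochner.bochnerNorm T Ω (qn n) (pn n) (un n))) :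
    ∃ κ : ℕ → ℕ, StrictMono κ ∧ ∃ u ∈ VarBochner.bochnerSpace T Ω q p,
      ∀ r s : ℝ × VarBochner.Vec d → ℝ,
        VarBochner.IsBddExponent (VarBochner.cylinder T Ω) r →
        VarBochner.IsBddExponent (VarBochner.cylinder T Ω) s →
        VarBochner.StrictlyBelow (VarBochner.cylinder T Ω) r q →
        VarBochner.StrictlyBelow (VarBochner.cylinder T Ω) s p →
          VarBochner.WeaklyTendstoIn (VarBochner.bochnerSpace T Ω r s)
            (VarBochner.bochnerNorm T Ω r s) (fun k => un (κ k)) u :=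
  VarBochner.exists_subseq_weaklyTendstoIn hΩ hq hp hq1 hp1 hqn hpn hqn_lim hpn_lim hun hbdd
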